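/- **Model.** The state $\omega\in\{0,1\}$ has prior $P(\omega=0)=\mu_0\in(0,1)$. In every period $t$ two firms simultaneously post prices $(\tau_0,\tau_1)\in[0,1]^2$, possibly at random, as measurable functions of the public history $h_t$ (all earlier prices and actions). Then consumer $t$ observes $h_t$, the prices and a private signal $s_t\in S$, and chooses an action in $\{0,1,e\}$ by a measurable (possibly randomized) rule; signals are drawn independently from $F_\omega$ conditional on $\omega$, where $F_0,F_1$ are mutually absolutely continuous probability measures. The consumer gets $1-\tau_a$ if $a=\omega$, $-\tau_a$ if $a=1-\omega$, and $0$ if $a=e$; firm $i$ gets $\tau_i$ if $a=i$ and $0$ otherwise. The public belief is $\mu_t=P(\omega=0\mid h_t)$. A strategy profile is a *myopic Bayesian Nash equilibrium* if for every $t$ and almost every realized history $h_t$: each firm's (mixed) price maximizes its expected stage payoff given $h_t$ and the other strategies in period $t$, and, for every price vector $(\tau_0,\tau_1)\in[0,1]^2$, the consumer's decision rule maximizes his expected payoff given $h_t$. Let $f_\omega$ be the density of $F_\omega$ with respect to $(F_0+F_1)/2$, $p(s)=f_0(s)/(f_0(s)+f_1(s))$ the private belief, $G_\omega(x)=F_\omega(p<x)$,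 $\underline\alpha=\inf\{x\in[0,1]:G_\omega(x)>0\}$ and $\overline\alpha=\sup\{x\in[0,1]:G_\omega(x)<1\}$ (neither depends on $\omega$). Signals are *unbounded* if $\underline\alpha=0$ and $\overline\alpha=1$, and *bounded* if $\underline\alpha>0$ and $\overline\alpha<1$. Assume that $G_0,G_1$ are continuous, and that they are differentiable on $(\underline\alpha,\overline\alpha)$ with derivatives that extend to continuous functions $g_0,g_1$ on $[\underline\alpha,\overline\alpha]$. *Vanishing likelihood* means $g_1(\underline\alpha)=g_0(\overline\alpha)=0$. **Theorem.** 1. If signals are unbounded, or bounded with vanishing likelihood, then for every prior $\mu_0\in(0,1)$ and every myopic Bayesian Nash equilibrium, $\mu_t$ converges almost surely to $1$ if $\omega=0$ and to $0$ if $\omega=1$. 2. If signals are bounded without vanishing likelihood, then for every prior $\mu_0\in(0,1)$ and every myopic Bayesian Nash equilibrium, $\mu_t$ converges almost surely to a limit $\mu_\infty$, and $\mu_\infty\in(0,1)$ with positive probability. -/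

import Mathlib

open MeasureTheory ProbabilityTheory Filter Topology
open scoped ENNReal

noncomputable section

namespace PricedHerding

/-! ## Signal structures -/

/-- A signal structure `(F₀, F₁, S)`: two mutually absolutely continuous probability measures on
the measurable space `S`; `F ω` is the law of a signal in state `ω ∈ {0, 1}`. -/
structure SignalStructure (S : Type*) [MeasurableSpace S] where
  F : Fin 2 → Measure S
  isProb : ∀ ω, IsProbabilityMeasure (F ω)
  ac01 : F 0 ≪ F 1
  ac10 : F 1 ≪ F 0

namespace SignalStructure

variable {S : Type*} [MeasurableSpace S] (E : SignalStructure S)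

instance (ω : Fin 2) : IsProbabilityMeasure (E.F ω) := E.isProb ω

/-- The Radon-Nikodym derivative `f_ω` of `F_ω` with respect to `(F₀ + F₁) / 2`. -/
def density (ω : Fin 2) (s : S) : ℝ :=
  ((E.F ω).rnDeriv ((2 : ℝ≥0∞)⁻¹ • (E.F 0 + E.F 1)) s).toReal

/-- The private belief `p(s) = f₀(s) / (f₀(s) + f₁(s))`. -/
def privateBelief (s : S) : ℝ := E.density 0 s / (E.density 0 s + E.density 1 s)

/-- `G_ω(x) = F_ω {s | p(s) < x}`. -/
def G (ω : Fin 2) (x : ℝ) : ℝ := (E.F ω).real {s | E.privateBelief s < x}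

/-- The lower bound of the private beliefs. Since `F₀` and `F₁` have the same null sets,
`0 < G ω x` does not depend on `ω`. -/
def lowerBound : ℝ := sInf {x | x ∈ Set.Icc (0 : ℝ) 1 ∧ 0 < E.G 0 x}

/-- The upper bound of the private beliefs. Since `F₀` and `F₁` have the same null sets,
`G ω x < 1` does not depend on `ω`. -/
def upperBound : ℝ := sSup {x | x ∈ Set.Icc (0 : ℝ) 1 ∧ E.G 0 x < 1}

/-- Unbounded signals. -/
def Unbounded : Prop := E.lowerBound = 0 ∧ E.upperBound = 1

/-- Bounded signals. -/
def Bounded : Prop := 0 < E.lowerBound ∧ E.upperBound < 1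

/-- The private-belief distribution functions are continuous (there are no atoms), differentiable
between the two bounds, and their derivatives extend to continuous functions `g_ω` on the closed
interval between the bounds. -/
def HasContinuousDensities (g : Fin 2 → ℝ → ℝ) : Prop :=
  ∀ ω, Continuous (E.G ω) ∧
    (∀ x ∈ Set.Ioo E.lowerBound E.upperBound, HasDerivAt (E.G ω) (g ω x) x) ∧
    ContinuousOn (g ω) (Set.Icc E.lowerBound E.upperBound)

/-- Vanishing likelihood of the densities `g`. -/
def VanishingLikelihood (g : Fin 2 → ℝ → ℝ) : Prop :=
  g 1 E.lowerBound = 0 ∧ g 0 E.upperBound = 0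

end SignalStructure

/-! ## The game -/

/-- The actions of a consumer: buy product `i`, or exit. -/
inductive Action where
  | buy (i : Fin 2) : Action
  | exit : Action

instance : MeasurableSpace Action := ⊤

/-- Price vectors `(τ₀, τ₁) ∈ [0, 1]²`. -/
abbrev Prices : Type := unitInterval × unitInterval

/-- The price of firm `i`. -/
def price (τ : Prices) (i : Fin 2) : ℝ := if i = 0 then (τ.1 : ℝ) else (τ.2 : ℝ)

/-- The consumer's payoff. -/
def utility (a : Action) (τ : Prices) (ω : Fin 2) : ℝ :=
  match a with
  | Action.buy i => (if i = ω then 1 else 0) - price τ i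
  | Action.exit => 0

/-- The stage payoff of firm `i`. -/
def profit (i : Fin 2) (a : Action) (τ : Prices) : ℝ :=
  match a with
  | Action.buy j => if j = i then price τ i else 0
  | Action.exit => 0

/-- Public histories before period `t` (periods are `0, 1, 2, …`): the prices and the actions of
the `t` periods before. -/
abbrev History (t : ℕ) : Type := Fin t → Prices × Action

/-- What happens in one period: prices, private signal and action. -/
abbrev Round (S : Type*) : Type _ := (Prices × S) × Action

variable {S : Type*} [MeasurableSpace S]

/-- A strategy profile. Firms use behavioral strategies. The consumer of period `t` maps the public
history, the price vector and the private signal to a (possibly degenerate) lottery over actions. -/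
structure Profile (S : Type*) [MeasurableSpace S] where
  φ₀ : ∀ t, Kernel (History t) unitInterval
  φ₁ : ∀ t, Kernel (History t) unitInterval
  σ : ∀ t, Kernel (History t × (Prices × S)) Action
  markov₀ : ∀ t, IsMarkovKernel (φ₀ t)
  markov₁ : ∀ t, IsMarkovKernel (φ₁ t)
  markovσ : ∀ t, IsMarkovKernel (σ t)

namespace Profile

variable (p : Profile S)

instance (t : ℕ) : IsMarkovKernel (p.φ₀ t) := p.markov₀ t
instance (t : ℕ) : IsMarkovKernel (p.φ₁ t) := p.markov₁ t
instance (t : ℕ) : IsMarkovKernel (p.σ t) := p.markovσ t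

end Profile

/-! ## The probability measure induced by a profile -/

/-- The public part of a period. -/
def publicPart (r : Round S) : Prices × Action := (r.1.1, r.2)

lemma measurable_publicPart : Measurable (publicPart (S := S)) := by
  unfold publicPart; fun_prop

/-- The public history before period `n + 1`, as a function of the periods `0, …, n`. -/
def publicHistory (n : ℕ) (x : Π _ : Finset.Iic n, Round S) : History (n + 1) :=
  fun i => publicPart (x ⟨i, Finset.mem_Iic.2 (Nat.lt_succ_iff.1 i.2)⟩)

lemma measurable_publicHistory (n : ℕ) : Measurable (publicHistory (S := S) n) :=
  measurable_pi_lambda _ fun _ => measurable_publicPart.comp (measurable_pi_apply _)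

/-- The law of period `t` in state `ω` given the public history: the firms draw prices
independently, the signal is drawn from `F ω` independently of the prices, and then the consumer
acts. -/
def roundKernel (E : SignalStructure S) (p : Profile S) (ω : Fin 2) (t : ℕ) :
    Kernel (History t) (Round S) :=
  ((p.φ₀ t ×ₖ p.φ₁ t) ×ₖ Kernel.const (History t) (E.F ω)) ⊗ₖ p.σ t

instance (E : SignalStructure S) (p : Profile S) (ω : Fin 2) (t : ℕ) :
    IsMarkovKernel (roundKernel E p ω t) := by
  unfold roundKernel; infer_instance

/-- The law of period `n + 1` in state `ω` given the periods `0, …, n`. -/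
def stepKernel (E : SignalStructure S) (p : Profile S) (ω : Fin 2) (n : ℕ) :
    Kernel (Π _ : Finset.Iic n, Round S) (Round S) :=
  (roundKernel E p ω (n + 1)).comap (publicHistory n) (measurable_publicHistory n)

instance (E : SignalStructure S) (p : Profile S) (ω : Fin 2) (n : ℕ) :
    IsMarkovKernel (stepKernel E p ω n) := by
  unfold stepKernel; infer_instance

/-- The law of the whole play conditional on the state `ω`. -/
def playLaw (E : SignalStructure S) (p : Profile S) (ω : Fin 2) : Measure (ℕ → Round S) :=
  Kernel.trajMeasure (X := fun _ => Round S) (roundKernel E p ω 0 Fin.elim0)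
    (stepKernel E p ω)

/-- The weights of a belief `β` (the probability of state `0`). -/
def weight (β : ℝ) (ω : Fin 2) : ℝ := if ω = 0 then β else 1 - β

/-- The joint law of the state and the play, for the prior `μ₀ = P(ω = 0)`. -/
def jointLaw (E : SignalStructure S) (p : Profile S) (μ₀ : ℝ) :
    Measure (Fin 2 × (ℕ → Round S)) :=
  ∑ ω : Fin 2, ENNReal.ofReal (weight μ₀ ω) • (Measure.dirac ω).prod (playLaw E p ω)

/-- The public history `h_t` along a play. -/
def history (t : ℕ) (x : Fin 2 × (ℕ → Round S)) : History t := fun i => publicPart (x.2 i)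

lemma measurable_history (t : ℕ) : Measurable (history (S := S) t) :=
  measurable_pi_lambda _ fun i =>
    measurable_publicPart.comp ((measurable_pi_apply (i : ℕ)).comp measurable_snd)

/-- The public belief `μ_t = P(ω = 0 | h_t)`. -/
def publicBelief (E : SignalStructure S) (p : Profile S) (μ₀ : ℝ) (t : ℕ) :
    Fin 2 × (ℕ → Round S) → ℝ :=
  condExp (MeasurableSpace.comap (history t) inferInstance) (jointLaw E p μ₀)
    (fun x => if x.1 = 0 then 1 else 0)

/-! ## Equilibrium -/

/-- The expected payoff of a consumer with public belief `β` who uses the decision rule `d` against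
the price vector `τ`. -/
def consumerPayoff (E : SignalStructure S) (β : ℝ) (τ : Prices)
    (d : Kernel (Prices × S) Action) : ℝ :=
  ∑ ω : Fin 2, weight β ω * ∫ s, ∫ a, utility a τ ω ∂(d (τ, s)) ∂(E.F ω)

/-- The expected stage payoff of firm `i` at public belief `β`, when the firms use the mixed prices
`ψ₀`, `ψ₁` and the consumer uses the decision rule `d`. -/
def firmPayoff (E : SignalStructure S) (i : Fin 2) (β : ℝ) (ψ₀ ψ₁ : Measure unitInterval)
    (d : Kernel (Prices × S) Action) : ℝ :=
  ∑ ω : Fin 2, weight β ω *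
    ∫ τ, ∫ s, ∫ a, profit i a τ ∂(d (τ, s)) ∂(E.F ω) ∂(ψ₀.prod ψ₁)

/-- The mutual best-reply conditions in one period, at public belief `β`. -/
structure IsStageEquilibrium (E : SignalStructure S) (β : ℝ) (ψ₀ ψ₁ : Measure unitInterval)
    (d : Kernel (Prices × S) Action) : Prop where
  firm0 : ∀ τ : unitInterval,
    firmPayoff E 0 β (Measure.dirac τ) ψ₁ d ≤ firmPayoff E 0 β ψ₀ ψ₁ d
  firm1 : ∀ τ : unitInterval,
    firmPayoff E 1 β ψ₀ (Measure.dirac τ) d ≤ firmPayoff E 1 β ψ₀ ψ₁ d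
  consumer : ∀ (τ : Prices) (d' : Kernel (Prices × S) Action), IsMarkovKernel d' →
    consumerPayoff E β τ d' ≤ consumerPayoff E β τ d

/-- Myopic Bayesian Nash equilibrium: in every period `t` and for almost every realized history
`h_t`, prices and the decision rule are optimal given `h_t`; conditional on `h_t` the state has law
`(μ_t, 1 - μ_t)`. The decision rule is optimal against every price vector. -/
def IsMyopicEquilibrium (E : SignalStructure S) (μ₀ : ℝ) (p : Profile S) : Prop :=
  ∀ t : ℕ, ∀ᵐ x ∂(jointLaw E p μ₀),
    IsStageEquilibrium E (publicBelief E p μ₀ t x) (p.φ₀ t (history t x)) (p.φ₁ t (history t x))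
      ((p.σ t).sectR (history t x))

/-! ## Learning -/

/-- Learning holds: almost surely the public belief converges to the point belief on the realized
state. -/
def LearningHolds (E : SignalStructure S) (μ₀ : ℝ) (p : Profile S) : Prop :=
  ∀ᵐ x ∂(jointLaw E p μ₀),
    Tendsto (fun t => publicBelief E p μ₀ t x) atTop (𝓝 (if x.1 = 0 then 1 else 0))

/-- Asymptotic learning holds: learning holds for every interior prior and every myopic
equilibrium. -/
def AsymptoticLearning (E : SignalStructure S) : Prop :=
  ∀ μ₀ ∈ Set.Ioo (0 : ℝ) 1, ∀ p : Profile S, IsMyopicEquilibrium E μ₀ p → LearningHolds E μ₀ p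

/-- Asymptotic learning never holds: for every interior prior and every myopic equilibrium, the
public belief almost surely converges, and with positive probability its limit is interior. -/
def AsymptoticLearningNeverHolds (E : SignalStructure S) : Prop :=
  ∀ μ₀ ∈ Set.Ioo (0 : ℝ) 1, ∀ p : Profile S, IsMyopicEquilibrium E μ₀ p →
    (∀ᵐ x ∂(jointLaw E p μ₀), ∃ l, Tendsto (fun t => publicBelief E p μ₀ t x) atTop (𝓝 l)) ∧
    0 < jointLaw E p μ₀
      {x | ∃ l ∈ Set.Ioo (0 : ℝ) 1, Tendsto (fun t => publicBelief E p μ₀ t x) atTop (𝓝 l)}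

end PricedHerding

end

open PricedHerding

/-!
The public belief is a bounded martingale, so it converges almost surely, and its limit is the
probability of state `0` given all public histories (`tendsto_publicBelief`). Everything depends on
what a single purchase can reveal at a given public belief `β`.

Optimal consumers compare the posterior belief that product `0` is the better one with two
thresholds that depend on the prices only (`threshold₀`, `threshold₁`): product `0` is bought above
the first, product `1` below the second (`ae_decision_eq_dirac`; ties are null because the private
belief has no atoms). Hence the firms play a pricing game whose only primitive is the distribution
function `N` of the posterior belief (`IsPriceEquilibrium`, `posteriorCDF`), and the purchase of a
period reveals the amount `disclosure`, which is positive exactly when a threshold falls strictly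
inside the range of the posterior belief.

*Learning.* With unbounded signals, or with densities that vanish at the ends of a bounded support,
no pricing equilibrium keeps the thresholds away from the interior of the support: either a firm
secures a profit by a price that only favourable signals accept, or, where `N` is flat near an end
of its support, raising the price by a small amount loses almost no customers, so serving the whole
market is not optimal. The probability of an interior threshold is bounded below uniformly for `β`
in a compact interval (`Unbounded.exists_disclosure_ge`,
`VanishingLikelihood.exists_disclosure_ge`). A martingale whose next step would keep a
non-negligible variance cannot converge to an interior point, so the limit is `0` or `1`
(`limitBelief_eq_zero_or_one`), and it is then the right one, because it is a conditional
probability (`learningHolds_of_limitBelief`).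

*Failure of learning.* If signals are bounded and, say, `g 1` does not vanish at the lower bound,
the distribution function `N` leaves `0` with a slope that becomes arbitrarily steep as `β` tends
to `1`. Every price rise beyond the one that serves the whole market then costs firm `0` more
customers than it brings in, so that in equilibrium firm `0` serves the whole market once `β` is
close to `1` (`exists_forall_market_capture_zero`), and purchases reveal nothing. The belief
therefore stops moving near `1` and cannot reach `1` in the limit (`limitBelief_ne_of_stuck`). If
the limit were almost surely not interior, it would then be almost surely `0`, while its expectation
is the prior (`limitBelief_interior`). The case in which `g 0` does not vanish at the upper bound is
the mirror image: `reflect` exchanges the roles of the firms and of the states.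
-/

noncomputable section

namespace PricedHerding

/-! ### The law of the public history -/

section Law

variable {S : Type*} [MeasurableSpace S] (E : SignalStructure S) (p : Profile S)

/-- The law of the prices and the action of period `t` in state `ω`, given the public history. -/
def publicKernel (ω : Fin 2) (t : ℕ) : Kernel (History t) (Prices × Action) :=
  (roundKernel E p ω t).map publicPart

instance (ω : Fin 2) (t : ℕ) : IsMarkovKernel (publicKernel E p ω t) :=
  Kernel.IsMarkovKernel.map _ measurable_publicPart

/-- The public history before period `t`, as a function of the play alone. -/
def playHistory (t : ℕ) (y : ℕ → Round S) : History t := fun i => publicPart (y i)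

lemma measurable_playHistory (t : ℕ) : Measurable (playHistory (S := S) t) :=
  measurable_pi_lambda _ fun i => measurable_publicPart.comp (measurable_pi_apply (i : ℕ))

/-- The law of the public history before period `t` in state `ω`. -/
def historyLaw (ω : Fin 2) (t : ℕ) : Measure (History t) := (playLaw E p ω).map (playHistory t)

instance (ω : Fin 2) : IsProbabilityMeasure (playLaw E p ω) := by
  unfold playLaw; infer_instance

instance (ω : Fin 2) (t : ℕ) : IsProbabilityMeasure (historyLaw E p ω t) :=
  Measure.isProbabilityMeasure_map (measurable_playHistory t).aemeasurable

/-- The law of the first coordinate under the Ionescu-Tulcea measure. -/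
lemma map_zero_trajMeasure {X : ℕ → Type*} [∀ n, MeasurableSpace (X n)]
    (μ₀ : Measure (X 0)) [IsProbabilityMeasure μ₀]
    (κ : (n : ℕ) → Kernel (Π i : Finset.Iic n, X i) (X (n + 1))) [∀ n, IsMarkovKernel (κ n)] :
    (Kernel.trajMeasure μ₀ κ).map (fun y => y 0) = μ₀ := by
  let e : (Π i : Finset.Iic 0, X i) → X 0 := fun z => z ⟨0, Finset.mem_Iic.2 le_rfl⟩
  have he : Measurable e := measurable_pi_apply _
  have h1 : (fun y : Π n, X n => y 0) = e ∘ (Preorder.frestrictLe 0) := rfl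
  rw [h1, ← Measure.map_map he (by fun_prop), Kernel.trajMeasure,
    Measure.map_comp _ _ (by fun_prop), Kernel.traj_map_frestrictLe, Kernel.partialTraj_self,
    Measure.id_comp]
  exact (Measure.map_map he (MeasurableEquiv.measurable
    (MeasurableEquiv.piUnique (fun i : Finset.Iic 0 => X i)).symm)).trans Measure.map_id

/-- The public kernel is a regular conditional law of the public part of period `t` given the
public history. -/
lemma map_playHistory_publicPart (ω : Fin 2) (t : ℕ) :
    (playLaw E p ω).map (fun y => (playHistory t y, publicPart (y t)))
      = historyLaw E p ω t ⊗ₘ publicKernel E p ω t := by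
  have hpub := measurable_publicPart (S := S)
  have hm : Measurable (fun y : ℕ → Round S => (playHistory t y, publicPart (y t))) :=
    (measurable_playHistory t).prodMk (hpub.comp (measurable_pi_apply t))
  refine Measure.ext_of_lintegral _ fun f hf => ?_
  rw [lintegral_map hf hm, Measure.lintegral_compProd hf, historyLaw,
    lintegral_map hf.lintegral_kernel_prod_right' (measurable_playHistory t)]
  have hk : ∀ h : History t, ∫⁻ r, f (h, r) ∂(publicKernel E p ω t h)
      = ∫⁻ r, f (h, publicPart r) ∂(roundKernel E p ω t h) := fun h => by
    rw [publicKernel, Kernel.map_apply _ hpub, lintegral_map (by fun_prop) hpub]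
  simp_rw [hk]
  cases t with
  | zero =>
    have hu : ∀ y : ℕ → Round S, playHistory 0 y = Fin.elim0 := fun y => Subsingleton.elim _ _
    simp_rw [hu, lintegral_const, measure_univ, mul_one]
    have h0 := map_zero_trajMeasure (X := fun _ => Round S)
      (roundKernel E p ω 0 Fin.elim0) (stepKernel E p ω)
    conv_rhs => rw [← h0]
    rw [lintegral_map (by fun_prop) (measurable_pi_apply 0)]
    rfl
  | succ n =>
    have h0 := Kernel.map_frestrictLe_trajMeasure_compProd_eq_map_trajMeasure
      (X := fun _ => Round S) (μ₀ := roundKernel E p ω 0 Fin.elim0) (κ := stepKernel E p ω)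
      (a := n)
    have hph := measurable_publicHistory (S := S) n
    have hg : Measurable (fun z : (Π _ : Finset.Iic n, Round S) × Round S =>
        f (publicHistory n z.1, publicPart z.2)) := by fun_prop
    have h1 := congrArg (fun M => ∫⁻ z, f (publicHistory n z.1, publicPart z.2) ∂M) h0
    rw [Measure.lintegral_compProd hg, lintegral_map hg (by fun_prop),
      lintegral_map hg.lintegral_kernel_prod_right' (by fun_prop)] at h1
    exact h1.symm

lemma playHistory_succ {S : Type*} (t : ℕ) (y : ℕ → Round S) :
    playHistory (t + 1) y = Fin.snoc (α := fun _ => Prices × Action) (playHistory t y)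
      (publicPart (y t)) := by
  funext i
  refine Fin.lastCases ?_ (fun j => ?_) i
  · simp [playHistory]
  · simp [playHistory]

lemma measurable_snoc (t : ℕ) : Measurable (fun z : History t × (Prices × Action) =>
    (Fin.snoc (α := fun _ => Prices × Action) z.1 z.2 : History (t + 1))) := by
  refine measurable_pi_lambda _ fun i => ?_
  refine Fin.lastCases ?_ (fun j => ?_) i
  · simpa using measurable_snd
  · simp only [Fin.snoc_castSucc]
    exact (measurable_pi_apply j).comp measurable_fst

lemma historyLaw_succ (ω : Fin 2) (t : ℕ) :
    historyLaw E p ω (t + 1) = (historyLaw E p ω t ⊗ₘ publicKernel E p ω t).map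
      (fun z => Fin.snoc (α := fun _ => Prices × Action) z.1 z.2) := by
  have hm : Measurable (fun y : ℕ → Round S => (playHistory t y, publicPart (y t))) :=
    (measurable_playHistory t).prodMk (measurable_publicPart.comp (measurable_pi_apply t))
  rw [← map_playHistory_publicPart, Measure.map_map (measurable_snoc t) hm, historyLaw]
  congr 1
  funext y
  exact playHistory_succ t y

lemma SignalStructure.absolutelyContinuous (ω ω' : Fin 2) : E.F ω ≪ E.F ω' := by
  fin_cases ω <;> fin_cases ω'
  exacts [Measure.AbsolutelyContinuous.rfl, E.ac01, E.ac10, Measure.AbsolutelyContinuous.rfl]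

lemma publicKernel_absolutelyContinuous (ω ω' : Fin 2) (t : ℕ) (h : History t) :
    publicKernel E p ω t h ≪ publicKernel E p ω' t h := by
  rw [publicKernel, publicKernel, Kernel.map_apply _ measurable_publicPart,
    Kernel.map_apply _ measurable_publicPart]
  refine Measure.AbsolutelyContinuous.map ?_ measurable_publicPart
  rw [roundKernel, roundKernel, Kernel.compProd_apply_eq_compProd_sectR,
    Kernel.compProd_apply_eq_compProd_sectR]
  simp only [Kernel.prod_apply, Kernel.const_apply]
  refine Measure.AbsolutelyContinuous.compProd_left ?_ _
  exact Measure.AbsolutelyContinuous.prod Measure.AbsolutelyContinuous.rfl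
    (E.absolutelyContinuous ω ω')

/-- No finite public history excludes a state. -/
lemma historyLaw_absolutelyContinuous (ω ω' : Fin 2) (t : ℕ) :
    historyLaw E p ω t ≪ historyLaw E p ω' t := by
  induction t with
  | zero =>
    have : historyLaw E p ω 0 = historyLaw E p ω' 0 := by
      ext s hs
      rcases Set.eq_empty_or_nonempty s with rfl | ⟨a, ha⟩
      · simp
      · have : s = Set.univ := Set.eq_univ_of_forall fun b => Subsingleton.elim a b ▸ ha
        simp [this]
    rw [this]
  | succ t ih =>
    rw [historyLaw_succ, historyLaw_succ]
    refine Measure.AbsolutelyContinuous.map ?_ (measurable_snoc t)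
    exact Measure.AbsolutelyContinuous.compProd ih
      (ae_of_all _ fun h => publicKernel_absolutelyContinuous E p ω ω' t h)

end Law

/-! ### Public beliefs -/

section Belief

variable {S : Type*} [MeasurableSpace S] (E : SignalStructure S) (p : Profile S) {μ₀ : ℝ}

/-- The indicator of the state `ω`. -/
def stateInd {S : Type*} (ω : Fin 2) (x : Fin 2 × (ℕ → Round S)) : ℝ := if x.1 = ω then 1 else 0

lemma measurable_stateInd (ω : Fin 2) : Measurable (stateInd (S := S) ω) := by
  have : Measurable (fun i : Fin 2 => if i = ω then (1 : ℝ) else 0) := measurable_of_finite _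
  exact this.comp measurable_fst

lemma stateInd_one {S : Type*} (x : Fin 2 × (ℕ → Round S)) :
    stateInd 1 x = 1 - stateInd 0 x := by
  unfold stateInd
  rcases x with ⟨i, y⟩
  fin_cases i <;> simp

lemma stateInd_mem {S : Type*} (ω : Fin 2) (x : Fin 2 × (ℕ → Round S)) :
    stateInd ω x ∈ Set.Icc (0 : ℝ) 1 := by
  unfold stateInd; split_ifs <;> simp

lemma weight_pos (hμ : μ₀ ∈ Set.Ioo (0 : ℝ) 1) (ω : Fin 2) : 0 < weight μ₀ ω := by
  unfold weight; split_ifs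
  · exact hμ.1
  · linarith [hμ.2]

lemma isProbabilityMeasure_jointLaw (hμ : μ₀ ∈ Set.Ioo (0 : ℝ) 1) :
    IsProbabilityMeasure (jointLaw E p μ₀) := by
  constructor
  have h0 := hμ.1.le
  have h1 : 0 ≤ 1 - μ₀ := by linarith [hμ.2]
  simp [jointLaw, weight, ← ENNReal.ofReal_add h0 h1]

lemma integrable_stateInd (hμ : μ₀ ∈ Set.Ioo (0 : ℝ) 1) (ω : Fin 2) :
    Integrable (stateInd (S := S) ω) (jointLaw E p μ₀) :=
  have := isProbabilityMeasure_jointLaw E p hμ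
  Integrable.of_bound (measurable_stateInd ω).aestronglyMeasurable 1
    (ae_of_all _ fun x => by
      have := stateInd_mem ω x
      rw [Real.norm_eq_abs, abs_of_nonneg this.1]; exact this.2)

/-- Expectations under the joint law of the state and the play. -/
lemma integral_jointLaw (hμ : μ₀ ∈ Set.Ioo (0 : ℝ) 1) {F : Fin 2 × (ℕ → Round S) → ℝ}
    (hF : Measurable F) {M : ℝ} (hM : ∀ x, |F x| ≤ M) :
    ∫ x, F x ∂(jointLaw E p μ₀) = ∑ ω, weight μ₀ ω * ∫ y, F (ω, y) ∂(playLaw E p ω) := by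
  have hint : ∀ ω : Fin 2, Integrable F
      (ENNReal.ofReal (weight μ₀ ω) • (Measure.dirac ω).prod (playLaw E p ω)) := fun ω =>
    (Integrable.of_bound hF.aestronglyMeasurable M (ae_of_all _ hM)).smul_measure
      ENNReal.ofReal_ne_top
  rw [jointLaw, integral_finsetSum_measure fun ω _ => hint ω]
  refine Finset.sum_congr rfl fun ω _ => ?_
  rw [integral_smul_measure, ENNReal.toReal_ofReal (weight_pos hμ ω).le, Measure.dirac_prod,
    integral_map (by fun_prop) hF.aestronglyMeasurable, smul_eq_mul]

lemma integral_stateInd_mul (hμ : μ₀ ∈ Set.Ioo (0 : ℝ) 1) (ω : Fin 2) {F : (ℕ → Round S) → ℝ}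
    (hF : Measurable F) {M : ℝ} (hM : ∀ x, |F x| ≤ M) :
    ∫ x, stateInd ω x * F x.2 ∂(jointLaw E p μ₀) = weight μ₀ ω * ∫ y, F y ∂(playLaw E p ω) := by
  rw [integral_jointLaw E p hμ (M := M) (F := fun x => stateInd ω x * F x.2)
    ((measurable_stateInd ω).mul (hF.comp measurable_snd))]
  · fin_cases ω <;> simp [stateInd]
  · intro x
    have := stateInd_mem ω x
    rw [abs_mul, abs_of_nonneg this.1]
    exact (mul_le_of_le_one_left (abs_nonneg _) this.2).trans (hM _)

/-- The expectation of `Φ` over the prices and the action of period `t` in state `ω`, given the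
public history. -/
def publicMean (ω : Fin 2) (t : ℕ) (Φ : History t × (Prices × Action) → ℝ) (h : History t) : ℝ :=
  ∫ r, Φ (h, r) ∂(publicKernel E p ω t h)

lemma measurable_publicMean (ω : Fin 2) (t : ℕ) {Φ : History t × (Prices × Action) → ℝ}
    (hΦ : Measurable Φ) : Measurable (publicMean E p ω t Φ) :=
  (hΦ.stronglyMeasurable.integral_kernel_prod_right').measurable

lemma abs_publicMean_le (ω : Fin 2) (t : ℕ) {Φ : History t × (Prices × Action) → ℝ}
    {M : ℝ} (hM : ∀ x, |Φ x| ≤ M) (h : History t) : |publicMean E p ω t Φ h| ≤ M := by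
  have := norm_integral_le_of_norm_le_const (μ := publicKernel E p ω t h)
    (f := fun r => Φ (h, r)) (C := M) (ae_of_all _ fun r => hM _)
  simpa [publicMean] using this

lemma integral_playLaw_round (ω : Fin 2) (t : ℕ) {Φ : History t × (Prices × Action) → ℝ}
    (hΦ : Measurable Φ) {M : ℝ} (hM : ∀ x, |Φ x| ≤ M) :
    ∫ y, Φ (playHistory t y, publicPart (y t)) ∂(playLaw E p ω)
      = ∫ y, publicMean E p ω t Φ (playHistory t y) ∂(playLaw E p ω) := by
  have hm : Measurable (fun y : ℕ → Round S => (playHistory t y, publicPart (y t))) :=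
    (measurable_playHistory t).prodMk (measurable_publicPart.comp (measurable_pi_apply t))
  rw [← integral_map (f := Φ) hm.aemeasurable hΦ.aestronglyMeasurable,
    map_playHistory_publicPart, Measure.integral_compProd
      (Integrable.of_bound hΦ.aestronglyMeasurable M (ae_of_all _ hM)), historyLaw,
    integral_map (measurable_playHistory t).aemeasurable]
  · rfl
  · exact (measurable_publicMean E p ω t hΦ).aestronglyMeasurable

/-- Given the state and the public history, the prices and the action of a period follow the public
kernel of that state. -/
lemma integral_stateInd_round (hμ : μ₀ ∈ Set.Ioo (0 : ℝ) 1) (ω : Fin 2) (t : ℕ)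
    {Φ : History t × (Prices × Action) → ℝ}
    (hΦ : Measurable Φ) {M : ℝ} (hM : ∀ x, |Φ x| ≤ M) :
    ∫ x, stateInd ω x * Φ (history t x, publicPart (x.2 t)) ∂(jointLaw E p μ₀)
      = ∫ x, stateInd ω x * publicMean E p ω t Φ (history t x) ∂(jointLaw E p μ₀) := by
  have hm : Measurable (fun y : ℕ → Round S => (playHistory t y, publicPart (y t))) :=
    (measurable_playHistory t).prodMk (measurable_publicPart.comp (measurable_pi_apply t))
  have h1 := integral_stateInd_mul E p hμ ω
    (F := fun y => Φ (playHistory t y, publicPart (y t))) (hΦ.comp hm) (M := M) fun y => hM _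
  have h2 := integral_stateInd_mul E p hμ ω
    (F := fun y => publicMean E p ω t Φ (playHistory t y))
    ((measurable_publicMean E p ω t hΦ).comp (measurable_playHistory t)) (M := M)
    fun y => abs_publicMean_le E p ω t hM _
  rw [integral_playLaw_round E p ω t hΦ hM] at h1
  exact h1.trans h2.symm

/-- The public information before period `t`. -/
abbrev historySigma (S : Type*) [MeasurableSpace S] (t : ℕ) :
    MeasurableSpace (Fin 2 × (ℕ → Round S)) :=
  MeasurableSpace.comap (history (S := S) t) inferInstance

lemma historySigma_le (t : ℕ) :
    historySigma S t ≤ (inferInstance : MeasurableSpace (Fin 2 × (ℕ → Round S))) :=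
  (measurable_history t).comap_le

lemma integral_history_mul_stateInd (hμ : μ₀ ∈ Set.Ioo (0 : ℝ) 1) (t : ℕ) {f : History t → ℝ}
    (hf : Measurable f) {M : ℝ} (hM : ∀ x, |f x| ≤ M) :
    ∫ x, f (history t x) * stateInd 0 x ∂(jointLaw E p μ₀)
      = ∫ x, f (history t x) * publicBelief E p μ₀ t x ∂(jointLaw E p μ₀) := by
  have := isProbabilityMeasure_jointLaw E p hμ
  have hle := historySigma_le (S := S) t
  have hs := integrable_stateInd E p hμ 0
  have hfm : StronglyMeasurable[historySigma S t]
      (fun x => f (history t x)) :=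
    (hf.comp (comap_measurable _)).stronglyMeasurable
  have hfs : Integrable ((fun x => f (history t x)) * stateInd (S := S) 0) (jointLaw E p μ₀) :=
    hs.bdd_mul (c := M) (hf.comp (measurable_history t)).aestronglyMeasurable
      (ae_of_all _ fun x => hM _)
  have h1 := condExp_mul_of_stronglyMeasurable_left hfm hfs hs
  have h2 := integral_condExp (f := (fun x => f (history t x)) * stateInd (S := S) 0)
    (μ := jointLaw E p μ₀) hle
  rw [integral_congr_ae h1] at h2
  exact h2.symm

lemma publicBelief_mem_Icc (hμ : μ₀ ∈ Set.Ioo (0 : ℝ) 1) (t : ℕ) :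
    ∀ᵐ x ∂(jointLaw E p μ₀), publicBelief E p μ₀ t x ∈ Set.Icc (0 : ℝ) 1 := by
  have := isProbabilityMeasure_jointLaw E p hμ
  have hs := integrable_stateInd E p hμ 0
  have h0 := condExp_mono (m := historySigma S t)
    (integrable_const (μ := jointLaw E p μ₀) (0 : ℝ)) hs (ae_of_all _ fun x => (stateInd_mem 0 x).1)
  have h1 := condExp_mono (m := historySigma S t)
    hs (integrable_const (μ := jointLaw E p μ₀) (1 : ℝ))
      (ae_of_all _ fun x => (stateInd_mem 0 x).2)
  rw [condExp_const (historySigma_le t)] at h0 h1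
  filter_upwards [h0, h1] with x a b using ⟨a, b⟩

/-- The public belief is a function of the public history, with values in the unit interval. -/
lemma exists_publicBelief_eq (hμ : μ₀ ∈ Set.Ioo (0 : ℝ) 1) (t : ℕ) :
    ∃ C : History t → ℝ, Measurable C ∧ (∀ h, C h ∈ Set.Icc (0 : ℝ) 1) ∧
      ∀ᵐ x ∂(jointLaw E p μ₀), publicBelief E p μ₀ t x = C (history t x) := by
  have hsm : StronglyMeasurable[historySigma S t]
      (publicBelief E p μ₀ t) := stronglyMeasurable_condExp
  obtain ⟨C, hC, hCe⟩ := Measurable.exists_eq_measurable_comp hsm.measurable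
  refine ⟨fun h => max 0 (min (C h) 1), by fun_prop,
    fun h => ⟨le_max_left _ _, max_le zero_le_one (min_le_right _ _)⟩, ?_⟩
  filter_upwards [publicBelief_mem_Icc E p hμ t] with x hx
  have : publicBelief E p μ₀ t x = C (history t x) := congrFun hCe x
  rw [← this, min_eq_left hx.2, max_eq_right hx.1]

/-- The expected increment of the public belief, weighted by a function `Φ` of what becomes public
in period `t`: it measures how differently the two states make `Φ` behave. -/
lemma integral_mul_publicBelief_sub (hμ : μ₀ ∈ Set.Ioo (0 : ℝ) 1) (t : ℕ)
    {Φ : History t × (Prices × Action) → ℝ}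
    (hΦ : Measurable Φ) {M : ℝ} (hM : ∀ x, |Φ x| ≤ M) :
    ∫ x, Φ (history t x, publicPart (x.2 t))
        * (publicBelief E p μ₀ (t + 1) x - publicBelief E p μ₀ t x) ∂(jointLaw E p μ₀)
      = ∫ x, publicBelief E p μ₀ t x * (1 - publicBelief E p μ₀ t x)
          * (publicMean E p 0 t Φ (history t x) - publicMean E p 1 t Φ (history t x))
          ∂(jointLaw E p μ₀) := by
  have := isProbabilityMeasure_jointLaw E p hμ
  obtain ⟨C, hC, hC01, hCe⟩ := exists_publicBelief_eq E p hμ t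
  have hM0 : 0 ≤ M := (abs_nonneg _).trans
    (hM (fun _ => ((0, 0), Action.exit), ((0, 0), Action.exit)))
  set k : Fin 2 → History t → ℝ := fun ω => publicMean E p ω t Φ with hk
  have hkm : ∀ ω, Measurable (k ω) := fun ω => measurable_publicMean E p ω t hΦ
  have hkM : ∀ ω h, |k ω h| ≤ M := fun ω h => abs_publicMean_le E p ω t hM h
  have hCabs : ∀ h, |C h| ≤ 1 := fun h => by rw [abs_of_nonneg (hC01 h).1]; exact (hC01 h).2
  have hround : Measurable (fun x : Fin 2 × (ℕ → Round S) =>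
      (history t x, publicPart (x.2 t))) :=
    (measurable_history t).prodMk
      (measurable_publicPart.comp ((measurable_pi_apply t).comp measurable_snd))
  have hbd : ∀ {a b K : ℝ}, |a| ≤ K → |b| ≤ 1 → |a * b| ≤ K := fun {a b K} ha hb => by
    rw [abs_mul]
    exact (mul_le_of_le_one_right (abs_nonneg a) hb).trans ha
  have hind : ∀ ω (x : Fin 2 × (ℕ → Round S)), |stateInd ω x| ≤ 1 := fun ω x => by
    have := stateInd_mem ω x
    rw [abs_of_nonneg this.1]; exact this.2
  have hint : ∀ {F : Fin 2 × (ℕ → Round S) → ℝ}, Measurable F → (∀ x, |F x| ≤ M) →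
      Integrable F (jointLaw E p μ₀) := fun hF hFM =>
    Integrable.of_bound hF.aestronglyMeasurable M (ae_of_all _ hFM)
  have hhm := measurable_history (S := S) t
  -- the conditional law of the state given the public history
  have hpost : ∀ f : History t → ℝ, Measurable f → (∀ h, |f h| ≤ M) →
      ∫ x, stateInd 0 x * f (history t x) ∂(jointLaw E p μ₀)
        = ∫ x, f (history t x) * C (history t x) ∂(jointLaw E p μ₀) := fun f hf hfM => by
    have h1 := integral_history_mul_stateInd E p hμ t hf hfM
    calc _ = ∫ x, f (history t x) * stateInd 0 x ∂(jointLaw E p μ₀) := by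
          simp_rw [mul_comm]
      _ = _ := h1
      _ = _ := integral_congr_ae (by filter_upwards [hCe] with x hx; simp only [hx])
  -- the two terms of the increment
  have hnext : ∫ x, Φ (history t x, publicPart (x.2 t)) * publicBelief E p μ₀ (t + 1) x
      ∂(jointLaw E p μ₀) = ∫ x, k 0 (history t x) * C (history t x) ∂(jointLaw E p μ₀) := by
    have hinit : Measurable (fun h : History (t + 1) => ((fun i => h (Fin.castSucc i) : History t),
        h (Fin.last t))) := by fun_prop
    have h1 := integral_history_mul_stateInd E p hμ (t + 1) (hΦ.comp hinit) fun h => hM _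
    have h2 := integral_stateInd_round E p hμ 0 t hΦ hM
    rw [hpost _ (hkm 0) (hkM 0)] at h2
    rw [← h2]
    refine h1.symm.trans ?_
    simp_rw [mul_comm (stateInd _ _)]
    rfl
  have hcur : ∫ x, Φ (history t x, publicPart (x.2 t)) * C (history t x) ∂(jointLaw E p μ₀)
      = ∫ x, (k 0 (history t x) * C (history t x) * C (history t x)
        + (k 1 (history t x) * C (history t x)
          - k 1 (history t x) * C (history t x) * C (history t x))) ∂(jointLaw E p μ₀) := by
    have hΦC : Measurable (fun z : History t × (Prices × Action) => Φ z * C z.1) := by fun_prop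
    have hΦCM : ∀ z : History t × (Prices × Action), |Φ z * C z.1| ≤ M := fun z =>
      hbd (hM z) (hCabs _)
    have hmean : ∀ ω h, publicMean E p ω t (fun z => Φ z * C z.1) h = k ω h * C h := fun ω h => by
      simp only [publicMean, hk, integral_mul_const]
    have hkC : ∀ ω, Measurable (fun h => k ω h * C h) := fun ω => (hkm ω).mul hC
    have hkCM : ∀ ω h, |k ω h * C h| ≤ M := fun ω h => hbd (hkM ω h) (hCabs _)
    have h0 := integral_stateInd_round E p hμ 0 t hΦC hΦCM
    have h1 := integral_stateInd_round E p hμ 1 t hΦC hΦCM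
    simp_rw [hmean] at h0 h1
    rw [hpost _ (hkC 0) (hkCM 0)] at h0
    have hsplit : ∀ F : Fin 2 × (ℕ → Round S) → ℝ, Measurable F → (∀ x, |F x| ≤ M) →
        ∫ x, F x ∂(jointLaw E p μ₀) = ∫ x, stateInd 0 x * F x ∂(jointLaw E p μ₀)
          + ∫ x, stateInd 1 x * F x ∂(jointLaw E p μ₀) := fun F hF hFM => by
      rw [← integral_add]
      · congr 1; funext x; rw [stateInd_one]; ring
      · exact hint ((measurable_stateInd 0).mul hF) fun x => by
          rw [mul_comm]; exact hbd (hFM x) (hind _ _)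
      · exact hint ((measurable_stateInd 1).mul hF) fun x => by
          rw [mul_comm]; exact hbd (hFM x) (hind _ _)
    have h3 := hsplit (fun x => k 1 (history t x) * C (history t x)) ((hkC 1).comp hhm)
      fun x => hkCM 1 _
    rw [hpost _ (hkC 1) (hkCM 1)] at h3
    have h4 := hsplit (fun x => Φ (history t x, publicPart (x.2 t)) * C (history t x))
      (hΦC.comp hround) fun x => hΦCM _
    rw [h0, h1] at h4
    rw [h4, integral_add, integral_sub]
    · linarith
    · exact hint ((hkC 1).comp hhm) fun x => hkCM 1 _
    · exact hint (((hkC 1).mul hC).comp hhm) fun x => hbd (hkCM 1 _) (hCabs _)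
    · exact hint (((hkC 0).mul hC).comp hhm) fun x => hbd (hkCM 0 _) (hCabs _)
    · exact (hint ((hkC 1).comp hhm) fun x => hkCM 1 _).sub
        (hint (((hkC 1).mul hC).comp hhm) fun x => hbd (hkCM 1 _) (hCabs _))
  have hlhs : ∫ x, Φ (history t x, publicPart (x.2 t))
        * (publicBelief E p μ₀ (t + 1) x - publicBelief E p μ₀ t x) ∂(jointLaw E p μ₀)
      = ∫ x, Φ (history t x, publicPart (x.2 t)) * publicBelief E p μ₀ (t + 1) x
          ∂(jointLaw E p μ₀)
        - ∫ x, Φ (history t x, publicPart (x.2 t)) * C (history t x) ∂(jointLaw E p μ₀) := by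
    rw [← integral_sub]
    · exact integral_congr_ae (by filter_upwards [hCe] with x hx; rw [hx]; ring)
    · exact integrable_condExp.bdd_mul (c := M) (hΦ.comp hround).aestronglyMeasurable
        (ae_of_all _ fun x => hM _)
    · exact hint ((hΦ.comp hround).mul (hC.comp hhm)) fun x => hbd (hM _) (hCabs _)
  rw [hlhs, hnext, hcur, ← integral_sub]
  · refine integral_congr_ae ?_
    filter_upwards [hCe] with x hx
    rw [hx]; ring
  · exact hint (((hkm 0).mul hC).comp hhm) fun x => hbd (hkM 0 _) (hCabs _)
  · refine Integrable.add ?_ (Integrable.sub ?_ ?_)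
    · exact hint ((((hkm 0).mul hC).mul hC).comp hhm) fun x => hbd (hbd (hkM 0 _) (hCabs _))
        (hCabs _)
    · exact hint (((hkm 1).mul hC).comp hhm) fun x => hbd (hkM 1 _) (hCabs _)
    · exact hint ((((hkm 1).mul hC).mul hC).comp hhm) fun x => hbd (hbd (hkM 1 _) (hCabs _))
        (hCabs _)

/-- Finite public histories never reveal the state. -/
lemma publicBelief_mem_Ioo (hμ : μ₀ ∈ Set.Ioo (0 : ℝ) 1) (t : ℕ) :
    ∀ᵐ x ∂(jointLaw E p μ₀), publicBelief E p μ₀ t x ∈ Set.Ioo (0 : ℝ) 1 := by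
  have := isProbabilityMeasure_jointLaw E p hμ
  obtain ⟨C, hC, hC01, hCe⟩ := exists_publicBelief_eq E p hμ t
  have hhm := measurable_history (S := S) t
  have hlaw : ∀ (ω : Fin 2) (A : Set (History t)), MeasurableSet A →
      ∫ x, stateInd ω x * A.indicator 1 (history t x) ∂(jointLaw E p μ₀)
        = weight μ₀ ω * (historyLaw E p ω t).real A := fun ω A hA => by
    have h1 := integral_stateInd_mul E p hμ ω (F := fun y => A.indicator 1 (playHistory t y))
      (M := 1) ((measurable_one.indicator hA).comp (measurable_playHistory t)) fun y => by
        by_cases h : playHistory t y ∈ A <;> simp [h]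
    refine h1.trans ?_
    rw [historyLaw, measureReal_def, Measure.map_apply (measurable_playHistory t) hA,
      ← measureReal_def, ← integral_indicator_one (measurable_playHistory t hA)]
    rfl
  -- a public event that is null in one state is null in the other
  have hnull : ∀ (ω ω' : Fin 2) (A : Set (History t)), MeasurableSet A →
      ∫ x, stateInd ω x * A.indicator 1 (history t x) ∂(jointLaw E p μ₀) = 0 →
      ∫ x, stateInd ω' x * A.indicator 1 (history t x) ∂(jointLaw E p μ₀) = 0 :=
    fun ω ω' A hA h0 => by
      rw [hlaw ω A hA, mul_eq_zero, or_iff_right (weight_pos hμ ω).ne', measureReal_eq_zero_iff]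
        at h0
      rw [hlaw ω' A hA, measureReal_def, historyLaw_absolutelyContinuous E p ω' ω t h0]
      simp
  have hi : ∀ (ω : Fin 2) (A : Set (History t)), MeasurableSet A → Integrable (fun x =>
      stateInd ω x * A.indicator (1 : History t → ℝ) (history t x)) (jointLaw E p μ₀) :=
    fun ω A hA => by
      refine Integrable.of_bound (C := 1) ((measurable_stateInd ω).mul
        ((measurable_one.indicator hA).comp hhm)).aestronglyMeasurable (ae_of_all _ fun x => ?_)
      have := stateInd_mem ω x
      by_cases h : history t x ∈ A <;> simp [h, abs_of_nonneg this.1, this.2]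
  have htotal : ∀ (A : Set (History t)), MeasurableSet A →
      ∫ x, stateInd 0 x * A.indicator 1 (history t x) ∂(jointLaw E p μ₀)
        + ∫ x, stateInd 1 x * A.indicator 1 (history t x) ∂(jointLaw E p μ₀)
        = (jointLaw E p μ₀).real (history t ⁻¹' A) := fun A hA => by
    rw [← integral_add (hi 0 A hA) (hi 1 A hA), ← integral_indicator_one (hhm hA)]
    refine integral_congr_ae (ae_of_all _ fun x => ?_)
    simp only [stateInd_one x]
    by_cases h : history t x ∈ A
    · simp [h]
    · simp [h]
  have hpost : ∀ (A : Set (History t)), MeasurableSet A →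
      ∫ x, stateInd 0 x * A.indicator 1 (history t x) ∂(jointLaw E p μ₀)
        = ∫ x, A.indicator C (history t x) ∂(jointLaw E p μ₀) := fun A hA => by
    have h1 := integral_history_mul_stateInd E p hμ t (f := A.indicator 1)
      (measurable_one.indicator hA) (M := 1) fun h => by
        by_cases h' : h ∈ A <;> simp [h']
    calc _ = _ := by simp_rw [mul_comm (stateInd _ _)]
      _ = _ := h1
      _ = _ := by
        refine integral_congr_ae ?_
        filter_upwards [hCe] with x hx
        by_cases h : history t x ∈ A <;> simp [h, hx]
  have hzero : ∀ᵐ x ∂(jointLaw E p μ₀), history t x ∉ C ⁻¹' {0} := by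
    have hA : MeasurableSet (C ⁻¹' {0}) := hC (measurableSet_singleton 0)
    have h0 : ∫ x, stateInd 0 x * (C ⁻¹' {0}).indicator 1 (history t x) ∂(jointLaw E p μ₀) = 0 := by
      rw [hpost _ hA]
      refine integral_eq_zero_of_ae (ae_of_all _ fun x => ?_)
      by_cases h : history t x ∈ C ⁻¹' {0}
      · have h' : C (history t x) = 0 := h
        simp [h']
      · simp [h]
    have h1 := htotal _ hA
    rw [h0, hnull 0 1 _ hA h0, add_zero] at h1
    rw [ae_iff]
    simp only [not_not]
    exact (measureReal_eq_zero_iff).1 h1.symm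
  have hone : ∀ᵐ x ∂(jointLaw E p μ₀), history t x ∉ C ⁻¹' {1} := by
    have hA : MeasurableSet (C ⁻¹' {1}) := hC (measurableSet_singleton 1)
    have h1 := htotal _ hA
    have h2 : ∫ x, stateInd 0 x * (C ⁻¹' {1}).indicator 1 (history t x) ∂(jointLaw E p μ₀)
        = (jointLaw E p μ₀).real (history t ⁻¹' (C ⁻¹' {1})) := by
      rw [hpost _ hA, ← integral_indicator_one (hhm hA)]
      refine integral_congr_ae (ae_of_all _ fun x => ?_)
      by_cases h : history t x ∈ C ⁻¹' {1}
      · have h' : C (history t x) = 1 := h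
        simp [h']
      · have h' : ¬ C (history t x) = 1 := h
        simp [h']
    have h3 : ∫ x, stateInd 1 x * (C ⁻¹' {1}).indicator 1 (history t x) ∂(jointLaw E p μ₀) = 0 := by
      linarith
    rw [h3, hnull 1 0 _ hA h3, add_zero] at h1
    rw [ae_iff]
    simp only [not_not]
    exact (measureReal_eq_zero_iff).1 h1.symm
  filter_upwards [hCe, hzero, hone] with x hx h0 h1
  rw [hx]
  exact ⟨lt_of_le_of_ne (hC01 _).1 fun h => h0 h.symm, lt_of_le_of_ne (hC01 _).2 h1⟩

end Belief

/-! ### The limit of the public belief -/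

section Limit

variable {S : Type*} [MeasurableSpace S] (E : SignalStructure S) (p : Profile S) {μ₀ : ℝ}

lemma historySigma_mono {s t : ℕ} (h : s ≤ t) : historySigma S s ≤ historySigma S t := by
  have hm : Measurable (fun f : History t => fun i : Fin s => f (Fin.castLE h i)) := by fun_prop
  intro A hA
  obtain ⟨B, hB, rfl⟩ := hA
  exact ⟨_, hm hB, rfl⟩

/-- The filtration generated by the public histories. -/
def historyFiltration (S : Type*) [MeasurableSpace S] :
    Filtration ℕ (inferInstance : MeasurableSpace (Fin 2 × (ℕ → Round S))) where
  seq := historySigma S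
  mono' _ _ h := historySigma_mono h
  le' t := historySigma_le t

/-- The public belief in the limit: the probability of state `0` given all public histories. -/
def limitBelief (μ₀ : ℝ) : Fin 2 × (ℕ → Round S) → ℝ :=
  condExp (⨆ t, historyFiltration S t) (jointLaw E p μ₀) (stateInd 0)

lemma iSup_historyFiltration_le : (⨆ t, historyFiltration S t) ≤
    (inferInstance : MeasurableSpace (Fin 2 × (ℕ → Round S))) :=
  iSup_le fun t => (historyFiltration S).le t

lemma measurable_limitBelief : Measurable (limitBelief E p μ₀) :=
  (stronglyMeasurable_condExp.mono iSup_historyFiltration_le).measurable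

lemma tendsto_publicBelief (hμ : μ₀ ∈ Set.Ioo (0 : ℝ) 1) :
    ∀ᵐ x ∂(jointLaw E p μ₀),
      Tendsto (fun t => publicBelief E p μ₀ t x) atTop (𝓝 (limitBelief E p μ₀ x)) := by
  have := isProbabilityMeasure_jointLaw E p hμ
  exact tendsto_ae_condExp (ℱ := historyFiltration S) (stateInd 0)

lemma limitBelief_mem_Icc (hμ : μ₀ ∈ Set.Ioo (0 : ℝ) 1) :
    ∀ᵐ x ∂(jointLaw E p μ₀), limitBelief E p μ₀ x ∈ Set.Icc (0 : ℝ) 1 := by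
  filter_upwards [tendsto_publicBelief E p hμ,
    ae_all_iff.2 fun t => publicBelief_mem_Icc E p hμ t] with x hx h01
  exact isClosed_Icc.mem_of_tendsto hx (Eventually.of_forall h01)

lemma integral_limitBelief (hμ : μ₀ ∈ Set.Ioo (0 : ℝ) 1) :
    ∫ x, limitBelief E p μ₀ x ∂(jointLaw E p μ₀) = μ₀ := by
  have := isProbabilityMeasure_jointLaw E p hμ
  have h1 := integral_stateInd_mul E p hμ 0 (F := fun _ => 1) measurable_const (M := 1)
    (fun _ => by simp)
  rw [limitBelief, integral_condExp iSup_historyFiltration_le]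
  simpa [weight] using h1

/-- A limit belief that is a point belief is correct. -/
lemma learningHolds_of_limitBelief (hμ : μ₀ ∈ Set.Ioo (0 : ℝ) 1)
    (h : ∀ᵐ x ∂(jointLaw E p μ₀), limitBelief E p μ₀ x = 0 ∨ limitBelief E p μ₀ x = 1) :
    LearningHolds E μ₀ p := by
  have := isProbabilityMeasure_jointLaw E p hμ
  have hs := integrable_stateInd E p hμ 0
  have hL := measurable_limitBelief E p (μ₀ := μ₀)
  have hLi : Integrable (limitBelief E p μ₀) (jointLaw E p μ₀) := integrable_condExp
  have hb : ∀ᵐ x ∂(jointLaw E p μ₀), ‖limitBelief E p μ₀ x‖ ≤ 1 := by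
    filter_upwards [limitBelief_mem_Icc E p hμ] with x hx
    rw [Real.norm_eq_abs, abs_of_nonneg hx.1]; exact hx.2
  -- `E[(1_{ω = 0} - L)²] = E[1_{ω = 0}] - E[L²] = E[L (1 - L)] = 0`
  have hLs : Integrable (limitBelief E p μ₀ * stateInd 0) (jointLaw E p μ₀) :=
    hs.bdd_mul (c := 1) hL.aestronglyMeasurable hb
  have hLL : Integrable (fun x => limitBelief E p μ₀ x * limitBelief E p μ₀ x)
      (jointLaw E p μ₀) := hLi.bdd_mul (c := 1) hL.aestronglyMeasurable hb
  have h1 : ∫ x, limitBelief E p μ₀ x * stateInd 0 x ∂(jointLaw E p μ₀)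
      = ∫ x, limitBelief E p μ₀ x * limitBelief E p μ₀ x ∂(jointLaw E p μ₀) := by
    have h2 := condExp_mul_of_stronglyMeasurable_left (μ := jointLaw E p μ₀)
      (m := ⨆ t, historyFiltration S t) (f := limitBelief E p μ₀) stronglyMeasurable_condExp
      hLs hs
    have h3 := integral_condExp (μ := jointLaw E p μ₀) (f := limitBelief E p μ₀ * stateInd 0)
      (iSup_historyFiltration_le (S := S))
    rw [integral_congr_ae h2] at h3
    exact h3.symm
  have h2 : ∫ x, stateInd 0 x ∂(jointLaw E p μ₀)
      = ∫ x, limitBelief E p μ₀ x ∂(jointLaw E p μ₀) :=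
    (integral_condExp iSup_historyFiltration_le).symm
  have h3 : ∫ x, (stateInd 0 x - limitBelief E p μ₀ x) ^ 2 ∂(jointLaw E p μ₀) = 0 := by
    calc _ = ∫ x, ((stateInd 0 x - limitBelief E p μ₀ x) - 2 * (limitBelief E p μ₀ x
          * stateInd 0 x - limitBelief E p μ₀ x * limitBelief E p μ₀ x)) ∂(jointLaw E p μ₀) := by
          refine integral_congr_ae ?_
          filter_upwards [h] with x hx
          have : stateInd 0 x = 0 ∨ stateInd 0 x = 1 := by
            unfold stateInd; split_ifs <;> simp
          rcases hx with hx | hx <;> rcases this with h' | h' <;> rw [hx, h'] <;> norm_num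
      _ = 0 := by
          have h4 := integral_sub hLs hLL
          have h5 := integral_sub (hs.sub hLi) ((hLs.sub hLL).const_mul 2)
          simp only [Pi.mul_apply, Pi.sub_apply] at h4 h5
          rw [h5, integral_sub hs hLi, integral_const_mul, h4, h1, h2]; ring
  have h4 : ∀ᵐ x ∂(jointLaw E p μ₀), (stateInd 0 x - limitBelief E p μ₀ x) ^ 2 = 0 := by
    refine (integral_eq_zero_iff_of_nonneg (fun x => sq_nonneg _) ?_).1 h3
    refine Integrable.of_bound (C := 4) (((measurable_stateInd 0).sub hL).pow_const
      2).aestronglyMeasurable ?_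
    filter_upwards [limitBelief_mem_Icc E p hμ] with x hx
    have := stateInd_mem 0 x
    rw [Real.norm_eq_abs, abs_of_nonneg (sq_nonneg _)]
    nlinarith [hx.1, hx.2, this.1, this.2]
  filter_upwards [h4, tendsto_publicBelief E p hμ] with x hx ht
  have : limitBelief E p μ₀ x = stateInd 0 x := by
    have := pow_eq_zero_iff (two_ne_zero) |>.1 hx
    linarith
  rw [this] at ht
  exact ht

/-- The sign of a purchase: `1` for product `0`, `-1` for product `1`. -/
def purchaseSign (a : Action) : ℝ :=
  match a with
  | Action.buy i => if i = 0 then 1 else -1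
  | Action.exit => 0

lemma abs_purchaseSign_le (a : Action) : |purchaseSign a| ≤ 1 := by
  unfold purchaseSign
  rcases a with i | _
  · rcases eq_or_ne i 0 with h | h <;> simp [h]
  · simp

/-- The information disclosed by the purchase of period `t`: how much more the purchases favour
product `0` in state `0` than in state `1`. -/
def purchaseGap (t : ℕ) (h : History t) : ℝ :=
  publicMean E p 0 t (fun z => purchaseSign z.2.2) h
    - publicMean E p 1 t (fun z => purchaseSign z.2.2) h

/-- If purchases disclose information uniformly at interior beliefs, no interior belief can be the
limit. -/
lemma limitBelief_eq_zero_or_one (hμ : μ₀ ∈ Set.Ioo (0 : ℝ) 1)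
    (h : ∀ a b : ℝ, 0 < a → a < b → b < 1 → ∃ δ > 0, ∀ t, ∀ᵐ x ∂(jointLaw E p μ₀),
      publicBelief E p μ₀ t x ∈ Set.Icc a b → δ ≤ purchaseGap E p t (history t x)) :
    ∀ᵐ x ∂(jointLaw E p μ₀), limitBelief E p μ₀ x = 0 ∨ limitBelief E p μ₀ x = 1 := by
  have := isProbabilityMeasure_jointLaw E p hμ
  set P := jointLaw E p μ₀ with hP
  have hbm : ∀ t, Measurable (publicBelief E p μ₀ t) := fun t =>
    (stronglyMeasurable_condExp.mono (historySigma_le t)).measurable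
  have hb01 := ae_all_iff.2 fun t => publicBelief_mem_Icc E p hμ t
  have hsgn : Measurable purchaseSign := measurable_from_top
  have hstep : Tendsto (fun t => ∫ x, |publicBelief E p μ₀ (t + 1) x - publicBelief E p μ₀ t x| ∂P)
      atTop (𝓝 0) := by
    have h0 : ∫ x, (0 : ℝ) ∂P = 0 := by simp
    rw [← h0]
    refine tendsto_integral_of_dominated_convergence (fun _ => 1)
      (fun t => ((hbm (t + 1)).sub (hbm t)).abs.aestronglyMeasurable)
      (integrable_const _) (fun t => ?_) ?_
    · filter_upwards [hb01] with x hx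
      rw [Real.norm_eq_abs, abs_abs, abs_le]
      constructor <;> linarith [(hx t).1, (hx t).2, (hx (t + 1)).1, (hx (t + 1)).2]
    · filter_upwards [tendsto_publicBelief E p hμ] with x hx
      have := ((tendsto_add_atTop_iff_nat 1).2 hx).sub hx
      simpa using this.abs
  -- the limit avoids every compact interior interval
  have hkey : ∀ a b : ℝ, 0 < a → a < b → b < 1 →
      ∀ᵐ x ∂P, limitBelief E p μ₀ x ∉ Set.Ioo a b := by
    intro a b ha hab hb
    obtain ⟨δ, hδ, hgap⟩ := h a b ha hab hb
    let ψ : ℝ → ℝ := fun y => max 0 (min (y - a) (b - y))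
    have hψc : Continuous ψ := by fun_prop
    have hψ0 : ∀ y, 0 ≤ ψ y := fun y => le_max_left _ _
    have hψ1 : ∀ y, ψ y ≤ 1 := fun y => by
      refine max_le zero_le_one ?_
      rcases le_total y (1 / 2) with hy | hy
      · exact (min_le_left _ _).trans (by linarith)
      · exact (min_le_right _ _).trans (by linarith)
    have hψI : ∀ y, y ∉ Set.Icc a b → ψ y = 0 := fun y hy => by
      refine max_eq_left ?_
      by_contra hcon
      rw [not_le, lt_min_iff] at hcon
      exact hy ⟨by linarith [hcon.1], by linarith [hcon.2]⟩
    have hψi : ∀ t, Integrable (fun x => ψ (publicBelief E p μ₀ t x)) P := fun t =>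
      Integrable.of_bound (hψc.measurable.comp (hbm t)).aestronglyMeasurable 1
        (ae_of_all _ fun x => by
          rw [Real.norm_eq_abs, abs_of_nonneg (hψ0 _)]; exact hψ1 _)
    have hle : ∀ t, a * (1 - b) * δ * ∫ x, ψ (publicBelief E p μ₀ t x) ∂P
        ≤ ∫ x, |publicBelief E p μ₀ (t + 1) x - publicBelief E p μ₀ t x| ∂P := by
      intro t
      obtain ⟨C, hC, hC01, hCe⟩ := exists_publicBelief_eq E p hμ t
      have hΦ : Measurable (fun z : History t × (Prices × Action) =>
          ψ (C z.1) * purchaseSign z.2.2) :=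
        ((hψc.measurable.comp hC).comp measurable_fst).mul
          (hsgn.comp (measurable_snd.comp measurable_snd))
      have hΦ1 : ∀ z : History t × (Prices × Action), |ψ (C z.1) * purchaseSign z.2.2| ≤ 1 :=
        fun z => by
          rw [abs_mul, abs_of_nonneg (hψ0 _)]
          exact mul_le_one₀ (hψ1 _) (abs_nonneg _) (abs_purchaseSign_le _)
      have h1 := integral_mul_publicBelief_sub E p hμ t hΦ hΦ1
      have hmean : ∀ ω h, publicMean E p ω t (fun z => ψ (C z.1) * purchaseSign z.2.2) h
          = ψ (C h) * publicMean E p ω t (fun z => purchaseSign z.2.2) h := fun ω h => by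
        simp only [publicMean, integral_const_mul]
      simp only [hmean, ← mul_sub] at h1
      have hround : Measurable (fun x : Fin 2 × (ℕ → Round S) =>
          (history t x, publicPart (x.2 t))) :=
        (measurable_history t).prodMk
          (measurable_publicPart.comp ((measurable_pi_apply t).comp measurable_snd))
      have hincr :
          Integrable (fun x => publicBelief E p μ₀ (t + 1) x - publicBelief E p μ₀ t x) P :=
        integrable_condExp.sub integrable_condExp
      rw [← integral_const_mul]
      have hsg : Measurable (fun z : History t × (Prices × Action) => purchaseSign z.2.2) :=
        hsgn.comp (measurable_snd.comp measurable_snd)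
      have hgm : Measurable (purchaseGap E p t) :=
        (measurable_publicMean E p 0 t hsg).sub (measurable_publicMean E p 1 t hsg)
      have hgb : ∀ h, |purchaseGap E p t h| ≤ 2 := fun h => by
        have h0 := abs_publicMean_le E p 0 t (Φ := fun z => purchaseSign z.2.2) (M := 1)
          (fun z => abs_purchaseSign_le _) h
        have h1 := abs_publicMean_le E p 1 t (Φ := fun z => purchaseSign z.2.2) (M := 1)
          (fun z => abs_purchaseSign_le _) h
        unfold purchaseGap
        exact (abs_sub _ _).trans (by linarith)
      calc ∫ x, a * (1 - b) * δ * ψ (publicBelief E p μ₀ t x) ∂P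
          ≤ ∫ x, publicBelief E p μ₀ t x * (1 - publicBelief E p μ₀ t x)
            * (ψ (C (history t x)) * purchaseGap E p t (history t x)) ∂P := by
            refine integral_mono_ae ((hψi t).const_mul _) ?_ ?_
            · refine Integrable.of_bound (C := 2) (((hbm t).mul (measurable_const.sub (hbm t))).mul
                (((hψc.measurable.comp hC).comp (measurable_history t)).mul
                  (hgm.comp (measurable_history t)))).aestronglyMeasurable ?_
              filter_upwards [hb01] with x hx
              have h1 : 0 ≤ 1 - publicBelief E p μ₀ t x := by linarith [(hx t).2]
              have h2 : 1 - publicBelief E p μ₀ t x ≤ 1 := by linarith [(hx t).1]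
              rw [Real.norm_eq_abs, abs_mul, abs_mul, abs_mul, abs_of_nonneg (hx t).1,
                abs_of_nonneg h1, abs_of_nonneg (hψ0 _)]
              have h3 : publicBelief E p μ₀ t x * (1 - publicBelief E p μ₀ t x) ≤ 1 :=
                mul_le_one₀ (hx t).2 h1 h2
              have h4 : ψ (C (history t x)) * |purchaseGap E p t (history t x)| ≤ 2 := by
                have := mul_le_mul (hψ1 (C (history t x))) (hgb (history t x)) (abs_nonneg _)
                  zero_le_one
                linarith
              have h5 : 0 ≤ ψ (C (history t x)) * |purchaseGap E p t (history t x)| :=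
                mul_nonneg (hψ0 _) (abs_nonneg _)
              nlinarith [mul_nonneg (hx t).1 h1]
            · filter_upwards [hCe, hgap t] with x hx hg
              rw [← hx]
              by_cases hI : publicBelief E p μ₀ t x ∈ Set.Icc a b
              · have h1 := hg hI
                have h2 : a * (1 - b) ≤ publicBelief E p μ₀ t x * (1 - publicBelief E p μ₀ t x) :=
                  mul_le_mul hI.1 (by linarith [hI.2]) (by linarith) (by linarith [hI.1])
                have h3 : a * (1 - b) * δ ≤ publicBelief E p μ₀ t x *
                    (1 - publicBelief E p μ₀ t x) * purchaseGap E p t (history t x) :=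
                  mul_le_mul h2 h1 hδ.le (le_trans (mul_nonneg ha.le (by linarith)) h2)
                have := mul_le_mul_of_nonneg_right h3 (hψ0 (publicBelief E p μ₀ t x))
                linarith
              · simp [hψI _ hI]
        _ = ∫ x, ψ (C (history t x)) * purchaseSign (publicPart (x.2 t)).2
            * (publicBelief E p μ₀ (t + 1) x - publicBelief E p μ₀ t x) ∂P := h1.symm
        _ ≤ ∫ x, |publicBelief E p μ₀ (t + 1) x - publicBelief E p μ₀ t x| ∂P := by
            refine integral_mono_ae (hincr.bdd_mul (c := 1) (hΦ.comp hround).aestronglyMeasurable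
              (ae_of_all _ fun x => hΦ1 (history t x, publicPart (x.2 t))))
              hincr.abs (ae_of_all _ fun x => ?_)
            refine (le_abs_self _).trans ?_
            simp only
            rw [abs_mul]
            exact mul_le_of_le_one_left (abs_nonneg _) (hΦ1 (history t x, publicPart (x.2 t)))
    have hlim : Tendsto (fun t => ∫ x, ψ (publicBelief E p μ₀ t x) ∂P) atTop
        (𝓝 (∫ x, ψ (limitBelief E p μ₀ x) ∂P)) := by
      refine tendsto_integral_of_dominated_convergence (fun _ => 1)
        (fun t => (hψi t).aestronglyMeasurable) (integrable_const _)
        (fun t => ae_of_all _ fun x => ?_) ?_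
      · rw [Real.norm_eq_abs, abs_of_nonneg (hψ0 _)]; exact hψ1 _
      · filter_upwards [tendsto_publicBelief E p hμ] with x hx
        exact (hψc.tendsto _).comp hx
    have hc : 0 < a * (1 - b) * δ := by have : 0 < 1 - b := by linarith
                                        positivity
    have h0 : a * (1 - b) * δ * ∫ x, ψ (limitBelief E p μ₀ x) ∂P ≤ 0 :=
      le_of_tendsto_of_tendsto' (hlim.const_mul _) hstep hle
    have h1 : ∫ x, ψ (limitBelief E p μ₀ x) ∂P = 0 :=
      le_antisymm (by_contra fun hcon => by
        rw [not_le] at hcon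
        linarith [mul_pos hc hcon]) (integral_nonneg fun x => hψ0 _)
    have h2 : ∀ᵐ x ∂P, ψ (limitBelief E p μ₀ x) = 0 := by
      refine (integral_eq_zero_iff_of_nonneg (fun x => hψ0 _) ?_).1 h1
      exact Integrable.of_bound
        (hψc.measurable.comp (measurable_limitBelief E p)).aestronglyMeasurable 1
        (ae_of_all _ fun x => by rw [Real.norm_eq_abs, abs_of_nonneg (hψ0 _)]; exact hψ1 _)
    filter_upwards [h2] with x hx hI
    have : 0 < ψ (limitBelief E p μ₀ x) :=
      lt_max_of_lt_right (lt_min (by linarith [hI.1]) (by linarith [hI.2]))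
    linarith
  have hall : ∀ᵐ x ∂P, ∀ n : ℕ,
      limitBelief E p μ₀ x ∉ Set.Ioo (1 / ((n : ℝ) + 3)) (1 - 1 / ((n : ℝ) + 3)) := by
    refine ae_all_iff.2 fun n => hkey _ _ (by positivity) ?_ ?_
    · have h3 : 1 / ((n : ℝ) + 3) ≤ 1 / 3 :=
        one_div_le_one_div_of_le (by norm_num) (by linarith [n.cast_nonneg (α := ℝ)])
      linarith
    · have : 0 < 1 / ((n : ℝ) + 3) := by positivity
      linarith
  filter_upwards [hall, limitBelief_mem_Icc E p hμ] with x hx h01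
  by_contra hcon
  push Not at hcon
  have h0 : 0 < limitBelief E p μ₀ x := lt_of_le_of_ne h01.1 hcon.1.symm
  have h1 : limitBelief E p μ₀ x < 1 := lt_of_le_of_ne h01.2 hcon.2
  obtain ⟨n, hn⟩ := exists_nat_one_div_lt (lt_min h0 (sub_pos.2 h1))
  have h3 : 1 / ((n : ℝ) + 3) ≤ 1 / ((n : ℝ) + 1) :=
    one_div_le_one_div_of_le (by positivity) (by linarith)
  rw [lt_min_iff] at hn
  exact hx n ⟨by linarith [hn.1], by linarith [hn.2]⟩

/-- If both states induce the same law of prices and actions, nothing is learned. -/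
lemma publicBelief_succ_eq (hμ : μ₀ ∈ Set.Ioo (0 : ℝ) 1) (t : ℕ) {D : Set ℝ}
    (hD : MeasurableSet D)
    (h : ∀ᵐ x ∂(jointLaw E p μ₀), publicBelief E p μ₀ t x ∈ D →
      publicKernel E p 0 t (history t x) = publicKernel E p 1 t (history t x)) :
    ∀ᵐ x ∂(jointLaw E p μ₀), publicBelief E p μ₀ t x ∈ D →
      publicBelief E p μ₀ (t + 1) x = publicBelief E p μ₀ t x := by
  have := isProbabilityMeasure_jointLaw E p hμ
  obtain ⟨C, hC, hC01, hCe⟩ := exists_publicBelief_eq E p hμ t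
  obtain ⟨C', hC', hC01', hCe'⟩ := exists_publicBelief_eq E p hμ (t + 1)
  let Φ : History t × (Prices × Action) → ℝ := fun z => D.indicator 1 (C z.1) *
    (C' (Fin.snoc (α := fun _ => Prices × Action) z.1 z.2) - C z.1)
  have hΦ : Measurable Φ :=
    ((measurable_one.indicator hD).comp (hC.comp measurable_fst)).mul
      ((hC'.comp (measurable_snoc t)).sub (hC.comp measurable_fst))
  have hΦ1 : ∀ z, |Φ z| ≤ 1 := fun z => by
    have h1 := hC01 z.1
    have h2 := hC01' (Fin.snoc (α := fun _ => Prices × Action) z.1 z.2)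
    by_cases hz : C z.1 ∈ D
    · simp only [Φ, Set.indicator_of_mem hz, Pi.one_apply, one_mul]
      rw [abs_le]; constructor <;> linarith [h1.1, h1.2, h2.1, h2.2]
    · simp [Φ, hz]
  have h1 := integral_mul_publicBelief_sub E p hμ t hΦ hΦ1
  have h2 : ∫ x, publicBelief E p μ₀ t x * (1 - publicBelief E p μ₀ t x)
          * (publicMean E p 0 t Φ (history t x) - publicMean E p 1 t Φ (history t x))
          ∂(jointLaw E p μ₀) = 0 := by
    refine integral_eq_zero_of_ae ?_
    filter_upwards [h, hCe] with x hx hxC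
    by_cases hz : publicBelief E p μ₀ t x ∈ D
    · simp [publicMean, hx hz]
    · rw [hxC] at hz
      simp [publicMean, Φ, hz]
  rw [h2] at h1
  have h3 : ∀ᵐ x ∂(jointLaw E p μ₀), Φ (history t x, publicPart (x.2 t))
      * (publicBelief E p μ₀ (t + 1) x - publicBelief E p μ₀ t x)
      = D.indicator 1 (publicBelief E p μ₀ t x)
        * (publicBelief E p μ₀ (t + 1) x - publicBelief E p μ₀ t x) ^ 2 := by
    filter_upwards [hCe, hCe'] with x hx hx'
    have hs : history (t + 1) x = Fin.snoc (α := fun _ => Prices × Action) (history t x)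
      (publicPart (x.2 t)) := playHistory_succ t x.2
    simp only [Φ]
    rw [← hs, ← hx, ← hx']; ring
  rw [integral_congr_ae h3] at h1
  have hbm : ∀ t, Measurable (publicBelief E p μ₀ t) := fun t =>
    (stronglyMeasurable_condExp.mono (historySigma_le t)).measurable
  have hnn : ∀ x, 0 ≤ D.indicator (1 : ℝ → ℝ) (publicBelief E p μ₀ t x)
      * (publicBelief E p μ₀ (t + 1) x - publicBelief E p μ₀ t x) ^ 2 := fun x =>
    mul_nonneg (Set.indicator_nonneg (fun _ _ => zero_le_one) _) (sq_nonneg _)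
  have h4 := (integral_eq_zero_iff_of_nonneg hnn ?_).1 h1
  · filter_upwards [h4] with x hx hz
    have hx' : D.indicator (1 : ℝ → ℝ) (publicBelief E p μ₀ t x)
      * (publicBelief E p μ₀ (t + 1) x - publicBelief E p μ₀ t x) ^ 2 = 0 := hx
    rw [Set.indicator_of_mem hz, Pi.one_apply, one_mul, sq_eq_zero_iff, sub_eq_zero] at hx'
    exact hx'
  · refine Integrable.of_bound (C := 1) (((measurable_one.indicator hD).comp (hbm t)).mul
      (((hbm (t + 1)).sub (hbm t)).pow_const 2)).aestronglyMeasurable ?_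
    filter_upwards [hCe, hCe'] with x hx hx'
    have h1 := hC01 (history t x)
    have h2 := hC01' (history (t + 1) x)
    rw [Real.norm_eq_abs, abs_of_nonneg (hnn x), hx, hx']
    by_cases hz : C (history t x) ∈ D
    · simp only [Set.indicator_of_mem hz, Pi.one_apply, one_mul]
      nlinarith [h1.1, h1.2, h2.1, h2.2]
    · simp [hz]

/-- A point belief is not reached in the limit if learning stops near it. -/
lemma limitBelief_ne_of_stuck (hμ : μ₀ ∈ Set.Ioo (0 : ℝ) 1) {D : Set ℝ} (hD : IsOpen D) {e : ℝ}
    (heD : e ∈ D) (he : e ∉ Set.Ioo (0 : ℝ) 1)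
    (h : ∀ t, ∀ᵐ x ∂(jointLaw E p μ₀), publicBelief E p μ₀ t x ∈ D →
      publicKernel E p 0 t (history t x) = publicKernel E p 1 t (history t x)) :
    ∀ᵐ x ∂(jointLaw E p μ₀), limitBelief E p μ₀ x ≠ e := by
  filter_upwards [tendsto_publicBelief E p hμ,
    ae_all_iff.2 fun t => publicBelief_mem_Ioo E p hμ t,
    ae_all_iff.2 fun t => publicBelief_succ_eq E p hμ t hD.measurableSet (h t)] with x hx h01 hst hL
  rw [hL] at hx
  obtain ⟨T, hT⟩ := (hx.eventually (hD.mem_nhds heD)).exists_forall_of_atTop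
  have hconst : ∀ n, publicBelief E p μ₀ (T + n) x = publicBelief E p μ₀ T x := by
    intro n
    induction n with
    | zero => rfl
    | succ n ih => rw [← ih]; exact hst (T + n) (hT _ (by omega))
  have hlim : Tendsto (fun t => publicBelief E p μ₀ t x) atTop (𝓝 (publicBelief E p μ₀ T x)) := by
    refine tendsto_const_nhds.congr' ?_
    filter_upwards [eventually_ge_atTop T] with t ht
    obtain ⟨n, rfl⟩ := Nat.exists_eq_add_of_le ht
    exact (hconst n).symm
  exact he (tendsto_nhds_unique hx hlim ▸ h01 T)

/-- If one of the point beliefs is not reached in the limit, the limit belief is interior with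
positive probability, because its expectation is the prior. -/
lemma limitBelief_interior (hμ : μ₀ ∈ Set.Ioo (0 : ℝ) 1)
    (h : (∀ᵐ x ∂(jointLaw E p μ₀), limitBelief E p μ₀ x ≠ 0) ∨
      ∀ᵐ x ∂(jointLaw E p μ₀), limitBelief E p μ₀ x ≠ 1) :
    0 < jointLaw E p μ₀
      {x | ∃ l ∈ Set.Ioo (0 : ℝ) 1, Tendsto (fun t => publicBelief E p μ₀ t x) atTop (𝓝 l)} := by
  have := isProbabilityMeasure_jointLaw E p hμ
  rw [pos_iff_ne_zero]
  intro h0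
  have hne : ∀ᵐ x ∂(jointLaw E p μ₀), ¬ ∃ l ∈ Set.Ioo (0 : ℝ) 1,
      Tendsto (fun t => publicBelief E p μ₀ t x) atTop (𝓝 l) := by
    rw [ae_iff]; simpa only [not_not] using h0
  have hint := integral_limitBelief E p hμ
  have hpt : ∀ᵐ x ∂(jointLaw E p μ₀), limitBelief E p μ₀ x = 0 ∨ limitBelief E p μ₀ x = 1 := by
    filter_upwards [hne, tendsto_publicBelief E p hμ, limitBelief_mem_Icc E p hμ] with x hx ht h01
    by_contra hcon
    push Not at hcon
    exact hx ⟨_, ⟨lt_of_le_of_ne h01.1 hcon.1.symm, lt_of_le_of_ne h01.2 hcon.2⟩, ht⟩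
  rcases h with h | h
  · have : ∀ᵐ x ∂(jointLaw E p μ₀), limitBelief E p μ₀ x = 1 := by
      filter_upwards [h, hpt] with x hx hx' using hx'.resolve_left hx
    rw [integral_congr_ae this] at hint
    simp at hint
    linarith [hμ.2]
  · have : ∀ᵐ x ∂(jointLaw E p μ₀), limitBelief E p μ₀ x = 0 := by
      filter_upwards [h, hpt] with x hx hx' using hx'.resolve_right hx
    rw [integral_congr_ae this] at hint
    simp at hint
    linarith [hμ.1]

end Limit

/-! ### Distributions of the private belief -/

namespace SignalStructure

variable {S : Type*} [MeasurableSpace S] (E : SignalStructure S)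

lemma density_nonneg (ω : Fin 2) (s : S) : 0 ≤ E.density ω s := ENNReal.toReal_nonneg

lemma measurable_density (ω : Fin 2) : Measurable (E.density ω) :=
  (Measure.measurable_rnDeriv _ _).ennreal_toReal

lemma measurable_privateBelief : Measurable E.privateBelief :=
  (E.measurable_density 0).div ((E.measurable_density 0).add (E.measurable_density 1))

lemma privateBelief_mem (s : S) : E.privateBelief s ∈ Set.Icc (0 : ℝ) 1 := by
  have h0 := E.density_nonneg 0 s
  have h1 := E.density_nonneg 1 s
  exact ⟨div_nonneg h0 (add_nonneg h0 h1), div_le_one_of_le₀ (by linarith) (by linarith)⟩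

/-- The density of `F ω` with respect to `F 0 + F 1`. -/
def beliefWeight (ω : Fin 2) (s : S) : ℝ :=
  if ω = 0 then E.privateBelief s else 1 - E.privateBelief s

lemma measurable_beliefWeight (ω : Fin 2) : Measurable (E.beliefWeight ω) := by
  unfold beliefWeight
  split_ifs
  · exact E.measurable_privateBelief
  · exact measurable_const.sub E.measurable_privateBelief

lemma beliefWeight_mem (ω : Fin 2) (s : S) : E.beliefWeight ω s ∈ Set.Icc (0 : ℝ) 1 := by
  have := E.privateBelief_mem s
  unfold beliefWeight
  split_ifs
  · exact this
  · exact ⟨by linarith [this.2], by linarith [this.1]⟩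

lemma beliefWeight_mul (ω : Fin 2) (s : S) :
    E.beliefWeight ω s * (E.density 0 s + E.density 1 s) = E.density ω s := by
  have h0 := E.density_nonneg 0 s
  have h1 := E.density_nonneg 1 s
  rcases eq_or_ne (E.density 0 s + E.density 1 s) 0 with h | h
  · have h0' : E.density 0 s = 0 := by linarith
    have h1' : E.density 1 s = 0 := by linarith
    fin_cases ω <;> simp [h0', h1']
  · fin_cases ω
    · exact div_mul_cancel₀ _ h
    · change (1 - E.density 0 s / (E.density 0 s + E.density 1 s)) * _ = E.density 1 s
      rw [sub_mul, div_mul_cancel₀ _ h]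
      ring

/-- The private belief is a likelihood ratio: `F ω` has density `p` or `1 - p` with respect to
`F 0 + F 1`. -/
lemma F_eq_withDensity (ω : Fin 2) :
    E.F ω = (E.F 0 + E.F 1).withDensity (fun s => ENNReal.ofReal (E.beliefWeight ω s)) := by
  set ν : Measure S := (2 : ℝ≥0∞)⁻¹ • (E.F 0 + E.F 1) with hν
  have hfin : IsFiniteMeasure ν := by
    rw [hν]; exact Measure.smul_finite _ (by simp)
  have hac : ∀ ω, E.F ω ≪ ν := fun ω => by
    refine Measure.AbsolutelyContinuous.trans (μ₂ := E.F 0 + E.F 1) ?_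
      (Measure.absolutelyContinuous_smul (ENNReal.inv_ne_zero.2 (by simp)))
    fin_cases ω
    · exact Measure.AbsolutelyContinuous.rfl.add_right _
    · rw [add_comm]; exact Measure.AbsolutelyContinuous.rfl.add_right _
  have hwd : ∀ ω, E.F ω = ν.withDensity ((E.F ω).rnDeriv ν) := fun ω =>
    (Measure.withDensity_rnDeriv_eq _ _ (hac ω)).symm
  have hr : ∀ ω, ∀ᵐ s ∂ν, (E.F ω).rnDeriv ν s = ENNReal.ofReal (E.density ω s) := fun ω => by
    filter_upwards [Measure.rnDeriv_lt_top (E.F ω) ν] with s hs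
    exact (ENNReal.ofReal_toReal hs.ne).symm
  have hsum : E.F 0 + E.F 1 = ν.withDensity ((E.F 0).rnDeriv ν + (E.F 1).rnDeriv ν) := by
    rw [withDensity_add_left (Measure.measurable_rnDeriv _ _), ← hwd 0, ← hwd 1]
  conv_rhs => rw [hsum]
  rw [← withDensity_mul _ ((Measure.measurable_rnDeriv _ _).add (Measure.measurable_rnDeriv _ _))
    (E.measurable_beliefWeight ω).ennreal_ofReal]
  conv_lhs => rw [hwd ω]
  refine withDensity_congr_ae ?_
  filter_upwards [hr 0, hr 1, hr ω] with s h0 h1 h2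
  rw [Pi.mul_apply, Pi.add_apply, h0, h1, h2,
    ← ENNReal.ofReal_add (E.density_nonneg 0 s) (E.density_nonneg 1 s),
    ← ENNReal.ofReal_mul (add_nonneg (E.density_nonneg 0 s) (E.density_nonneg 1 s)),
    mul_comm, E.beliefWeight_mul]

lemma integral_F (ω : Fin 2) (φ : S → ℝ) :
    ∫ s, φ s ∂(E.F ω) = ∫ s, E.beliefWeight ω s * φ s ∂(E.F 0 + E.F 1) := by
  conv_lhs => rw [E.F_eq_withDensity ω]
  rw [integral_withDensity_eq_integral_toReal_smul
    (E.measurable_beliefWeight ω).ennreal_ofReal (ae_of_all _ fun s => ENNReal.ofReal_lt_top)]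
  refine integral_congr_ae (ae_of_all _ fun s => ?_)
  simp only [smul_eq_mul, ENNReal.toReal_ofReal (E.beliefWeight_mem ω s).1]

lemma measurableSet_belief_lt (x : ℝ) : MeasurableSet {s | E.privateBelief s < x} :=
  measurableSet_lt E.measurable_privateBelief measurable_const

lemma G_mono (ω : Fin 2) : Monotone (E.G ω) := fun _ _ h =>
  measureReal_mono fun _ hs => lt_of_lt_of_le hs h

lemma G_nonneg (ω : Fin 2) (x : ℝ) : 0 ≤ E.G ω x := measureReal_nonneg

lemma G_le_one (ω : Fin 2) (x : ℝ) : E.G ω x ≤ 1 := measureReal_le_one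

lemma G_eq_zero_of_nonpos (ω : Fin 2) {x : ℝ} (hx : x ≤ 0) : E.G ω x = 0 := by
  have : {s | E.privateBelief s < x} = ∅ := by
    ext s; simpa using hx.trans (E.privateBelief_mem s).1
  simp [G, this]

lemma G_eq_one_of_gt (ω : Fin 2) {x : ℝ} (hx : 1 < x) : E.G ω x = 1 := by
  have : {s | E.privateBelief s < x} = Set.univ := by
    ext s; simpa using (E.privateBelief_mem s).2.trans_lt hx
  simp [G, this]

lemma G_sub (ω : Fin 2) {x y : ℝ} (h : x ≤ y) :
    E.G ω y - E.G ω x = (E.F ω).real {s | x ≤ E.privateBelief s ∧ E.privateBelief s < y} := by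
  have : {s | x ≤ E.privateBelief s ∧ E.privateBelief s < y}
      = {s | E.privateBelief s < y} \ {s | E.privateBelief s < x} := by
    ext s; simp [and_comm]
  have hsub : {s | E.privateBelief s < x} ⊆ {s | E.privateBelief s < y} :=
    fun s hs => lt_of_lt_of_le hs h
  rw [this, measureReal_sdiff hsub (E.measurableSet_belief_lt x)]
  rfl

lemma G_sub_eq_integral (ω : Fin 2) {x y : ℝ} (h : x ≤ y) :
    E.G ω y - E.G ω x = ∫ s in {s | x ≤ E.privateBelief s ∧ E.privateBelief s < y},
      E.beliefWeight ω s ∂(E.F 0 + E.F 1) := by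
  have hm : MeasurableSet {s | x ≤ E.privateBelief s ∧ E.privateBelief s < y} :=
    (measurableSet_le measurable_const E.measurable_privateBelief).inter
      (E.measurableSet_belief_lt y)
  rw [E.G_sub ω h, ← integral_indicator_one hm, E.integral_F, ← integral_indicator hm]
  refine integral_congr_ae (ae_of_all _ fun s => ?_)
  by_cases hs : s ∈ {s | x ≤ E.privateBelief s ∧ E.privateBelief s < y} <;> simp [hs]

lemma integrable_beliefWeight (ω : Fin 2) (μ : Measure S) [IsFiniteMeasure μ] :
    Integrable (E.beliefWeight ω) μ :=
  Integrable.of_bound (E.measurable_beliefWeight ω).aestronglyMeasurable 1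
    (ae_of_all _ fun s => by
      rw [Real.norm_eq_abs, abs_of_nonneg (E.beliefWeight_mem ω s).1]
      exact (E.beliefWeight_mem ω s).2)

/-- On private beliefs below `y` the likelihood ratio of state `0` is at most `y / (1 - y)`. -/
lemma G_zero_sub_le {x y : ℝ} (h : x ≤ y) :
    (1 - y) * (E.G 0 y - E.G 0 x) ≤ y * (E.G 1 y - E.G 1 x) := by
  have hm : MeasurableSet {s | x ≤ E.privateBelief s ∧ E.privateBelief s < y} :=
    (measurableSet_le measurable_const E.measurable_privateBelief).inter
      (E.measurableSet_belief_lt y)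
  rw [E.G_sub_eq_integral 0 h, E.G_sub_eq_integral 1 h, ← integral_const_mul,
    ← integral_const_mul]
  refine setIntegral_mono_on ((E.integrable_beliefWeight 0 _).const_mul _)
    ((E.integrable_beliefWeight 1 _).const_mul _) hm fun s hs => ?_
  simp only [beliefWeight, if_true, one_ne_zero, if_false]
  nlinarith [hs.2]

/-- On private beliefs above `x` the likelihood ratio of state `0` is at least `x / (1 - x)`. -/
lemma G_one_sub_le {x y : ℝ} (h : x ≤ y) :
    x * (E.G 1 y - E.G 1 x) ≤ (1 - x) * (E.G 0 y - E.G 0 x) := by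
  have hm : MeasurableSet {s | x ≤ E.privateBelief s ∧ E.privateBelief s < y} :=
    (measurableSet_le measurable_const E.measurable_privateBelief).inter
      (E.measurableSet_belief_lt y)
  rw [E.G_sub_eq_integral 0 h, E.G_sub_eq_integral 1 h, ← integral_const_mul,
    ← integral_const_mul]
  refine setIntegral_mono_on ((E.integrable_beliefWeight 1 _).const_mul _)
    ((E.integrable_beliefWeight 0 _).const_mul _) hm fun s hs => ?_
  simp only [beliefWeight, if_true, one_ne_zero, if_false]
  nlinarith [hs.1]

lemma G_pos_of_pos (ω ω' : Fin 2) {x : ℝ} (h : 0 < E.G ω x) : 0 < E.G ω' x := by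
  refine lt_of_le_of_ne (E.G_nonneg ω' x) fun h0 => h.ne' ?_
  have h1 : E.F ω' {s | E.privateBelief s < x} = 0 := (measureReal_eq_zero_iff).1 h0.symm
  exact (measureReal_eq_zero_iff).2 (E.absolutelyContinuous ω ω' h1)

lemma G_lt_one_of_lt_one (ω ω' : Fin 2) {x : ℝ} (h : E.G ω x < 1) : E.G ω' x < 1 := by
  have hc : ∀ ω, (E.F ω).real {s | E.privateBelief s < x}ᶜ = 1 - E.G ω x := fun ω =>
    probReal_compl_eq_one_sub (E.measurableSet_belief_lt x)
  refine lt_of_le_of_ne (E.G_le_one ω' x) fun h0 => h.ne ?_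
  have h1 := hc ω'
  rw [h0, sub_self] at h1
  have h2 : E.F ω' {s | E.privateBelief s < x}ᶜ = 0 := (measureReal_eq_zero_iff).1 h1
  have h3 : (E.F ω).real {s | E.privateBelief s < x}ᶜ = 0 :=
    (measureReal_eq_zero_iff).2 (E.absolutelyContinuous ω ω' h2)
  linarith [hc ω]

lemma upperBound_le_one : E.upperBound ≤ 1 := csSup_le
  ⟨0, ⟨le_rfl, zero_le_one⟩, by rw [E.G_eq_zero_of_nonpos 0 le_rfl]; exact one_pos⟩
  fun _ hx => hx.1.2

lemma G_lt_one (ω : Fin 2) {x : ℝ} (hx : x < E.upperBound) : E.G ω x < 1 := by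
  have hne : {x | x ∈ Set.Icc (0 : ℝ) 1 ∧ E.G 0 x < 1}.Nonempty :=
    ⟨0, ⟨le_rfl, zero_le_one⟩, by rw [E.G_eq_zero_of_nonpos 0 le_rfl]; exact one_pos⟩
  obtain ⟨y, hy, hyx⟩ := exists_lt_of_lt_csSup hne hx
  exact (E.G_mono ω hyx.le).trans_lt (E.G_lt_one_of_lt_one 0 ω hy.2)

section Continuous

variable {E} (hG : ∀ ω, Continuous (E.G ω))
include hG

lemma G_one (ω : Fin 2) : E.G ω 1 = 1 := by
  have h1 : Tendsto (E.G ω) (𝓝[>] 1) (𝓝 (E.G ω 1)) := ((hG ω).tendsto 1).mono_left inf_le_left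
  have h2 : Tendsto (E.G ω) (𝓝[>] 1) (𝓝 1) := tendsto_const_nhds.congr' (by
    filter_upwards [self_mem_nhdsWithin] with x hx using (E.G_eq_one_of_gt ω hx).symm)
  exact tendsto_nhds_unique h1 h2

lemma lowerBound_nonneg : 0 ≤ E.lowerBound := le_csInf
  ⟨1, ⟨zero_le_one, le_rfl⟩, by rw [G_one hG]; exact one_pos⟩ fun _ hx => hx.1.1

lemma G_eq_zero (ω : Fin 2) {x : ℝ} (hx : x ≤ E.lowerBound) : E.G ω x = 0 := by
  have hlt : ∀ y < E.lowerBound, E.G ω y = 0 := fun y hy => by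
    by_contra h
    have h0 : 0 < E.G 0 y := E.G_pos_of_pos ω 0 (lt_of_le_of_ne (E.G_nonneg _ _) (Ne.symm h))
    have hy0 : 0 < y := by
      by_contra h'
      rw [E.G_eq_zero_of_nonpos 0 (not_lt.1 h')] at h0
      exact lt_irrefl _ h0
    rcases le_or_gt y 1 with h1 | h1
    · have : E.lowerBound ≤ y := csInf_le ⟨0, fun z hz => hz.1.1⟩ ⟨⟨hy0.le, h1⟩, h0⟩
      linarith
    · have : E.lowerBound ≤ 1 := csInf_le ⟨0, fun z hz => hz.1.1⟩
        ⟨⟨zero_le_one, le_rfl⟩, by rw [G_one hG]; exact one_pos⟩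
      linarith
  have h1 : Tendsto (E.G ω) (𝓝[<] x) (𝓝 (E.G ω x)) := ((hG ω).tendsto x).mono_left inf_le_left
  have h2 : Tendsto (E.G ω) (𝓝[<] x) (𝓝 0) := tendsto_const_nhds.congr' (by
    filter_upwards [self_mem_nhdsWithin] with y hy
      using (hlt y (lt_of_lt_of_le hy hx)).symm)
  exact tendsto_nhds_unique h1 h2

lemma G_eq_one (ω : Fin 2) {x : ℝ} (hx : E.upperBound ≤ x) : E.G ω x = 1 := by
  have hgt : ∀ y, E.upperBound < y → E.G ω y = 1 := fun y hy => by
    by_contra h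
    have h0 : E.G 0 y < 1 := E.G_lt_one_of_lt_one ω 0 (lt_of_le_of_ne (E.G_le_one _ _) h)
    have hy1 : y < 1 := by
      by_contra h'
      exact absurd (E.G_mono 0 (not_lt.1 h')) (not_le.2 (by rwa [G_one hG]))
    rcases le_or_gt 0 y with h1 | h1
    · have : y ≤ E.upperBound := le_csSup ⟨1, fun z hz => hz.1.2⟩ ⟨⟨h1, hy1.le⟩, h0⟩
      linarith
    · have : 0 ≤ E.upperBound := le_csSup ⟨1, fun z hz => hz.1.2⟩
        ⟨⟨le_rfl, zero_le_one⟩, by rw [E.G_eq_zero_of_nonpos 0 le_rfl]; exact one_pos⟩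
      linarith
  have h1 : Tendsto (E.G ω) (𝓝[>] x) (𝓝 (E.G ω x)) := ((hG ω).tendsto x).mono_left inf_le_left
  have h2 : Tendsto (E.G ω) (𝓝[>] x) (𝓝 1) := tendsto_const_nhds.congr' (by
    filter_upwards [self_mem_nhdsWithin] with y hy
      using (hgt y (lt_of_le_of_lt hx hy)).symm)
  exact tendsto_nhds_unique h1 h2

lemma G_pos (ω : Fin 2) {x : ℝ} (hx : E.lowerBound < x) : 0 < E.G ω x := by
  have hne : {x | x ∈ Set.Icc (0 : ℝ) 1 ∧ 0 < E.G 0 x}.Nonempty :=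
    ⟨1, ⟨zero_le_one, le_rfl⟩, by rw [G_one hG]; exact one_pos⟩
  obtain ⟨y, hy, hyx⟩ := exists_lt_of_csInf_lt hne hx
  exact (E.G_pos_of_pos 0 ω hy.2).trans_le (E.G_mono ω hyx.le)

lemma lowerBound_lt_upperBound : E.lowerBound < E.upperBound := by
  by_contra h
  have h0 := G_eq_zero hG 0 (le_refl E.lowerBound)
  rw [G_eq_one hG 0 (not_lt.1 h)] at h0
  exact one_ne_zero h0

/-- Private beliefs have no atoms. -/
lemma F_belief_eq (ω : Fin 2) (x : ℝ) : E.F ω {s | E.privateBelief s = x} = 0 := by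
  have h1 : (E.F ω).real {s | E.privateBelief s = x} ≤ 0 := by
    have h2 : Tendsto (fun y => E.G ω y - E.G ω x) (𝓝[>] x) (𝓝 0) := by
      have := ((hG ω).tendsto x).sub_const (E.G ω x)
      rw [sub_self] at this
      exact this.mono_left inf_le_left
    refine ge_of_tendsto h2 ?_
    filter_upwards [self_mem_nhdsWithin] with y hy
    have hy' : x < y := hy
    rw [E.G_sub ω hy'.le]
    refine measureReal_mono fun s hs => ?_
    have hs' : E.privateBelief s = x := hs
    exact ⟨hs'.ge, hs'.trans_lt hy'⟩
  exact (measureReal_eq_zero_iff).1 (le_antisymm h1 measureReal_nonneg)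

/-- Low private beliefs are less likely in state `0`. -/
lemma G_zero_le_G_one (x : ℝ) : E.G 0 x ≤ E.G 1 x := by
  rcases le_total x 0 with hx | hx
  · rw [E.G_eq_zero_of_nonpos 0 hx, E.G_eq_zero_of_nonpos 1 hx]
  rcases le_total 1 x with hx1 | hx1
  · rw [G_eq_one hG 0 ((E.upperBound_le_one).trans hx1),
      G_eq_one hG 1 ((E.upperBound_le_one).trans hx1)]
  rcases le_total x (1 / 2) with h | h
  · have h1 := E.G_zero_sub_le hx
    rw [E.G_eq_zero_of_nonpos 0 le_rfl, E.G_eq_zero_of_nonpos 1 le_rfl, sub_zero, sub_zero] at h1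
    nlinarith [E.G_nonneg 1 x]
  · have h1 := E.G_one_sub_le hx1
    rw [G_one hG, G_one hG] at h1
    nlinarith [E.G_le_one 0 x]

/-- Strictly between the bounds, low private beliefs are strictly less likely in state `0`. -/
lemma G_zero_lt_G_one {x : ℝ} (hx : x ∈ Set.Ioo E.lowerBound E.upperBound) :
    E.G 0 x < E.G 1 x := by
  have hlow : ∀ y, E.lowerBound < y → y < 1 / 2 → E.G 0 y < E.G 1 y := fun y hy h => by
    have hy0 : 0 ≤ y := (lowerBound_nonneg hG).trans hy.le
    have h1 := E.G_zero_sub_le hy0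
    rw [E.G_eq_zero_of_nonpos 0 le_rfl, E.G_eq_zero_of_nonpos 1 le_rfl, sub_zero, sub_zero] at h1
    nlinarith [G_pos hG 1 hy]
  rcases lt_trichotomy x (1 / 2) with h | h | h
  · exact hlow x hx.1 h
  · obtain ⟨y, hy, hyx⟩ := exists_between hx.1
    have h1 := hlow y hy (by linarith)
    have h2 := E.G_zero_sub_le hyx.le
    rw [h] at h2 hyx ⊢
    linarith
  · have hx1 : x ≤ 1 := hx.2.le.trans (E.upperBound_le_one)
    have h1 := E.G_one_sub_le hx1
    rw [G_one hG, G_one hG] at h1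
    nlinarith [E.G_lt_one 0 hx.2]

end Continuous

section Densities

variable {E} {g : Fin 2 → ℝ → ℝ} (hg : E.HasContinuousDensities g)
include hg

lemma HasContinuousDensities.continuous (ω : Fin 2) : Continuous (E.G ω) := (hg ω).1

/-- The mean value theorem, for intervals that may touch the two bounds. -/
lemma exists_slope_eq (ω : Fin 2) {x y : ℝ} (hx : E.lowerBound ≤ x) (hxy : x < y)
    (hy : y ≤ E.upperBound) : ∃ c ∈ Set.Ioo x y, E.G ω y - E.G ω x = g ω c * (y - x) := by
  obtain ⟨c, hc, h⟩ := exists_hasDerivAt_eq_slope (E.G ω) (g ω) hxy (hg ω).1.continuousOn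
    fun z hz => (hg ω).2.1 z ⟨hx.trans_lt hz.1, hz.2.trans_le hy⟩
  refine ⟨c, hc, ?_⟩
  rw [h, div_mul_cancel₀ _ (sub_pos.2 hxy).ne']

/-- Increments of `G ω` are controlled by a bound of its density. -/
lemma G_sub_le_of_density_le (ω : Fin 2) {κ x y : ℝ} (hκ : 0 ≤ κ) (hxy : x ≤ y)
    (h : ∀ c ∈ Set.Icc E.lowerBound E.upperBound, x ≤ c → c ≤ y → g ω c ≤ κ) :
    E.G ω y - E.G ω x ≤ κ * (y - x) := by
  have hab := lowerBound_lt_upperBound hg.continuous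
  have hx : E.G ω (max x E.lowerBound) = E.G ω x := by
    rcases le_total x E.lowerBound with h' | h'
    · rw [max_eq_right h', G_eq_zero hg.continuous ω h', G_eq_zero hg.continuous ω le_rfl]
    · rw [max_eq_left h']
  have hy : E.G ω (min y E.upperBound) = E.G ω y := by
    rcases le_total y E.upperBound with h' | h'
    · rw [min_eq_left h']
    · rw [min_eq_right h', G_eq_one hg.continuous ω h', G_eq_one hg.continuous ω le_rfl]
  rcases le_or_gt (min y E.upperBound) (max x E.lowerBound) with h' | h'
  · have := E.G_mono ω h'
    rw [hx, hy] at this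
    nlinarith [mul_nonneg hκ (sub_nonneg.2 hxy)]
  · obtain ⟨c, hc, he⟩ := exists_slope_eq hg ω (le_max_right x _) h' (min_le_right y _)
    rw [hx, hy] at he
    have h1 : g ω c ≤ κ := h c ⟨(le_max_right _ _).trans hc.1.le, hc.2.le.trans (min_le_right _ _)⟩
      ((le_max_left _ _).trans hc.1.le) (hc.2.le.trans (min_le_left _ _))
    have h2 : min y E.upperBound - max x E.lowerBound ≤ y - x :=
      sub_le_sub (min_le_left _ _) (le_max_left _ _)
    rw [he]
    exact (mul_le_mul_of_nonneg_right h1 (sub_pos.2 h').le).trans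
      (mul_le_mul_of_nonneg_left h2 hκ)

lemma exists_G_lipschitz : ∃ K : ℝ, 0 < K ∧ ∀ ω x y, x ≤ y → E.G ω y - E.G ω x ≤ K * (y - x) := by
  have hb : ∀ ω, ∃ K : ℝ, 0 < K ∧ ∀ c ∈ Set.Icc E.lowerBound E.upperBound, g ω c ≤ K := fun ω => by
    obtain ⟨K, hK⟩ := (isCompact_Icc.bddAbove_image (hg ω).2.2)
    exact ⟨max K 1, lt_max_of_lt_right one_pos, fun c hc =>
      (hK ⟨c, hc, rfl⟩).trans (le_max_left _ _)⟩
  choose K hK0 hK using hb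
  refine ⟨K 0 + K 1, add_pos (hK0 0) (hK0 1), fun ω x y hxy => ?_⟩
  have h1 := G_sub_le_of_density_le hg ω (hK0 ω).le hxy fun c hc _ _ => hK ω c hc
  refine h1.trans (mul_le_mul_of_nonneg_right ?_ (sub_nonneg.2 hxy))
  fin_cases ω
  · simpa using (hK0 1).le
  · simpa using (hK0 0).le

/-- Vanishing likelihood makes `G` flat near the lower bound, in both states. -/
lemma exists_flat_lower (h : g 1 E.lowerBound = 0) {κ : ℝ} (hκ : 0 < κ) :
    ∃ η > 0, ∀ ω x y, x ≤ y → y ≤ E.lowerBound + η → E.G ω y - E.G ω x ≤ κ * (y - x) := by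
  have hab := lowerBound_lt_upperBound hg.continuous
  have hb1 := E.upperBound_le_one
  set r := (E.upperBound - E.lowerBound) / 2 with hr
  have hr0 : 0 < r := by rw [hr]; linarith
  have hc := (hg 1).2.2 E.lowerBound ⟨le_rfl, hab.le⟩
  rw [ContinuousWithinAt, h, Metric.tendsto_nhdsWithin_nhds] at hc
  obtain ⟨η, hη, hc⟩ := hc (κ * r) (by positivity)
  have hone : ∀ x y, x ≤ y → y ≤ E.lowerBound + min (η / 2) r →
      E.G 1 y - E.G 1 x ≤ κ * r * (y - x) := fun x y hxy hy => by
    refine G_sub_le_of_density_le hg 1 (by positivity) hxy fun c hcI _ hcy => ?_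
    have := hc hcI (by
      rw [Real.dist_eq, abs_of_nonneg (by linarith [hcI.1])]
      linarith [min_le_left (η / 2) r])
    rw [Real.dist_eq, sub_zero] at this
    exact (le_abs_self _).trans this.le
  refine ⟨min (η / 2) r, lt_min (by linarith) hr0, fun ω x y hxy hy => ?_⟩
  have h1 := hone x y hxy hy
  have hr1 : r ≤ 1 := by rw [hr]; linarith [lowerBound_nonneg hg.continuous]
  have hκxy : 0 ≤ κ * (y - x) := mul_nonneg hκ.le (sub_nonneg.2 hxy)
  fin_cases ω
  · have h2 := E.G_zero_sub_le hxy
    have h3 : r ≤ 1 - y := by linarith [min_le_right (η / 2) r]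
    have h4 : 0 ≤ E.G 0 y - E.G 0 x := sub_nonneg.2 (E.G_mono 0 hxy)
    have h5 : 0 ≤ E.G 1 y - E.G 1 x := sub_nonneg.2 (E.G_mono 1 hxy)
    have h6 : r * (E.G 0 y - E.G 0 x) ≤ r * (κ * (y - x)) := by nlinarith
    exact le_of_mul_le_mul_left h6 hr0
  · have : κ * r * (y - x) ≤ κ * (y - x) := by nlinarith
    exact h1.trans this

/-- Vanishing likelihood makes `G` flat near the upper bound, in both states. -/
lemma exists_flat_upper (h : g 0 E.upperBound = 0) {κ : ℝ} (hκ : 0 < κ) :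
    ∃ η > 0, ∀ ω x y, x ≤ y → E.upperBound - η ≤ x → E.G ω y - E.G ω x ≤ κ * (y - x) := by
  have hab := lowerBound_lt_upperBound hg.continuous
  have ha0 := lowerBound_nonneg hg.continuous
  set r := (E.upperBound - E.lowerBound) / 2 with hr
  have hr0 : 0 < r := by rw [hr]; linarith
  have hc := (hg 0).2.2 E.upperBound ⟨hab.le, le_rfl⟩
  rw [ContinuousWithinAt, h, Metric.tendsto_nhdsWithin_nhds] at hc
  obtain ⟨η, hη, hc⟩ := hc (κ * r) (by positivity)
  have hzero : ∀ x y, x ≤ y → E.upperBound - min (η / 2) r ≤ x →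
      E.G 0 y - E.G 0 x ≤ κ * r * (y - x) := fun x y hxy hy => by
    refine G_sub_le_of_density_le hg 0 (by positivity) hxy fun c hcI hcx _ => ?_
    have := hc hcI (by
      rw [Real.dist_eq, abs_of_nonpos (by linarith [hcI.2])]
      linarith [min_le_left (η / 2) r])
    rw [Real.dist_eq, sub_zero] at this
    exact (le_abs_self _).trans this.le
  refine ⟨min (η / 2) r, lt_min (by linarith) hr0, fun ω x y hxy hy => ?_⟩
  have h1 := hzero x y hxy hy
  have hr1 : r ≤ 1 := by rw [hr]; linarith [E.upperBound_le_one]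
  have hκxy : 0 ≤ κ * (y - x) := mul_nonneg hκ.le (sub_nonneg.2 hxy)
  fin_cases ω
  · have : κ * r * (y - x) ≤ κ * (y - x) := by nlinarith
    exact h1.trans this
  · have h2 := E.G_one_sub_le hxy
    have h3 : r ≤ x := by linarith [min_le_right (η / 2) r]
    have h4 : 0 ≤ E.G 0 y - E.G 0 x := sub_nonneg.2 (E.G_mono 0 hxy)
    have h5 : 0 ≤ E.G 1 y - E.G 1 x := sub_nonneg.2 (E.G_mono 1 hxy)
    have h6 : r * (E.G 1 y - E.G 1 x) ≤ r * (κ * (y - x)) := by nlinarith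
    exact le_of_mul_le_mul_left h6 hr0

/-- Without vanishing likelihood at the lower bound, `G 0` has a positive slope there. -/
lemma exists_slope_lower (hpos : 0 < E.lowerBound) (h : g 1 E.lowerBound ≠ 0) :
    ∃ c > 0, ∃ η > 0, E.lowerBound + η ≤ E.upperBound ∧
      ∀ x y, E.lowerBound ≤ x → x ≤ y → y ≤ E.lowerBound + η → c * (y - x) ≤ E.G 0 y - E.G 0 x := by
  have hab := lowerBound_lt_upperBound hg.continuous
  have hc := (hg 1).2.2 E.lowerBound ⟨le_rfl, hab.le⟩
  rw [ContinuousWithinAt, Metric.tendsto_nhdsWithin_nhds] at hc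
  obtain ⟨η, hη, hc⟩ := hc (|g 1 E.lowerBound| / 2) (by have := abs_pos.2 h; linarith)
  have hη' : 0 < min (η / 2) (E.upperBound - E.lowerBound) := lt_min (by linarith) (by linarith)
  refine ⟨E.lowerBound * (|g 1 E.lowerBound| / 2), by have := abs_pos.2 h; positivity,
    min (η / 2) (E.upperBound - E.lowerBound), hη', ?_, fun x y hx hxy hy => ?_⟩
  · linarith [min_le_right (η / 2) (E.upperBound - E.lowerBound)]
  have hyb : y ≤ E.upperBound := by linarith [min_le_right (η / 2) (E.upperBound - E.lowerBound)]
  have h1 : |g 1 E.lowerBound| / 2 * (y - x) ≤ E.G 1 y - E.G 1 x := by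
    rcases hxy.eq_or_lt with rfl | hlt
    · simp
    obtain ⟨c, hcI, he⟩ := exists_slope_eq hg 1 hx hlt hyb
    have h2 := hc (x := c) ⟨hx.trans hcI.1.le, hcI.2.le.trans hyb⟩ (by
      rw [Real.dist_eq, abs_of_nonneg (by linarith [hcI.1])]
      linarith [min_le_left (η / 2) (E.upperBound - E.lowerBound), hcI.2])
    rw [Real.dist_eq, abs_lt] at h2
    have h3 : 0 ≤ g 1 c := by
      have : 0 ≤ g 1 c * (y - x) := he ▸ sub_nonneg.2 (E.G_mono 1 hxy)
      exact nonneg_of_mul_nonneg_left this (sub_pos.2 hlt)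
    rw [he]
    refine mul_le_mul_of_nonneg_right ?_ (sub_nonneg.2 hxy)
    rcases abs_cases (g 1 E.lowerBound) with h4 | h4 <;> linarith [h2.1, h2.2]
  have h2 := E.G_one_sub_le hxy
  have h3 : 0 ≤ E.G 0 y - E.G 0 x := sub_nonneg.2 (E.G_mono 0 hxy)
  have h4 : 0 ≤ E.G 1 y - E.G 1 x := sub_nonneg.2 (E.G_mono 1 hxy)
  have h5 := mul_le_mul_of_nonneg_left h1 hpos.le
  nlinarith

/-- Without vanishing likelihood at the upper bound, `G 1` has a positive slope there. -/
lemma exists_slope_upper (hlt1 : E.upperBound < 1) (h : g 0 E.upperBound ≠ 0) :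
    ∃ c > 0, ∃ η > 0, E.lowerBound ≤ E.upperBound - η ∧
      ∀ x y, E.upperBound - η ≤ x → x ≤ y → y ≤ E.upperBound →
        c * (y - x) ≤ E.G 1 y - E.G 1 x := by
  have hab := lowerBound_lt_upperBound hg.continuous
  have hc := (hg 0).2.2 E.upperBound ⟨hab.le, le_rfl⟩
  rw [ContinuousWithinAt, Metric.tendsto_nhdsWithin_nhds] at hc
  obtain ⟨η, hη, hc⟩ := hc (|g 0 E.upperBound| / 2) (by have := abs_pos.2 h; linarith)
  have hη' : 0 < min (η / 2) (E.upperBound - E.lowerBound) := lt_min (by linarith) (by linarith)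
  refine ⟨(1 - E.upperBound) * (|g 0 E.upperBound| / 2), mul_pos (by linarith)
    (by have := abs_pos.2 h; linarith),
    min (η / 2) (E.upperBound - E.lowerBound), hη', ?_, fun x y hx hxy hy => ?_⟩
  · linarith [min_le_right (η / 2) (E.upperBound - E.lowerBound)]
  have hxa : E.lowerBound ≤ x := by
    linarith [min_le_right (η / 2) (E.upperBound - E.lowerBound)]
  have h1 : |g 0 E.upperBound| / 2 * (y - x) ≤ E.G 0 y - E.G 0 x := by
    rcases hxy.eq_or_lt with rfl | hlt
    · simp
    obtain ⟨c, hcI, he⟩ := exists_slope_eq hg 0 hxa hlt hy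
    have h2 := hc (x := c) ⟨hxa.trans hcI.1.le, hcI.2.le.trans hy⟩ (by
      rw [Real.dist_eq, abs_of_nonpos (by linarith [hcI.2])]
      linarith [min_le_left (η / 2) (E.upperBound - E.lowerBound), hcI.1])
    rw [Real.dist_eq, abs_lt] at h2
    have h3 : 0 ≤ g 0 c := by
      have : 0 ≤ g 0 c * (y - x) := he ▸ sub_nonneg.2 (E.G_mono 0 hxy)
      exact nonneg_of_mul_nonneg_left this (sub_pos.2 hlt)
    rw [he]
    refine mul_le_mul_of_nonneg_right ?_ (sub_nonneg.2 hxy)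
    rcases abs_cases (g 0 E.upperBound) with h4 | h4 <;> linarith [h2.1, h2.2]
  have h2 := E.G_zero_sub_le hxy
  have h3 : 0 ≤ E.G 0 y - E.G 0 x := sub_nonneg.2 (E.G_mono 0 hxy)
  have h4 : 0 ≤ E.G 1 y - E.G 1 x := sub_nonneg.2 (E.G_mono 1 hxy)
  have h5 : (1 - E.upperBound) * (|g 0 E.upperBound| / 2 * (y - x))
      ≤ (1 - E.upperBound) * (E.G 0 y - E.G 0 x) := mul_le_mul_of_nonneg_left h1 (by linarith)
  have h6 : (1 - E.upperBound) * (E.G 0 y - E.G 0 x) ≤ (1 - y) * (E.G 0 y - E.G 0 x) :=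
    mul_le_mul_of_nonneg_right (by linarith) h3
  have h7 : y * (E.G 1 y - E.G 1 x) ≤ 1 * (E.G 1 y - E.G 1 x) :=
    mul_le_mul_of_nonneg_right (by linarith) h4
  linarith

end Densities

end SignalStructure

/-! ### Price competition against a distribution of posterior beliefs -/

section Pricing

/-- The posterior belief above which product `0` is bought: `q > τ₀` and `q - τ₀ > (1 - q) - τ₁`. -/
def threshold₀ (τ : Prices) : ℝ := max (τ.1 : ℝ) ((1 + τ.1 - τ.2) / 2)

/-- The posterior belief below which product `1` is bought. -/
def threshold₁ (τ : Prices) : ℝ := min (1 - (τ.2 : ℝ)) ((1 + τ.1 - τ.2) / 2)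

lemma continuous_threshold₀ : Continuous threshold₀ := by
  unfold threshold₀; fun_prop

lemma continuous_threshold₁ : Continuous threshold₁ := by
  unfold threshold₁; fun_prop

lemma le_threshold₀ (z : Prices) : (z.1 : ℝ) ≤ threshold₀ z := le_max_left _ _

lemma mid_le_threshold₀ (z : Prices) : (1 + (z.1 : ℝ) - z.2) / 2 ≤ threshold₀ z := le_max_right _ _

lemma threshold₁_le (z : Prices) : threshold₁ z ≤ 1 - (z.2 : ℝ) := min_le_left _ _

lemma threshold₁_le_mid (z : Prices) : threshold₁ z ≤ (1 + (z.1 : ℝ) - z.2) / 2 := min_le_right _ _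

/-- Equilibrium of the pricing game in which the posterior belief of the consumer has distribution
function `N` and the consumer replies optimally. -/
structure IsPriceEquilibrium (N : ℝ → ℝ) (ψ₀ ψ₁ : Measure unitInterval) : Prop where
  firm0 : ∀ x : unitInterval, ∫ y, (x : ℝ) * (1 - N (threshold₀ (x, y))) ∂ψ₁
    ≤ ∫ z : Prices, (z.1 : ℝ) * (1 - N (threshold₀ z)) ∂(ψ₀.prod ψ₁)
  firm1 : ∀ y : unitInterval, ∫ x, (y : ℝ) * N (threshold₁ (x, y)) ∂ψ₀
    ≤ ∫ z : Prices, (z.2 : ℝ) * N (threshold₁ z) ∂(ψ₀.prod ψ₁)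

/-- The distribution function of the probability of state `1`, for a continuous distribution `N` of
the probability of state `0`. -/
def reflect (N : ℝ → ℝ) (x : ℝ) : ℝ := 1 - N (1 - x)

lemma reflect_threshold₀_swap (N : ℝ → ℝ) (z : Prices) :
    reflect N (threshold₀ z.swap) = 1 - N (threshold₁ z) := by
  unfold reflect threshold₀ threshold₁
  rw [← min_sub_sub_left]
  congr 3
  simp only [Prod.fst_swap, Prod.snd_swap]; ring

lemma reflect_threshold₁_swap (N : ℝ → ℝ) (z : Prices) :
    reflect N (threshold₁ z.swap) = 1 - N (threshold₀ z) := by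
  unfold reflect threshold₀ threshold₁
  rw [← max_sub_sub_left]
  congr 3
  · simp only [Prod.snd_swap]; ring
  · simp only [Prod.fst_swap, Prod.snd_swap]; ring

variable {N : ℝ → ℝ} {ψ₀ ψ₁ : Measure unitInterval}

/-- The pricing game is symmetric under exchanging the two states together with the two firms. -/
lemma IsPriceEquilibrium.reflect [SFinite ψ₀] [SFinite ψ₁] (h : IsPriceEquilibrium N ψ₀ ψ₁) :
    IsPriceEquilibrium (reflect N) ψ₁ ψ₀ where
  firm0 y := by
    have h1 : ∀ x : unitInterval, (y : ℝ) * (1 - PricedHerding.reflect N (threshold₀ (y, x)))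
        = (y : ℝ) * N (threshold₁ (x, y)) := fun x => by
      rw [show (y, x) = Prod.swap (x, y) from rfl, reflect_threshold₀_swap, sub_sub_cancel]
    rw [← integral_prod_swap]
    simp only [reflect_threshold₀_swap, sub_sub_cancel, Prod.fst_swap, h1]
    exact h.firm1 y
  firm1 x := by
    have h1 : ∀ y : unitInterval, (x : ℝ) * PricedHerding.reflect N (threshold₁ (y, x))
        = (x : ℝ) * (1 - N (threshold₀ (x, y))) := fun y => by
      rw [show (y, x) = Prod.swap (x, y) from rfl, reflect_threshold₁_swap]
    rw [← integral_prod_swap]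
    simp only [reflect_threshold₁_swap, Prod.snd_swap, h1]
    exact h.firm0 x

lemma reflect_monotone (hN : Monotone N) : Monotone (reflect N) := fun x y h =>
  sub_le_sub_left (hN (by linarith)) _

lemma reflect_mem (h01 : ∀ x, N x ∈ Set.Icc (0 : ℝ) 1) (x : ℝ) :
    reflect N x ∈ Set.Icc (0 : ℝ) 1 := by
  have := h01 (1 - x)
  unfold reflect
  exact ⟨by linarith [this.2], by linarith [this.1]⟩

lemma integrable_of_mem_Icc {α : Type*} [MeasurableSpace α] {μ : Measure α} [IsFiniteMeasure μ]
    {f : α → ℝ} (hf : Measurable f) {C : ℝ} (h : ∀ x, |f x| ≤ C) : Integrable f μ :=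
  Integrable.of_bound hf.aestronglyMeasurable C (ae_of_all _ h)

/-- The expectation of a combination of three indicators, in the form in which pointwise bounds of
profits are integrated. -/
lemma integral_indicators {α : Type*} [MeasurableSpace α] (μ : Measure α) [IsProbabilityMeasure μ]
    {A B D : Set α} (hA : MeasurableSet A) (hB : MeasurableSet B) (hD : MeasurableSet D)
    (a b d e : ℝ) :
    Integrable (fun z => a * A.indicator 1 z + b * B.indicator 1 z + d * D.indicator 1 z + e) μ ∧
    ∫ z, (a * A.indicator 1 z + b * B.indicator 1 z + d * D.indicator 1 z + e) ∂μ
      = a * μ.real A + b * μ.real B + d * μ.real D + e := by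
  have hi : ∀ (c : ℝ) {A : Set α}, MeasurableSet A →
      Integrable (fun z => c * A.indicator 1 z) μ := fun c A hA =>
    (((integrable_const 1).indicator hA).const_mul c)
  have h1 := hi a hA
  have h2 := hi b hB
  have h3 := hi d hD
  have h12 : Integrable (fun z => a * A.indicator 1 z + b * B.indicator 1 z) μ := h1.add h2
  have h123 : Integrable (fun z => a * A.indicator 1 z + b * B.indicator 1 z
    + d * D.indicator 1 z) μ := h12.add h3
  refine ⟨h123.add (integrable_const e), ?_⟩
  rw [integral_add h123 (integrable_const e), integral_add h12 h3, integral_add h1 h2,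
    integral_const_mul, integral_const_mul, integral_const_mul, integral_indicator_one hA,
    integral_indicator_one hB, integral_indicator_one hD, integral_const, probReal_univ, one_smul]

section Deviations

variable [IsProbabilityMeasure ψ₀] [IsProbabilityMeasure ψ₁]

lemma measurable_payoff₀ (hN : Monotone N) :
    Measurable (fun z : Prices => (z.1 : ℝ) * (1 - N (threshold₀ z))) :=
  (measurable_subtype_coe.comp measurable_fst).mul
    (measurable_const.sub (hN.measurable.comp continuous_threshold₀.measurable))

lemma measurable_payoff₁ (hN : Monotone N) :
    Measurable (fun z : Prices => (z.2 : ℝ) * N (threshold₁ z)) :=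
  (measurable_subtype_coe.comp measurable_snd).mul
    (hN.measurable.comp continuous_threshold₁.measurable)

lemma measurable_payoff₀_right (hN : Monotone N) (x : unitInterval) :
    Measurable (fun y : unitInterval => (x : ℝ) * (1 - N (threshold₀ (x, y)))) :=
  (measurable_payoff₀ hN).comp measurable_prodMk_left

lemma measurable_payoff₁_left (hN : Monotone N) (y : unitInterval) :
    Measurable (fun x : unitInterval => (y : ℝ) * N (threshold₁ (x, y))) :=
  (measurable_payoff₁ hN).comp measurable_prodMk_right

lemma abs_payoff₀_le (h01 : ∀ x, N x ∈ Set.Icc (0 : ℝ) 1) (z : Prices) :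
    |(z.1 : ℝ) * (1 - N (threshold₀ z))| ≤ 1 := by
  have h1 := h01 (threshold₀ z)
  rw [abs_of_nonneg (mul_nonneg z.1.2.1 (by linarith [h1.2]))]
  exact mul_le_one₀ z.1.2.2 (by linarith [h1.2]) (by linarith [h1.1])

lemma abs_payoff₁_le (h01 : ∀ x, N x ∈ Set.Icc (0 : ℝ) 1) (z : Prices) :
    |(z.2 : ℝ) * N (threshold₁ z)| ≤ 1 := by
  have h1 := h01 (threshold₁ z)
  rw [abs_of_nonneg (mul_nonneg z.2.2.1 h1.1)]
  exact mul_le_one₀ z.2.2.2 h1.1 h1.2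

/-- The profit of firm `0` from its whole mixed strategy is not improved by raising every price by
`ε`; the gain is the higher price on the remaining demand, the loss the lost demand. Hence firm `0`
rarely serves (nearly) the whole market when `N` is flat near the ends of its support. -/
lemma measure_threshold₀_le (h : IsPriceEquilibrium N ψ₀ ψ₁) (hN : Monotone N)
    (h01 : ∀ x, N x ∈ Set.Icc (0 : ℝ) 1) {ε κ K l u : ℝ} (hε : 0 < ε) (hκ : 0 ≤ κ)
    (hlow : ∀ x ≤ l, N (x + ε) - N x ≤ κ * ε)
    (hup : ∀ x, u ≤ x → N (x + ε) - N x ≤ κ * ε)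
    (hlip : ∀ x, N (x + ε) - N x ≤ K * ε)
    (hNl : N (l + ε) ≤ κ) (hone : ∀ x, 1 - ε ≤ x → N x = 1) :
    (ψ₀.prod ψ₁).real {z | threshold₀ z ≤ l} * (1 - κ)
      ≤ κ + K * (ψ₀.prod ψ₁).real {z | threshold₀ z ∈ Set.Ioo l u} := by
  set ψ := ψ₀.prod ψ₁ with hψ
  set A : Set Prices := {z | threshold₀ z ≤ l} with hA
  set B : Set Prices := {z | threshold₀ z ∈ Set.Ioo l u} with hB
  have hAm : MeasurableSet A :=
    measurableSet_le continuous_threshold₀.measurable measurable_const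
  have hBm : MeasurableSet B := continuous_threshold₀.measurable measurableSet_Ioo
  have hmem : ∀ x : unitInterval, min ((x : ℝ) + ε) 1 ∈ Set.Icc (0 : ℝ) 1 := fun x =>
    ⟨le_min (by linarith [x.2.1]) zero_le_one, min_le_right _ _⟩
  let up : unitInterval → unitInterval := fun x => ⟨min ((x : ℝ) + ε) 1, hmem x⟩
  have hupm : Measurable up := Measurable.subtype_mk (by fun_prop)
  let dev : Prices → Prices := fun z => (up z.1, z.2)
  have hdev : Measurable dev := (hupm.comp measurable_fst).prodMk measurable_snd
  have hpm := measurable_payoff₀ hN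
  have hpi : Integrable (fun z : Prices => (z.1 : ℝ) * (1 - N (threshold₀ z))) ψ :=
    integrable_of_mem_Icc hpm (abs_payoff₀_le h01)
  have hdi : Integrable (fun z : Prices => ((dev z).1 : ℝ) * (1 - N (threshold₀ (dev z)))) ψ :=
    integrable_of_mem_Icc (hpm.comp hdev) fun z => abs_payoff₀_le h01 (dev z)
  have hle : ∫ z : Prices, ((dev z).1 : ℝ) * (1 - N (threshold₀ (dev z))) ∂ψ
      ≤ ∫ z : Prices, (z.1 : ℝ) * (1 - N (threshold₀ z)) ∂ψ := by
    rw [hψ, integral_prod _ hdi]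
    refine (integral_mono (hdi.integral_prod_left) (integrable_const _)
      fun x => h.firm0 (up x)).trans ?_
    simp
  have hpt : ∀ z : Prices, ε * (1 - κ) * A.indicator 1 z + -(ε * K) * B.indicator 1 z
      + 0 * A.indicator 1 z + -(ε * κ)
      ≤ ((dev z).1 : ℝ) * (1 - N (threshold₀ (dev z))) - (z.1 : ℝ) * (1 - N (threshold₀ z)) := by
    intro z
    have hz0 := z.1.2.1
    have hz1 := z.1.2.2
    set c := threshold₀ z with hc
    have hinc : 0 ≤ N (c + ε) - N c := sub_nonneg.2 (hN (by linarith))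
    have h1 : ε * (1 - N (c + ε)) - (N (c + ε) - N c)
        ≤ ((dev z).1 : ℝ) * (1 - N (threshold₀ (dev z))) - (z.1 : ℝ) * (1 - N c) := by
      rcases le_or_gt ((z.1 : ℝ) + ε) 1 with hle | hgt
      · have hd : ((dev z).1 : ℝ) = z.1 + ε := min_eq_left hle
        have hcd : threshold₀ (dev z) ≤ c + ε := by
          have h2 : threshold₀ (dev z) = max ((z.1 : ℝ) + ε) ((1 + (z.1 + ε) - z.2) / 2) := by
            rw [← hd]; rfl
          rw [h2]
          refine max_le (by linarith [le_threshold₀ z]) ?_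
          linarith [mid_le_threshold₀ z]
        have h3 : N (threshold₀ (dev z)) ≤ N (c + ε) := hN hcd
        rw [hd]
        nlinarith
      · have hc1 : 1 - ε ≤ c := by linarith [le_threshold₀ z]
        rw [hone c hc1, hone (c + ε) (by linarith)]
        have := mul_nonneg (dev z).1.2.1 (sub_nonneg.2 (h01 (threshold₀ (dev z))).2)
        linarith
    refine le_trans ?_ h1
    have hNc := (h01 (c + ε)).2
    have hκε : 0 ≤ κ * ε := mul_nonneg hκ hε.le
    rcases le_or_gt c l with h2 | h2
    · have hA' : z ∈ A := h2
      have hB' : z ∉ B := fun h => absurd h.1 (not_lt.2 h2)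
      rw [Set.indicator_of_mem hA', Set.indicator_of_notMem hB']
      have h3 := hlow c h2
      have h4 : N (c + ε) ≤ κ := (hN (by linarith)).trans hNl
      simp only [Pi.one_apply]
      nlinarith
    · have hA' : z ∉ A := not_le.2 h2
      rw [Set.indicator_of_notMem hA']
      rcases lt_or_ge c u with h3 | h3
      · have hB' : z ∈ B := ⟨h2, h3⟩
        rw [Set.indicator_of_mem hB']
        have h4 := hlip c
        simp only [Pi.one_apply]
        nlinarith
      · have hB' : z ∉ B := fun h => absurd h.2 (not_lt.2 h3)
        rw [Set.indicator_of_notMem hB']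
        have h4 := hup c h3
        nlinarith
  obtain ⟨hi, he⟩ := integral_indicators ψ hAm hBm hAm (ε * (1 - κ)) (-(ε * K)) 0 (-(ε * κ))
  have h2 := integral_mono hi (hdi.sub hpi) hpt
  have h3 := integral_sub hdi hpi
  simp only [Pi.sub_apply] at h2
  rw [h3, he] at h2
  have h4 : ε * (ψ.real A * (1 - κ)) ≤ ε * (κ + K * ψ.real B) := by linarith
  exact le_of_mul_le_mul_left h4 hε

/-- When `N` is flat near the ends of its support, thresholds fall strictly inside the support with
a probability that is bounded below. -/
lemma measure_threshold_interior_ge (h : IsPriceEquilibrium N ψ₀ ψ₁) (hN : Monotone N)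
    (h01 : ∀ x, N x ∈ Set.Icc (0 : ℝ) 1) {ε K l u Λ : ℝ} (hε : 0 < ε) (hK : 1 ≤ K)
    (hΛ : 0 < Λ) (hΛl : Λ ≤ l) (hlu : l < u) (hu : u ≤ 1 - Λ)
    (hlow : ∀ x ≤ l, N (x + ε) - N x ≤ Λ / 100 * ε)
    (hup : ∀ x, u - ε ≤ x → N (x + ε) - N x ≤ Λ / 100 * ε)
    (hlip : ∀ x, N (x + ε) - N x ≤ K * ε)
    (hNl : N (l + ε) ≤ Λ / 100) (hNu : 1 - Λ / 100 ≤ N (u - ε))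
    (hone : ∀ x, 1 - ε ≤ x → N x = 1) (hzero : ∀ x ≤ ε, N x = 0) :
    Λ / (100 * K) ≤ (ψ₀.prod ψ₁).real
      {z | threshold₀ z ∈ Set.Ioo l u ∨ threshold₁ z ∈ Set.Ioo l u} := by
  set ψ := ψ₀.prod ψ₁ with hψ
  set A : Set Prices := {z | threshold₀ z ≤ l} with hA
  set B : Set Prices := {z | u ≤ threshold₁ z} with hB
  set D : Set Prices := {z | threshold₀ z ∈ Set.Ioo l u ∨ threshold₁ z ∈ Set.Ioo l u} with hD
  have hAm : MeasurableSet A :=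
    measurableSet_le continuous_threshold₀.measurable measurable_const
  have hBm : MeasurableSet B :=
    measurableSet_le measurable_const continuous_threshold₁.measurable
  have hDm : MeasurableSet D := (continuous_threshold₀.measurable measurableSet_Ioo).union
    (continuous_threshold₁.measurable measurableSet_Ioo)
  by_contra hcon
  rw [not_le, lt_div_iff₀ (by linarith)] at hcon
  have hl1 : l ≤ 1 := by linarith
  have hD0 : 0 ≤ ψ.real D := measureReal_nonneg
  have hKD : K * ψ.real D ≤ Λ / 100 := by linarith
  have hA1 : ψ.real A * (1 - Λ / 100) ≤ Λ / 100 + Λ / 100 := by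
    refine (measure_threshold₀_le h hN h01 (K := K) (u := u) hε (by linarith) hlow
      (fun x hx => hup x (by linarith)) hlip hNl hone).trans ?_
    have : ψ.real {z | threshold₀ z ∈ Set.Ioo l u} ≤ ψ.real D :=
      measureReal_mono fun z hz => Or.inl hz
    have := mul_le_mul_of_nonneg_left this (by linarith : (0 : ℝ) ≤ K)
    linarith
  have hB1 : ψ.real B * (1 - Λ / 100) ≤ Λ / 100 + Λ / 100 := by
    have hswap : ∀ T : Set Prices, MeasurableSet T →
        (ψ₁.prod ψ₀).real T = ψ.real (Prod.swap ⁻¹' T) := fun T hT => by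
      rw [measureReal_def, measureReal_def, hψ, ← Measure.prod_swap,
        Measure.map_apply measurable_swap hT]
    have h1 := measure_threshold₀_le h.reflect (reflect_monotone hN) (reflect_mem h01)
      (K := K) (κ := Λ / 100) (l := 1 - u) (u := 1 - l) hε (by linarith)
      (fun x hx => by
        have := hup (1 - (x + ε)) (by linarith)
        rw [show 1 - (x + ε) + ε = 1 - x by ring] at this
        unfold PricedHerding.reflect; linarith)
      (fun x hx => by
        have := hlow (1 - (x + ε)) (by linarith)
        rw [show 1 - (x + ε) + ε = 1 - x by ring] at this
        unfold PricedHerding.reflect; linarith)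
      (fun x => by
        have := hlip (1 - (x + ε))
        rw [show 1 - (x + ε) + ε = 1 - x by ring] at this
        unfold PricedHerding.reflect; linarith)
      (by
        unfold PricedHerding.reflect
        rw [show 1 - (1 - u + ε) = u - ε by ring]; linarith)
      (fun x hx => by
        unfold PricedHerding.reflect
        rw [hzero _ (by linarith), sub_zero])
    have hts : ∀ z : Prices, threshold₀ z.swap = 1 - threshold₁ z := fun z => by
      have := reflect_threshold₀_swap (fun y => y) z
      unfold PricedHerding.reflect at this
      linarith
    rw [hswap _ (measurableSet_le continuous_threshold₀.measurable measurable_const),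
      hswap {z | threshold₀ z ∈ Set.Ioo (1 - u) (1 - l)}
        (continuous_threshold₀.measurable measurableSet_Ioo)] at h1
    have e1 : Prod.swap ⁻¹' {z : Prices | threshold₀ z ≤ 1 - u} = B := by
      ext z
      simp only [Set.mem_preimage, Set.mem_ofPred_eq, hts, hB]
      constructor <;> intro _ <;> linarith
    rw [e1] at h1
    refine h1.trans ?_
    have : ψ.real (Prod.swap ⁻¹' {z : Prices | threshold₀ z ∈ Set.Ioo (1 - u) (1 - l)})
        ≤ ψ.real D := measureReal_mono fun z hz => by
      simp only [Set.mem_preimage, Set.mem_ofPred_eq, hts, Set.mem_Ioo] at hz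
      exact Or.inr ⟨by linarith [hz.2], by linarith [hz.1]⟩
    have := mul_le_mul_of_nonneg_left this (by linarith : (0 : ℝ) ≤ K)
    linarith
  -- the profit of firm `0` is small
  have hpi : Integrable (fun z : Prices => (z.1 : ℝ) * (1 - N (threshold₀ z))) ψ :=
    integrable_of_mem_Icc (measurable_payoff₀ hN) (abs_payoff₀_le h01)
  obtain ⟨hi, he⟩ := integral_indicators ψ hAm hBm hDm 1 0 1 (Λ / 100)
  have hsmall := integral_mono hpi hi fun z => by
    have hz1 := z.1.2.2
    have hz0 := z.1.2.1
    have hc := h01 (threshold₀ z)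
    have hbd : (z.1 : ℝ) * (1 - N (threshold₀ z)) ≤ 1 - N (threshold₀ z) :=
      mul_le_of_le_one_left (by linarith [hc.2]) hz1
    have hAn : 0 ≤ A.indicator (1 : Prices → ℝ) z := Set.indicator_nonneg (fun _ _ => zero_le_one) _
    have hDn : 0 ≤ D.indicator (1 : Prices → ℝ) z := Set.indicator_nonneg (fun _ _ => zero_le_one) _
    refine hbd.trans ?_
    rcases le_or_gt (threshold₀ z) l with h2 | h2
    · have hA' : A.indicator (1 : Prices → ℝ) z = 1 := Set.indicator_of_mem (s := A) h2 _
      simp only [hA']; linarith [hc.1]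
    rcases lt_or_ge (threshold₀ z) u with h3 | h3
    · have hD' : D.indicator (1 : Prices → ℝ) z = 1 :=
        Set.indicator_of_mem (s := D) (Or.inl ⟨h2, h3⟩) _
      simp only [hD']; linarith [hc.1]
    · have := hN (show u - ε ≤ threshold₀ z by linarith)
      linarith
  rw [he] at hsmall
  -- but charging `l` sells to almost everybody, because the rival's price is high
  obtain ⟨x, hx⟩ : ∃ x : unitInterval, (x : ℝ) = l := ⟨⟨l, by linarith, hl1⟩, rfl⟩
  have hdev := h.firm0 x
  obtain ⟨hi', he'⟩ := integral_indicators ψ hAm hBm hDm (-1) (-1) (-1) 1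
  have hyi : Integrable (fun z : Prices =>
      (x : ℝ) * (1 - N (threshold₀ (x, z.2)))) ψ :=
    integrable_of_mem_Icc ((measurable_payoff₀_right hN x).comp measurable_snd)
      fun z => abs_payoff₀_le h01 (x, z.2)
  have hlarge := integral_mono (hi'.const_mul (l * (1 - Λ / 100))) hyi fun z => by
    simp only [hx]
    have hAn : 0 ≤ A.indicator (1 : Prices → ℝ) z := Set.indicator_nonneg (fun _ _ => zero_le_one) _
    have hBn : 0 ≤ B.indicator (1 : Prices → ℝ) z := Set.indicator_nonneg (fun _ _ => zero_le_one) _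
    have hDn : 0 ≤ D.indicator (1 : Prices → ℝ) z := Set.indicator_nonneg (fun _ _ => zero_le_one) _
    have hc := h01 (threshold₀ (x, z.2))
    have hl0 : 0 < l := by linarith
    have hLk : 0 ≤ l * (1 - Λ / 100) := mul_nonneg hl0.le (by linarith)
    have hrhs : 0 ≤ l * (1 - N (threshold₀ (x, z.2))) :=
      mul_nonneg hl0.le (by linarith [hc.2])
    by_cases hgood : z ∈ A ∨ z ∈ B ∨ z ∈ D
    · have : -1 * A.indicator (1 : Prices → ℝ) z + -1 * B.indicator (1 : Prices → ℝ) z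
          + -1 * D.indicator (1 : Prices → ℝ) z + 1 ≤ 0 := by
        rcases hgood with hz | hz | hz
        · have : A.indicator (1 : Prices → ℝ) z = 1 := Set.indicator_of_mem hz _
          linarith
        · have : B.indicator (1 : Prices → ℝ) z = 1 := Set.indicator_of_mem hz _
          linarith
        · have : D.indicator (1 : Prices → ℝ) z = 1 := Set.indicator_of_mem hz _
          linarith
      exact (mul_nonpos_of_nonneg_of_nonpos hLk this).trans hrhs
    · simp only [not_or] at hgood
      obtain ⟨hzA, hzB, hzD⟩ := hgood
      rw [Set.indicator_of_notMem hzA, Set.indicator_of_notMem hzB, Set.indicator_of_notMem hzD]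
      have h1 : l < threshold₀ z := not_le.1 hzA
      have h2 : threshold₁ z < u := not_le.1 hzB
      have h3 : u ≤ threshold₀ z := by
        by_contra h'; exact hzD (Or.inl ⟨h1, not_le.1 h'⟩)
      have h4 : threshold₁ z ≤ l := by
        by_contra h'; exact hzD (Or.inr ⟨not_le.1 h', h2⟩)
      have h5 : 1 - l ≤ (z.2 : ℝ) := by
        unfold threshold₀ at h3
        unfold threshold₁ at h4
        rcases min_le_iff.1 h4 with h4 | h4
        · linarith
        · rcases le_max_iff.1 h3 with h3 | h3 <;> linarith
      have h6 : threshold₀ (x, z.2) ≤ l :=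
        max_le hx.le (by simp only [hx]; linarith)
      have h7 := (hN (h6.trans (by linarith : l ≤ l + ε))).trans hNl
      have h8 := mul_le_mul_of_nonneg_left (by linarith :
        1 - Λ / 100 ≤ 1 - N (threshold₀ (x, z.2))) hl0.le
      linarith
  rw [integral_const_mul, he'] at hlarge
  rw [integral_fun_snd (μ := ψ₀) (ν := ψ₁)
    (f := fun y => (x : ℝ) * (1 - N (threshold₀ (x, y)))), probReal_univ,
    one_smul] at hlarge
  have hfin := hlarge.trans (hdev.trans hsmall)
  have hΛ1 : Λ ≤ 1 / 2 := by linarith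
  have hAn : 0 ≤ ψ.real A := measureReal_nonneg
  have hBn : 0 ≤ ψ.real B := measureReal_nonneg
  have hA2 : ψ.real A ≤ 3 * Λ / 100 := by nlinarith
  have hB2 : ψ.real B ≤ 3 * Λ / 100 := by nlinarith
  have hD2 : ψ.real D ≤ Λ / 100 := by nlinarith
  have h9 : (9 : ℝ) / 10 ≤ -1 * ψ.real A + -1 * ψ.real B + -1 * ψ.real D + 1 := by linarith
  have h10 : Λ * (99 / 100) ≤ l * (1 - Λ / 100) :=
    mul_le_mul hΛl (by linarith) (by norm_num) (by linarith)
  have h11 : Λ * (99 / 100) * (9 / 10) ≤ l * (1 - Λ / 100) *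
      (-1 * ψ.real A + -1 * ψ.real B + -1 * ψ.real D + 1) :=
    mul_le_mul h10 h9 (by norm_num) (mul_nonneg (by linarith) (by linarith))
  linarith

/-- When the posterior belief is below `1 / 4` with positive probability, firm `1` secures a
profit with the price `1 / 2`, so it sells, at prices bounded away from `0`. -/
lemma measure_threshold₁_interior_ge (h : IsPriceEquilibrium N ψ₀ ψ₁) (hN : Monotone N)
    (h01 : ∀ x, N x ∈ Set.Icc (0 : ℝ) 1) {κ : ℝ} (hκ : 0 ≤ κ) (hκN : 2 * κ ≤ N (1 / 4)) :
    κ / 2 ≤ (ψ₀.prod ψ₁).real {z | threshold₁ z ≤ 1 - κ / 2 ∧ κ / 2 ≤ N (threshold₁ z)} := by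
  set ψ := ψ₀.prod ψ₁ with hψ
  set A : Set Prices := {z | threshold₁ z ≤ 1 - κ / 2 ∧ κ / 2 ≤ N (threshold₁ z)} with hA
  have hAm : MeasurableSet A :=
    (measurableSet_le continuous_threshold₁.measurable measurable_const).inter
      (measurableSet_le measurable_const (hN.measurable.comp continuous_threshold₁.measurable))
  have hpi : Integrable (fun z : Prices => (z.2 : ℝ) * N (threshold₁ z)) ψ :=
    integrable_of_mem_Icc (measurable_payoff₁ hN) (abs_payoff₁_le h01)
  have hmem : (1 / 2 : ℝ) ∈ Set.Icc (0 : ℝ) 1 := by norm_num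
  obtain ⟨y, hy⟩ : ∃ y : unitInterval, (y : ℝ) = 1 / 2 := ⟨⟨1 / 2, hmem⟩, rfl⟩
  have hdev := h.firm1 y
  have h1 : κ ≤ ∫ x, (y : ℝ) * N (threshold₁ (x, y)) ∂ψ₀ := by
    have h2 := integral_mono (integrable_const (μ := ψ₀) κ)
      (integrable_of_mem_Icc (measurable_payoff₁_left hN y) fun x => abs_payoff₁_le h01 (x, y))
      fun x => by
      have h3 : 1 / 4 ≤ threshold₁ (x, y) :=
        le_min (by simp only [hy]; norm_num) (by have := x.2.1; simp only [hy]; linarith)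
      have := hN h3
      simp only [hy]; linarith
    simpa using h2
  obtain ⟨hi, he⟩ := integral_indicators ψ hAm hAm hAm 1 0 0 (κ / 2)
  have h2 := integral_mono hpi hi fun z => by
    have hc := h01 (threshold₁ z)
    have hz0 := z.2.2.1
    have hz1 := z.2.2.2
    have hb : (z.2 : ℝ) * N (threshold₁ z) ≤ 1 := mul_le_one₀ hz1 hc.1 hc.2
    have hAn : 0 ≤ A.indicator (1 : Prices → ℝ) z := Set.indicator_nonneg (fun _ _ => zero_le_one) _
    by_cases hz : z ∈ A
    · have hA' : A.indicator (1 : Prices → ℝ) z = 1 := Set.indicator_of_mem hz _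
      simp only [hA']; linarith
    · have hsmall : (z.2 : ℝ) * N (threshold₁ z) ≤ κ / 2 := by
        by_contra hcon
        rw [not_le] at hcon
        refine hz ⟨?_, ?_⟩
        · have : (z.2 : ℝ) * N (threshold₁ z) ≤ z.2 := mul_le_of_le_one_right hz0 hc.2
          linarith [threshold₁_le z]
        · have : (z.2 : ℝ) * N (threshold₁ z) ≤ N (threshold₁ z) := mul_le_of_le_one_left hc.1 hz1
          linarith
      linarith
  rw [he] at h2
  have h3 := h1.trans (hdev.trans h2)
  linarith

end Deviations

end Pricing

section Capture

lemma ae_eq_of_le_of_integral_eq {α : Type*} [MeasurableSpace α] {μ : Measure α}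
    [IsProbabilityMeasure μ] {f : α → ℝ} {c : ℝ} (hf : Integrable f μ) (hle : ∀ x, f x ≤ c)
    (hc : ∫ x, f x ∂μ = c) : ∀ᵐ x ∂μ, f x = c := by
  have h1 : ∫ x, (c - f x) ∂μ = 0 := by
    rw [integral_sub (integrable_const c) hf, hc]; simp
  have h2 := (integral_eq_zero_iff_of_nonneg (fun x => sub_nonneg.2 (hle x))
    ((integrable_const c).sub hf)).1 h1
  filter_upwards [h2] with x hx
  have : c - f x = 0 := hx
  linarith

variable {N : ℝ → ℝ} {ψ₀ ψ₁ : Measure unitInterval}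
  [IsProbabilityMeasure ψ₀] [IsProbabilityMeasure ψ₁]

lemma IsPriceEquilibrium.ae_payoff₀_eq (h : IsPriceEquilibrium N ψ₀ ψ₁) (hN : Monotone N)
    (h01 : ∀ x, N x ∈ Set.Icc (0 : ℝ) 1) :
    ∀ᵐ x : unitInterval ∂ψ₀, ∫ y, (x : ℝ) * (1 - N (threshold₀ (x, y))) ∂ψ₁
      = ∫ z : Prices, (z.1 : ℝ) * (1 - N (threshold₀ z)) ∂(ψ₀.prod ψ₁) := by
  have hi : Integrable (fun z : Prices => (z.1 : ℝ) * (1 - N (threshold₀ z))) (ψ₀.prod ψ₁) :=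
    integrable_of_mem_Icc (measurable_payoff₀ hN) (abs_payoff₀_le h01)
  exact ae_eq_of_le_of_integral_eq hi.integral_prod_left h.firm0 (integral_prod _ hi).symm

lemma IsPriceEquilibrium.ae_payoff₁_eq (h : IsPriceEquilibrium N ψ₀ ψ₁) (hN : Monotone N)
    (h01 : ∀ x, N x ∈ Set.Icc (0 : ℝ) 1) :
    ∀ᵐ y : unitInterval ∂ψ₁, ∫ x, (y : ℝ) * N (threshold₁ (x, y)) ∂ψ₀
      = ∫ z : Prices, (z.2 : ℝ) * N (threshold₁ z) ∂(ψ₀.prod ψ₁) := by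
  have hi : Integrable (fun z : Prices => (z.2 : ℝ) * N (threshold₁ z)) (ψ₀.prod ψ₁) :=
    integrable_of_mem_Icc (measurable_payoff₁ hN) (abs_payoff₁_le h01)
  exact ae_eq_of_le_of_integral_eq hi.integral_prod_right h.firm1 (integral_prod_symm _ hi).symm

/-- Every price in the support of firm `0`'s strategy is optimal. -/
lemma IsPriceEquilibrium.payoff₀_eq_of_mem_support (h : IsPriceEquilibrium N ψ₀ ψ₁)
    (hN : Monotone N) (hc : Continuous N) (h01 : ∀ x, N x ∈ Set.Icc (0 : ℝ) 1)
    {x : unitInterval} (hx : x ∈ ψ₀.support) :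
    ∫ y, (x : ℝ) * (1 - N (threshold₀ (x, y))) ∂ψ₁
      = ∫ z : Prices, (z.1 : ℝ) * (1 - N (threshold₀ z)) ∂(ψ₀.prod ψ₁) := by
  have hcont : Continuous fun x : unitInterval =>
      ∫ y, (x : ℝ) * (1 - N (threshold₀ (x, y))) ∂ψ₁ := by
    refine continuous_of_dominated (bound := fun _ => 1)
      (fun x => (measurable_payoff₀_right hN x).aestronglyMeasurable)
      (fun x => ae_of_all _ fun y => abs_payoff₀_le h01 (x, y)) (integrable_const _)
      (ae_of_all _ fun y => ?_)
    have := continuous_threshold₀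
    fun_prop
  exact Measure.support_subset_of_isClosed (isClosed_eq hcont continuous_const)
    (h.ae_payoff₀_eq hN h01) hx

/-- Firm `0` captures the market. The support of the posterior belief starts at `l`, close to `1`,
and `N` is steep there. If the highest price of firm `0` exceeded `2 * l - 1`, firm `1` would sell
and hence undercut it; then, `N` being steep, a slightly lower price would gain more demand than it
costs, unless half of the demand is already lost at the highest price; and serving everybody at the
price `2 * l - 1` is better than that. -/
lemma IsPriceEquilibrium.ae_threshold₀_le (h : IsPriceEquilibrium N ψ₀ ψ₁)
    (hN : Monotone N) (hc : Continuous N) (h01 : ∀ x, N x ∈ Set.Icc (0 : ℝ) 1)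
    {l κ k γ : ℝ} (hl : 1 / 2 < l) (hl1 : l < 1) (hzero : ∀ x ≤ l, N x = 0)
    (hpos : ∀ x, l < x → 0 < N x) (hk : 8 ≤ k * (2 * l - 1))
    (hslope : ∀ x y, l ≤ x → x ≤ y → y ≤ l + κ → k * (y - x) ≤ N y - N x)
    (hγ : γ ≤ N (l + κ)) (hγl : 2 * (1 - l) < γ / 2) :
    ∀ᵐ z ∂(ψ₀.prod ψ₁), threshold₀ z ≤ l := by
  obtain ⟨t, htS, htmax⟩ := (Measure.isClosed_support (μ := ψ₀)).isCompact.exists_isGreatest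
    (Measure.nonempty_support (IsProbabilityMeasure.ne_zero ψ₀))
  have hlet : ∀ᵐ x ∂ψ₀, x ≤ t := by
    filter_upwards [Measure.support_mem_ae (μ := ψ₀)] with x hx using htmax hx
  have ht1 := t.2.2
  have ht0 := t.2.1
  suffices htl : (t : ℝ) ≤ 2 * l - 1 by
    have := Measure.quasiMeasurePreserving_fst (μ := ψ₀) (ν := ψ₁) |>.ae hlet
    filter_upwards [this] with z hz
    have hz' : (z.1 : ℝ) ≤ t := hz
    have := z.2.2.1
    exact max_le (by linarith) (by linarith)
  by_contra hcon
  rw [not_le] at hcon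
  set d : ℝ := t - (2 * l - 1) with hd
  have hd0 : 0 < d := by linarith
  set V₀ := ∫ z : Prices, (z.1 : ℝ) * (1 - N (threshold₀ z)) ∂(ψ₀.prod ψ₁) with hV₀
  set V₁ := ∫ z : Prices, (z.2 : ℝ) * N (threshold₁ z) ∂(ψ₀.prod ψ₁) with hV₁
  -- firm `1` sells
  have hV₁pos : 0 < V₁ := by
    obtain ⟨y, hy⟩ : ∃ y : unitInterval, (y : ℝ) = d / 4 := ⟨⟨d / 4, by linarith, by linarith⟩, rfl⟩
    let U : Set unitInterval := {x | (t : ℝ) - d / 4 < x}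
    have hUo : IsOpen U := isOpen_lt continuous_const continuous_subtype_val
    have hU : 0 < ψ₀ U := (Measure.mem_support_iff_forall t).1 htS U
      (hUo.mem_nhds (by change (t : ℝ) - d / 4 < t; linarith))
    have hUr : 0 < ψ₀.real U := ENNReal.toReal_pos hU.ne' (measure_ne_top _ _)
    obtain ⟨hi, he⟩ := integral_indicators ψ₀ hUo.measurableSet hUo.measurableSet
      hUo.measurableSet (y * N (l + d / 4)) 0 0 0
    have h1 := integral_mono hi (integrable_of_mem_Icc (measurable_payoff₁_left hN y)
      fun x => abs_payoff₁_le h01 (x, y)) fun x => by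
        have hy0 := y.2.1
        by_cases hx : x ∈ U
        · have hx' : (t : ℝ) - d / 4 < x := hx
          have h2 : l + d / 4 ≤ threshold₁ (x, y) :=
            le_min (by simp only [hy]; linarith) (by simp only [hy]; linarith)
          have := mul_le_mul_of_nonneg_left (hN h2) hy0
          simp only [Set.indicator_of_mem hx, Pi.one_apply]
          linarith
        · have := mul_nonneg hy0 (h01 (threshold₁ (x, y))).1
          simp only [Set.indicator_of_notMem hx]
          linarith
    rw [he] at h1
    have h2 : 0 < y * N (l + d / 4) := mul_pos (by rw [hy]; linarith) (hpos _ (by linarith))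
    have h3 := mul_pos h2 hUr
    linarith [h.firm1 y]
  -- so it undercuts the highest price of firm `0`
  have hunder : ∀ᵐ y : unitInterval ∂ψ₁, (y : ℝ) < d := by
    filter_upwards [h.ae_payoff₁_eq hN h01] with y hy
    by_contra hyd
    rw [not_lt] at hyd
    have h0 : ∫ x, (y : ℝ) * N (threshold₁ (x, y)) ∂ψ₀ = 0 := by
      refine integral_eq_zero_of_ae ?_
      filter_upwards [hlet] with x hx
      have hx' : (x : ℝ) ≤ t := hx
      have h1 : threshold₁ (x, y) ≤ l := (threshold₁_le_mid _).trans (by simp only; linarith)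
      simp [hzero _ h1]
    linarith [hy.symm.trans h0]
  -- firm `0` can serve the whole market
  have hV₀ge : 2 * l - 1 ≤ V₀ := by
    obtain ⟨x, hx⟩ : ∃ x : unitInterval, (x : ℝ) = 2 * l - 1 :=
      ⟨⟨2 * l - 1, by linarith, by linarith⟩, rfl⟩
    refine le_trans (le_of_eq ?_) (h.firm0 x)
    have h1 : ∀ y : unitInterval, N (threshold₀ (x, y)) = 0 := fun y =>
      hzero _ (max_le (by simp only [hx]; linarith) (by
        have := y.2.1
        simp only [hx]; linarith))
    simp [h1, hx]
  have hVt := h.payoff₀_eq_of_mem_support hN hc h01 htS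
  have hint : ∀ x : unitInterval,
      Integrable (fun y : unitInterval => (x : ℝ) * (1 - N (threshold₀ (x, y)))) ψ₁ := fun x =>
    integrable_of_mem_Icc (measurable_payoff₀_right hN x) fun y => abs_payoff₀_le h01 (x, y)
  have hcm : Measurable fun y : unitInterval => threshold₀ (t, y) :=
    continuous_threshold₀.measurable.comp measurable_prodMk_left
  have hk0 : 0 < k := by
    by_contra hk0
    nlinarith
  -- a slightly lower price than the highest
  have hlocal : ∀ ε : ℝ, 0 < ε → ε < d / 2 →
      ψ₁.real {y : unitInterval | (y : ℝ) ≤ d - 2 * ε ∧ threshold₀ (t, y) ≤ l + κ} ≤ 1 / 4 := by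
    intro ε hε hεd
    set A : Set unitInterval := {y | (y : ℝ) ≤ d - 2 * ε ∧ threshold₀ (t, y) ≤ l + κ} with hA
    have hAm : MeasurableSet A := (measurableSet_le measurable_subtype_coe measurable_const).inter
      (measurableSet_le hcm measurable_const)
    obtain ⟨x, hx⟩ : ∃ x : unitInterval, (x : ℝ) = t - 2 * ε :=
      ⟨⟨t - 2 * ε, by linarith, by linarith⟩, rfl⟩
    obtain ⟨hi, he⟩ := integral_indicators ψ₁ hAm hAm hAm (t * (k * ε)) 0 0 (-(2 * ε))
    have h1 := integral_mono hi ((hint x).sub (hint t)) fun y => by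
      have hy0 := y.2.1
      have hle : threshold₀ (x, y) ≤ threshold₀ (t, y) - ε := by
        have h2 := le_threshold₀ (t, y)
        have h3 := mid_le_threshold₀ (t, y)
        exact max_le (by simp only [hx] at h2 ⊢; linarith) (by simp only [hx] at h3 ⊢; linarith)
      have hmono := hN hle
      have hmono' := hN (show threshold₀ (t, y) - ε ≤ threshold₀ (t, y) by linarith)
      have hx01 := h01 (threshold₀ (x, y))
      have hgain : t * (N (threshold₀ (t, y)) - N (threshold₀ (x, y))) - 2 * ε
          ≤ (x : ℝ) * (1 - N (threshold₀ (x, y))) - t * (1 - N (threshold₀ (t, y))) := by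
        rw [hx]; nlinarith [hx01.1]
      simp only [Pi.sub_apply]
      refine le_trans ?_ hgain
      by_cases hy : y ∈ A
      · have h3 := mid_le_threshold₀ (t, y)
        simp only at h3
        have h4 : l ≤ threshold₀ (t, y) - ε := by linarith [hy.1]
        have h5 := hslope _ _ h4 (by linarith) hy.2
        rw [sub_sub_cancel] at h5
        have h6 := mul_le_mul_of_nonneg_left (h5.trans (sub_le_sub_left hmono _)) ht0
        simp only [Set.indicator_of_mem hy, Pi.one_apply]
        linarith
      · have h6 := mul_nonneg ht0 (sub_nonneg.2 (hmono.trans hmono'))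
        simp only [Set.indicator_of_notMem hy]
        linarith
    have h2 := integral_sub (hint x) (hint t)
    simp only [Pi.sub_apply] at h1
    rw [he, h2, hVt] at h1
    have h3 := h.firm0 x
    have h4 : t * (k * ε) * ψ₁.real A ≤ 2 * ε := by linarith
    have h5 : k * t * ψ₁.real A ≤ 2 := by
      have : ε * (k * t * ψ₁.real A) ≤ ε * 2 := by linarith
      exact le_of_mul_le_mul_left this hε
    have h6 : 8 ≤ k * t := hk.trans (mul_le_mul_of_nonneg_left hcon.le hk0.le)
    have h7 : 8 * ψ₁.real A ≤ k * t * ψ₁.real A :=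
      mul_le_mul_of_nonneg_right h6 measureReal_nonneg
    linarith
  set B : Set unitInterval := {y | threshold₀ (t, y) ≤ l + κ} with hB
  have hBm : MeasurableSet B := measurableSet_le hcm measurable_const
  have hBle : ψ₁.real B ≤ 1 / 4 := by
    let s : ℕ → Set unitInterval := fun n =>
      {y | (y : ℝ) ≤ d - 2 * (d / (2 * ((n : ℝ) + 2))) ∧ threshold₀ (t, y) ≤ l + κ}
    have hs : ∀ n, ψ₁ (s n) ≤ ENNReal.ofReal (1 / 4) := fun n => by
      rw [← ofReal_measureReal]
      refine ENNReal.ofReal_le_ofReal (hlocal _ (by positivity) ?_)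
      exact div_lt_div_of_pos_left hd0 (by norm_num) (by linarith [n.cast_nonneg (α := ℝ)])
    have hsm : Monotone s := fun m n hmn y hy => by
      refine ⟨hy.1.trans ?_, hy.2⟩
      have : (m : ℝ) ≤ n := by exact_mod_cast hmn
      have : d / (2 * ((n : ℝ) + 2)) ≤ d / (2 * ((m : ℝ) + 2)) :=
        div_le_div_of_nonneg_left hd0.le (by positivity) (by linarith)
      linarith
    have hU : ψ₁ (⋃ n, s n) ≤ ENNReal.ofReal (1 / 4) := by
      rw [hsm.measure_iUnion]; exact iSup_le hs
    have hBU : B ≤ᵐ[ψ₁] ⋃ n, s n := by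
      filter_upwards [hunder] with y hy hyB
      obtain ⟨n, hn⟩ := exists_nat_one_div_lt (div_pos (sub_pos.2 hy) hd0)
      refine Set.mem_iUnion.2 ⟨n, ?_, hyB⟩
      have h1 : 2 * (d / (2 * ((n : ℝ) + 2))) = d * (1 / ((n : ℝ) + 2)) := by
        field_simp
      have h2 : 1 / ((n : ℝ) + 2) ≤ 1 / ((n : ℝ) + 1) :=
        one_div_le_one_div_of_le (by positivity) (by linarith)
      have h3 : d * (1 / ((n : ℝ) + 2)) ≤ d * ((d - y) / d) :=
        mul_le_mul_of_nonneg_left (h2.trans hn.le) hd0.le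
      rw [mul_div_cancel₀ _ hd0.ne'] at h3
      linarith
    have := (measure_mono_ae hBU).trans hU
    exact ENNReal.toReal_le_of_le_ofReal (by norm_num) this
  -- the demand that is lost at the highest price
  obtain ⟨hi, he⟩ := integral_indicators ψ₁ hBm hBm hBm γ 0 0 (1 - γ)
  have hfin := integral_mono (hint t) hi fun y => by
    have hy := h01 (threshold₀ (t, y))
    have hbd : (t : ℝ) * (1 - N (threshold₀ (t, y))) ≤ 1 - N (threshold₀ (t, y)) :=
      mul_le_of_le_one_left (by linarith [hy.2]) ht1
    refine hbd.trans ?_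
    by_cases hyB : y ∈ B
    · simp only [Set.indicator_of_mem hyB, Pi.one_apply]
      linarith [hy.1]
    · have : l + κ ≤ threshold₀ (t, y) := (not_le.1 hyB).le
      have := hN this
      simp only [Set.indicator_of_notMem hyB]
      linarith
  rw [he, hVt] at hfin
  have hγ0 : 0 < γ := by linarith
  nlinarith

end Capture

/-! ### From private beliefs to posterior beliefs -/

section Posterior

/-- The private belief at which the posterior belief for the prior `β` is `x` (clamped to the unit
interval): `x (1 - β) / (β (1 - x) + x (1 - β))`. -/
def beliefCut (β x : ℝ) : ℝ :=
  max 0 (min x 1) * (1 - β) / (β * (1 - max 0 (min x 1)) + max 0 (min x 1) * (1 - β))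

/-- The posterior belief for the prior `β` and the private belief `q`. -/
def posterior (β q : ℝ) : ℝ := β * q / (β * q + (1 - β) * (1 - q))

variable {β : ℝ}

lemma clamp_mem (x : ℝ) : max 0 (min x 1) ∈ Set.Icc (0 : ℝ) 1 :=
  ⟨le_max_left _ _, max_le zero_le_one (min_le_right _ _)⟩

lemma clamp_of_mem {x : ℝ} (hx : x ∈ Set.Icc (0 : ℝ) 1) : max 0 (min x 1) = x := by
  rw [min_eq_left hx.2, max_eq_right hx.1]

lemma clamp_mono {x y : ℝ} (h : x ≤ y) : max 0 (min x 1) ≤ max 0 (min y 1) :=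
  max_le_max le_rfl (min_le_min h le_rfl)

lemma clamp_sub_le {x y : ℝ} (h : x ≤ y) : max 0 (min y 1) - max 0 (min x 1) ≤ y - x := by
  rcases max_cases 0 (min y 1) with h1 | h1 <;> rcases max_cases 0 (min x 1) with h2 | h2 <;>
    rcases min_cases y 1 with h3 | h3 <;> rcases min_cases x 1 with h4 | h4 <;> linarith

/-- `min β (1 - β)` is a lower bound of the denominator of `beliefCut`. -/
lemma le_cut_denom {m y : ℝ} (h1 : m ≤ β) (h2 : m ≤ 1 - β) (hy : y ∈ Set.Icc (0 : ℝ) 1) :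
    m ≤ β * (1 - y) + y * (1 - β) := by
  nlinarith [hy.1, hy.2]

lemma cut_denom_pos (hβ : β ∈ Set.Ioo (0 : ℝ) 1) {y : ℝ} (hy : y ∈ Set.Icc (0 : ℝ) 1) :
    0 < β * (1 - y) + y * (1 - β) :=
  (lt_min hβ.1 (sub_pos.2 hβ.2)).trans_le (le_cut_denom (min_le_left _ _) (min_le_right _ _) hy)

lemma cut_denom_le_one (hβ : β ∈ Set.Ioo (0 : ℝ) 1) {y : ℝ} (hy : y ∈ Set.Icc (0 : ℝ) 1) :
    β * (1 - y) + y * (1 - β) ≤ 1 := by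
  nlinarith [hβ.1, hβ.2, hy.1, hy.2]

lemma cut_sub_cut (hβ : β ∈ Set.Ioo (0 : ℝ) 1) {x y : ℝ} (hx : x ∈ Set.Icc (0 : ℝ) 1)
    (hy : y ∈ Set.Icc (0 : ℝ) 1) :
    beliefCut β y - beliefCut β x = β * (1 - β) * (y - x) /
      ((β * (1 - y) + y * (1 - β)) * (β * (1 - x) + x * (1 - β))) := by
  have h1 := (cut_denom_pos hβ hx).ne'
  have h2 := (cut_denom_pos hβ hy).ne'
  rw [beliefCut, beliefCut, clamp_of_mem hx, clamp_of_mem hy, div_sub_div _ _ h2 h1]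
  congr 1
  ring

lemma beliefCut_clamp (β x : ℝ) : beliefCut β (max 0 (min x 1)) = beliefCut β x := by
  simp only [beliefCut, clamp_of_mem (clamp_mem x)]

lemma beliefCut_mono (hβ : β ∈ Set.Ioo (0 : ℝ) 1) : Monotone (beliefCut β) := fun x y h => by
  rw [← beliefCut_clamp β x, ← beliefCut_clamp β y, ← sub_nonneg,
    cut_sub_cut hβ (clamp_mem x) (clamp_mem y)]
  have h1 := cut_denom_pos hβ (clamp_mem x)
  have h2 := cut_denom_pos hβ (clamp_mem y)
  exact div_nonneg (mul_nonneg (mul_nonneg hβ.1.le (sub_nonneg.2 hβ.2.le))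
    (sub_nonneg.2 (clamp_mono h))) (mul_pos h2 h1).le

lemma beliefCut_sub_le {m : ℝ} (hm : 0 < m) (h1 : m ≤ β) (h2 : m ≤ 1 - β) {x y : ℝ} (h : x ≤ y) :
    beliefCut β y - beliefCut β x ≤ 1 / m ^ 2 * (y - x) := by
  have hβ : β ∈ Set.Ioo (0 : ℝ) 1 := ⟨by linarith, by linarith⟩
  rw [← beliefCut_clamp β x, ← beliefCut_clamp β y, cut_sub_cut hβ (clamp_mem x) (clamp_mem y)]
  have h3 := le_cut_denom h1 h2 (clamp_mem x)
  have h4 := le_cut_denom h1 h2 (clamp_mem y)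
  rw [div_mul_eq_mul_div, one_mul]
  refine div_le_div₀ (sub_nonneg.2 h) ?_ (by positivity) ?_
  · have h5 := clamp_sub_le h
    have h6 := sub_nonneg.2 (clamp_mono h)
    have h7 : β * (1 - β) ≤ 1 := by nlinarith [hβ.1, hβ.2]
    nlinarith
  · rw [sq]; exact mul_le_mul h4 h3 hm.le (hm.le.trans h4)

lemma continuous_beliefCut (hβ : β ∈ Set.Ioo (0 : ℝ) 1) : Continuous (beliefCut β) := by
  unfold beliefCut
  exact Continuous.div (by fun_prop) (by fun_prop) fun x => (cut_denom_pos hβ (clamp_mem x)).ne'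

lemma beliefCut_of_nonpos {x : ℝ} (hx : x ≤ 0) : beliefCut β x = 0 := by
  have : max 0 (min x 1) = 0 := max_eq_left ((min_le_left _ _).trans hx)
  simp [beliefCut, this]

lemma beliefCut_of_one_le (hβ : β ∈ Set.Ioo (0 : ℝ) 1) {x : ℝ} (hx : 1 ≤ x) :
    beliefCut β x = 1 := by
  have : max 0 (min x 1) = 1 := by rw [min_eq_right hx]; simp
  have h1 : (1 : ℝ) - β ≠ 0 := (sub_pos.2 hβ.2).ne'
  simp [beliefCut, this, h1]

lemma lt_beliefCut_iff (hβ : β ∈ Set.Ioo (0 : ℝ) 1) {q x : ℝ} (hx : x ∈ Set.Icc (0 : ℝ) 1) :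
    q < beliefCut β x ↔ β * q * (1 - x) < x * (1 - β) * (1 - q) := by
  rw [beliefCut, clamp_of_mem hx, lt_div_iff₀ (cut_denom_pos hβ hx)]
  constructor <;> intro h <;> linarith

lemma beliefCut_lt_iff (hβ : β ∈ Set.Ioo (0 : ℝ) 1) {q x : ℝ} (hx : x ∈ Set.Icc (0 : ℝ) 1) :
    beliefCut β x < q ↔ x * (1 - β) * (1 - q) < β * q * (1 - x) := by
  rw [beliefCut, clamp_of_mem hx, div_lt_iff₀ (cut_denom_pos hβ hx)]
  constructor <;> intro h <;> linarith

lemma one_sub_beliefCut (hβ : β ∈ Set.Ioo (0 : ℝ) 1) (x : ℝ) :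
    beliefCut (1 - β) (1 - x) = 1 - beliefCut β x := by
  have hc : max 0 (min (1 - x) 1) = 1 - max 0 (min x 1) := by
    rcases max_cases 0 (min (1 - x) 1) with h1 | h1 <;>
    rcases max_cases 0 (min x 1) with h2 | h2 <;>
    rcases min_cases (1 - x) 1 with h3 | h3 <;> rcases min_cases x 1 with h4 | h4 <;> linarith
  have hm := clamp_mem x
  have h1 := cut_denom_pos hβ hm
  have h2 : (1 - β) * (1 - (1 - max 0 (min x 1))) + (1 - max 0 (min x 1)) * (1 - (1 - β))
      = β * (1 - max 0 (min x 1)) + max 0 (min x 1) * (1 - β) := by ring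
  rw [beliefCut, beliefCut, hc, h2, eq_sub_iff_add_eq, ← add_div, div_eq_one_iff_eq h1.ne']
  ring

lemma posterior_denom_pos (hβ : β ∈ Set.Ioo (0 : ℝ) 1) {q : ℝ} (hq : q ∈ Set.Icc (0 : ℝ) 1) :
    0 < β * q + (1 - β) * (1 - q) := by
  have h := cut_denom_pos hβ (y := 1 - q) ⟨by linarith [hq.2], by linarith [hq.1]⟩
  linarith

lemma posterior_denom_le_one (hβ : β ∈ Set.Ioo (0 : ℝ) 1) {q : ℝ} (hq : q ∈ Set.Icc (0 : ℝ) 1) :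
    β * q + (1 - β) * (1 - q) ≤ 1 := by
  have h := cut_denom_le_one hβ (y := 1 - q) ⟨by linarith [hq.2], by linarith [hq.1]⟩
  linarith

lemma posterior_mem (hβ : β ∈ Set.Ioo (0 : ℝ) 1) {q : ℝ} (hq : q ∈ Set.Icc (0 : ℝ) 1) :
    posterior β q ∈ Set.Icc (0 : ℝ) 1 := by
  have h1 := posterior_denom_pos hβ hq
  refine ⟨div_nonneg (mul_nonneg hβ.1.le hq.1) h1.le, (div_le_one h1).2 ?_⟩
  nlinarith [mul_nonneg (sub_nonneg.2 hβ.2.le) (sub_nonneg.2 hq.2)]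

lemma one_sub_posterior (hβ : β ∈ Set.Ioo (0 : ℝ) 1) {q : ℝ} (hq : q ∈ Set.Icc (0 : ℝ) 1) :
    1 - posterior β q = (1 - β) * (1 - q) / (β * q + (1 - β) * (1 - q)) := by
  have h1 := posterior_denom_pos hβ hq
  rw [posterior, eq_div_iff h1.ne', sub_mul, div_mul_cancel₀ _ h1.ne']
  ring

lemma beliefCut_posterior (hβ : β ∈ Set.Ioo (0 : ℝ) 1) {q : ℝ} (hq : q ∈ Set.Icc (0 : ℝ) 1) :
    beliefCut β (posterior β q) = q := by
  have h1 := posterior_denom_pos hβ hq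
  have hm := posterior_mem hβ hq
  rw [beliefCut, clamp_of_mem hm, div_eq_iff (cut_denom_pos hβ hm).ne', one_sub_posterior hβ hq,
    posterior]
  field_simp
  ring

lemma le_posterior (hβ : β ∈ Set.Ioo (0 : ℝ) 1) {q : ℝ} (hq : q ∈ Set.Icc (0 : ℝ) 1) :
    β * q ≤ posterior β q :=
  le_div_self (mul_nonneg hβ.1.le hq.1) (posterior_denom_pos hβ hq) (posterior_denom_le_one hβ hq)

lemma le_one_sub_posterior (hβ : β ∈ Set.Ioo (0 : ℝ) 1) {q : ℝ} (hq : q ∈ Set.Icc (0 : ℝ) 1) :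
    (1 - β) * (1 - q) ≤ 1 - posterior β q := by
  rw [one_sub_posterior hβ hq]
  exact le_div_self (mul_nonneg (sub_nonneg.2 hβ.2.le) (sub_nonneg.2 hq.2))
    (posterior_denom_pos hβ hq) (posterior_denom_le_one hβ hq)

lemma lt_of_beliefCut_lt (hβ : β ∈ Set.Ioo (0 : ℝ) 1) {x y : ℝ}
    (h : beliefCut β x < beliefCut β y) : x < y := by
  by_contra h'
  exact absurd (beliefCut_mono hβ (not_lt.1 h')) (not_le.2 h)

lemma beliefCut_lt_of_lt (hβ : β ∈ Set.Ioo (0 : ℝ) 1) {x y : ℝ} (hx : x ∈ Set.Icc (0 : ℝ) 1)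
    (hy : y ∈ Set.Icc (0 : ℝ) 1) (h : x < y) : beliefCut β x < beliefCut β y := by
  rw [← sub_pos, cut_sub_cut hβ hx hy]
  have h1 := cut_denom_pos hβ hx
  have h2 := cut_denom_pos hβ hy
  have h3 := sub_pos.2 hβ.2
  have h4 := hβ.1
  have h5 := sub_pos.2 h
  positivity

/-- The distribution function of the posterior belief for the prior `β`, when the private belief has
distribution function `A` in state `0` and `B` in state `1`. -/
def posteriorCDF (A B : ℝ → ℝ) (β x : ℝ) : ℝ :=
  β * A (beliefCut β x) + (1 - β) * B (beliefCut β x)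

variable {A B : ℝ → ℝ}

lemma posteriorCDF_mono (hβ : β ∈ Set.Ioo (0 : ℝ) 1) (hA : Monotone A) (hB : Monotone B) :
    Monotone (posteriorCDF A B β) := fun _ _ h =>
  add_le_add (mul_le_mul_of_nonneg_left (hA (beliefCut_mono hβ h)) hβ.1.le)
    (mul_le_mul_of_nonneg_left (hB (beliefCut_mono hβ h)) (sub_nonneg.2 hβ.2.le))

lemma posteriorCDF_continuous (hβ : β ∈ Set.Ioo (0 : ℝ) 1) (hA : Continuous A)
    (hB : Continuous B) : Continuous (posteriorCDF A B β) := by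
  have := continuous_beliefCut hβ
  unfold posteriorCDF
  fun_prop

/-- A mixture of two numbers lies between every common pair of bounds. -/
lemma mix_mem (hβ : β ∈ Set.Ioo (0 : ℝ) 1) {x y a b : ℝ} (hx : x ∈ Set.Icc a b)
    (hy : y ∈ Set.Icc a b) : β * x + (1 - β) * y ∈ Set.Icc a b := by
  have h0 := hβ.1
  have h1 := sub_pos.2 hβ.2
  constructor
  · nlinarith [hx.1, hy.1]
  · nlinarith [hx.2, hy.2]

lemma posteriorCDF_mem (hβ : β ∈ Set.Ioo (0 : ℝ) 1) (hA : ∀ x, A x ∈ Set.Icc (0 : ℝ) 1)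
    (hB : ∀ x, B x ∈ Set.Icc (0 : ℝ) 1) (x : ℝ) : posteriorCDF A B β x ∈ Set.Icc (0 : ℝ) 1 :=
  mix_mem hβ (hA _) (hB _)

lemma reflect_posteriorCDF (hβ : β ∈ Set.Ioo (0 : ℝ) 1) (A B : ℝ → ℝ) :
    reflect (posteriorCDF A B β) = posteriorCDF (reflect B) (reflect A) (1 - β) := by
  funext x
  have h := one_sub_beliefCut hβ (1 - x)
  rw [sub_sub_cancel] at h
  simp only [reflect, posteriorCDF, h, sub_sub_cancel]
  ring

/-- Near certainty of state `0`, if the distribution of the private belief has a positive slope at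
its lower end, firm `0` serves the whole market. -/
lemma exists_forall_market_capture_zero (hA : Monotone A) (hB : Monotone B) (hAc : Continuous A)
    (hBc : Continuous B) (hA01 : ∀ x, A x ∈ Set.Icc (0 : ℝ) 1)
    (hB01 : ∀ x, B x ∈ Set.Icc (0 : ℝ) 1) {α c η : ℝ} (hα : 0 < α) (hα1 : α + η ≤ 1)
    (hc : 0 < c) (hη : 0 < η) (hAzero : ∀ x ≤ α, A x = 0) (hBzero : ∀ x ≤ α, B x = 0)
    (hslope : ∀ x y, α ≤ x → x ≤ y → y ≤ α + η → c * (y - x) ≤ A y - A x) :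
    ∃ e < 1, ∀ β ∈ Set.Ioo e 1, ∀ ψ₀ ψ₁ : Measure unitInterval, IsProbabilityMeasure ψ₀ →
      IsProbabilityMeasure ψ₁ → IsPriceEquilibrium (posteriorCDF A B β) ψ₀ ψ₁ →
      ∀ᵐ z ∂(ψ₀.prod ψ₁), beliefCut β (threshold₀ z) ≤ α := by
  set γ := A (α + η) with hγ
  have hγ0 : 0 < γ := by
    have := hslope α (α + η) le_rfl (by linarith) le_rfl
    rw [hAzero α le_rfl] at this
    nlinarith
  have hγ1 : γ ≤ 1 := (hA01 _).2
  set w := min (min (1 / 2) (α / 8)) (min (c * α ^ 2 / 1024) (γ * α / 32)) with hw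
  have hw0 : 0 < w := by
    rw [hw]; refine lt_min (lt_min ?_ ?_) (lt_min ?_ ?_) <;> positivity
  have hw1 : w ≤ 1 / 2 := (min_le_left _ _).trans (min_le_left _ _)
  have hw2 : w ≤ α / 8 := (min_le_left _ _).trans (min_le_right _ _)
  have hw3 : w ≤ c * α ^ 2 / 1024 := (min_le_right _ _).trans (min_le_left _ _)
  have hw4 : w ≤ γ * α / 32 := (min_le_right _ _).trans (min_le_right _ _)
  refine ⟨1 - w, by linarith, fun β hβ ψ₀ ψ₁ _ _ h => ?_⟩
  have hβ01 : β ∈ Set.Ioo (0 : ℝ) 1 := ⟨by linarith [hβ.1], hβ.2⟩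
  have hβ2 : 1 / 2 < β := by linarith [hβ.1]
  have hv0 : 0 < 1 - β := by linarith [hβ.2]
  have hvw : 1 - β < w := by linarith [hβ.1]
  have hαI : α ∈ Set.Icc (0 : ℝ) 1 := ⟨hα.le, by linarith⟩
  have hαηI : α + η ∈ Set.Icc (0 : ℝ) 1 := ⟨by linarith, hα1⟩
  set l := posterior β α with hl
  set r := posterior β (α + η) with hr
  have hlI := posterior_mem hβ01 hαI
  have hrI := posterior_mem hβ01 hαηI
  have hTl := beliefCut_posterior hβ01 hαI
  have hTr := beliefCut_posterior hβ01 hαηI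
  have hl1 : α * (1 - l) ≤ 2 * (1 - β) := by
    have h1 := posterior_denom_pos hβ01 hαI
    rw [hl, one_sub_posterior hβ01 hαI, mul_div_assoc', div_le_iff₀ h1]
    have h2 : α / 2 ≤ β * α + (1 - β) * (1 - α) := by nlinarith [hαI.2]
    nlinarith [mul_nonneg hv0.le hα.le, mul_nonneg (mul_nonneg hv0.le hα.le) hα.le]
  have hlv : 1 - l ≤ 1 / 4 := by
    have : α * (1 - l) ≤ α * (1 / 4) := by linarith
    exact le_of_mul_le_mul_left this hα
  have hl_lt : l < 1 := by
    have h1 := posterior_denom_pos hβ01 hαI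
    have h2 := one_sub_posterior hβ01 hαI
    have h3 : 0 < (1 - β) * (1 - α) / (β * α + (1 - β) * (1 - α)) :=
      div_pos (mul_pos hv0 (by linarith)) h1
    linarith
  have hlr : l < r := lt_of_beliefCut_lt hβ01 (by rw [hTl, hTr]; linarith)
  have hmain := h.ae_threshold₀_le (posteriorCDF_mono hβ01 hA hB)
    (posteriorCDF_continuous hβ01 hAc hBc) (posteriorCDF_mem hβ01 hA01 hB01)
    (l := l) (κ := r - l) (k := c * α ^ 2 / (64 * (1 - β))) (γ := γ / 2)
    (by linarith) hl_lt
    (fun x hx => by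
      have h1 : beliefCut β x ≤ α := hTl ▸ beliefCut_mono hβ01 hx
      simp [posteriorCDF, hAzero _ h1, hBzero _ h1])
    (fun x hx => by
      have h1 : α < beliefCut β x := by
        rw [← beliefCut_clamp, ← hTl]
        refine beliefCut_lt_of_lt hβ01 hlI (clamp_mem x) (lt_max_of_lt_right (lt_min hx hl_lt))
      have h2 : 0 < A (beliefCut β x) := by
        have h3 : A α < A (min (beliefCut β x) (α + η)) := by
          have h4 : α < min (beliefCut β x) (α + η) := lt_min h1 (by linarith)
          have h5 := hslope α _ le_rfl h4.le (min_le_right _ _)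
          have h6 := mul_pos hc (sub_pos.2 h4)
          linarith
        rw [hAzero α le_rfl] at h3
        exact h3.trans_le (hA (min_le_left _ _))
      have h3 := mul_nonneg hv0.le (hB01 (beliefCut β x)).1
      have h4 := mul_pos hβ01.1 h2
      unfold posteriorCDF
      linarith)
    (by
      have h1 : (16 : ℝ) ≤ c * α ^ 2 / (64 * (1 - β)) := by
        rw [le_div_iff₀ (by linarith)]; linarith
      have h2 : (1 : ℝ) / 2 ≤ 2 * l - 1 := by linarith
      have := mul_le_mul h1 h2 (by norm_num) (by linarith)
      linarith)
    (fun x y hx hxy hy => by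
      rw [add_sub_cancel] at hy
      have hyI : y ∈ Set.Icc (0 : ℝ) 1 := ⟨hlI.1.trans (hx.trans hxy), hy.trans hrI.2⟩
      have hxI : x ∈ Set.Icc (0 : ℝ) 1 := ⟨hlI.1.trans hx, hxy.trans hyI.2⟩
      have hden : ∀ z, l ≤ z → z ∈ Set.Icc (0 : ℝ) 1 →
          α * (β * (1 - z) + z * (1 - β)) ≤ 4 * (1 - β) := fun z hz hzI => by
        have h1 : α * (1 - z) ≤ 2 * (1 - β) := by
          have := mul_le_mul_of_nonneg_left (sub_le_sub_left hz 1) hα.le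
          linarith
        have h2 : β * (α * (1 - z)) ≤ 1 * (2 * (1 - β)) :=
          mul_le_mul hβ.2.le h1 (mul_nonneg hα.le (sub_nonneg.2 hzI.2)) zero_le_one
        have h3 : (α * z) * (1 - β) ≤ 1 * (1 - β) :=
          mul_le_mul_of_nonneg_right (mul_le_one₀ hαI.2 hzI.1 hzI.2) hv0.le
        linarith
      have hcut : α ^ 2 / (32 * (1 - β)) * (y - x) ≤ beliefCut β y - beliefCut β x := by
        have d1 := cut_denom_pos hβ01 hxI
        have d2 := cut_denom_pos hβ01 hyI
        rw [cut_sub_cut hβ01 hxI hyI, div_mul_eq_mul_div, div_le_div_iff₀ (by linarith)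
          (mul_pos d2 d1)]
        have h1 := mul_le_mul (hden y (hx.trans hxy) hyI) (hden x hx hxI)
          (mul_nonneg hα.le d1.le) (by linarith)
        have h2 := mul_le_mul_of_nonneg_left h1 (sub_nonneg.2 hxy)
        have h3 : 0 ≤ (y - x) * (1 - β) ^ 2 := mul_nonneg (sub_nonneg.2 hxy) (sq_nonneg _)
        nlinarith
      have hTx : α ≤ beliefCut β x := hTl ▸ beliefCut_mono hβ01 hx
      have hTy : beliefCut β y ≤ α + η := hTr ▸ beliefCut_mono hβ01 hy
      have hTxy := beliefCut_mono hβ01 hxy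
      have h1 := hslope _ _ hTx hTxy hTy
      have h2 := mul_le_mul_of_nonneg_left hcut hc.le
      have h3 := mul_nonneg hv0.le (sub_nonneg.2 (hB hTxy))
      have h4 : 0 ≤ A (beliefCut β y) - A (beliefCut β x) := sub_nonneg.2 (hA hTxy)
      have h5 : 1 / 2 * (A (beliefCut β y) - A (beliefCut β x))
          ≤ β * (A (beliefCut β y) - A (beliefCut β x)) := mul_le_mul_of_nonneg_right hβ2.le h4
      have h6 : c * α ^ 2 / (64 * (1 - β)) * (y - x)
          = 1 / 2 * (c * (α ^ 2 / (32 * (1 - β)) * (y - x))) := by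
        field_simp; ring
      unfold posteriorCDF
      linarith)
    (by
      rw [add_sub_cancel]
      unfold posteriorCDF
      rw [hTr]
      have h3 := mul_nonneg hv0.le (hB01 (α + η)).1
      nlinarith)
    (by
      have : α * (1 - l) < α * (γ / 8) := by nlinarith
      have := lt_of_mul_lt_mul_left this hα.le
      linarith)
  filter_upwards [hmain] with z hz
  exact hTl ▸ beliefCut_mono hβ01 hz

/-- Near certainty of state `1`, if the distribution of the private belief has a positive slope at
its upper end, firm `1` serves the whole market. -/
lemma exists_forall_market_capture_one (hA : Monotone A) (hB : Monotone B) (hAc : Continuous A)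
    (hBc : Continuous B) (hA01 : ∀ x, A x ∈ Set.Icc (0 : ℝ) 1)
    (hB01 : ∀ x, B x ∈ Set.Icc (0 : ℝ) 1) {α c η : ℝ} (hα : α < 1) (hα0 : 0 ≤ α - η)
    (hc : 0 < c) (hη : 0 < η) (hAone : ∀ x, α ≤ x → A x = 1) (hBone : ∀ x, α ≤ x → B x = 1)
    (hslope : ∀ x y, α - η ≤ x → x ≤ y → y ≤ α → c * (y - x) ≤ B y - B x) :
    ∃ e > 0, ∀ β ∈ Set.Ioo 0 e, ∀ ψ₀ ψ₁ : Measure unitInterval, IsProbabilityMeasure ψ₀ →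
      IsProbabilityMeasure ψ₁ → IsPriceEquilibrium (posteriorCDF A B β) ψ₀ ψ₁ →
      ∀ᵐ z ∂(ψ₀.prod ψ₁), α ≤ beliefCut β (threshold₁ z) := by
  have hrc : ∀ {D : ℝ → ℝ}, Continuous D → Continuous (reflect D) := fun hD => by
    unfold reflect; fun_prop
  obtain ⟨e, he1, he⟩ := exists_forall_market_capture_zero (reflect_monotone hB)
    (reflect_monotone hA) (hrc hBc) (hrc hAc) (reflect_mem hB01) (reflect_mem hA01)
    (α := 1 - α) (c := c) (η := η)
    (by linarith) (by linarith) hc hη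
    (fun x hx => by unfold reflect; rw [hBone _ (by linarith), sub_self])
    (fun x hx => by unfold reflect; rw [hAone _ (by linarith), sub_self])
    (fun x y hx hxy hy => by
      have := hslope (1 - y) (1 - x) (by linarith) (by linarith) (by linarith)
      unfold reflect; linarith)
  refine ⟨min (1 - e) 1, lt_min (by linarith) one_pos, fun β hβ ψ₀ ψ₁ _ _ h => ?_⟩
  have hβ01 : β ∈ Set.Ioo (0 : ℝ) 1 := ⟨hβ.1, hβ.2.trans_le (min_le_right _ _)⟩
  have h1 := h.reflect
  rw [reflect_posteriorCDF hβ01] at h1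
  have h2 := he (1 - β) ⟨by linarith [hβ.2, min_le_left (1 - e) 1], by linarith [hβ.1]⟩
    ψ₁ ψ₀ inferInstance inferInstance h1
  rw [← Measure.prod_swap] at h2
  have h3 := ae_of_ae_map measurable_swap.aemeasurable h2
  filter_upwards [h3] with z hz
  have hts : threshold₀ z.swap = 1 - threshold₁ z := by
    have := reflect_threshold₀_swap (fun y => y) z
    unfold reflect at this
    linarith
  rw [hts, one_sub_beliefCut hβ01] at hz
  linarith

end Posterior

/-! ### Information disclosed in one period -/

namespace SignalStructure

variable {S : Type*} [MeasurableSpace S] (E : SignalStructure S)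

/-- The information disclosed by purchases at the prices `z`, for the prior `β`: the difference
between the two states of the probabilities that product `0` is bought, plus the difference of the
probabilities that product `1` is not. -/
def disclosure (β : ℝ) (z : Prices) : ℝ :=
  (E.G 1 (beliefCut β (threshold₀ z)) - E.G 0 (beliefCut β (threshold₀ z)))
    + (E.G 1 (beliefCut β (threshold₁ z)) - E.G 0 (beliefCut β (threshold₁ z)))

variable {E}

lemma measurable_disclosure (hG : ∀ ω, Continuous (E.G ω)) {β : ℝ} (hβ : β ∈ Set.Ioo (0 : ℝ) 1) :
    Measurable (E.disclosure β) := by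
  have h0 := continuous_threshold₀
  have h1 := continuous_threshold₁
  have h2 := continuous_beliefCut hβ
  have h3 := hG 0
  have h4 := hG 1
  have : Continuous (E.disclosure β) := by unfold disclosure; fun_prop
  exact this.measurable

lemma abs_disclosure_le (β : ℝ) (z : Prices) : |E.disclosure β z| ≤ 2 := by
  have h0 := E.G_nonneg 0
  have h1 := E.G_nonneg 1
  have h2 := E.G_le_one 0
  have h3 := E.G_le_one 1
  unfold disclosure
  rw [abs_le]
  constructor
  · linarith [h2 (beliefCut β (threshold₀ z)), h2 (beliefCut β (threshold₁ z)),
      h1 (beliefCut β (threshold₀ z)), h1 (beliefCut β (threshold₁ z))]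
  · linarith [h0 (beliefCut β (threshold₀ z)), h0 (beliefCut β (threshold₁ z)),
      h3 (beliefCut β (threshold₀ z)), h3 (beliefCut β (threshold₁ z))]

lemma exists_G_gap_pos (hG : ∀ ω, Continuous (E.G ω)) {u v : ℝ} (hu : E.lowerBound < u)
    (hv : v < E.upperBound) : ∃ δ > 0, ∀ x ∈ Set.Icc u v, δ ≤ E.G 1 x - E.G 0 x := by
  rcases (Set.Icc u v).eq_empty_or_nonempty with h | h
  · exact ⟨1, one_pos, by simp [h]⟩
  obtain ⟨x, hx, hmin⟩ := isCompact_Icc.exists_isMinOn h ((hG 1).sub (hG 0)).continuousOn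
  exact ⟨_, sub_pos.2 (G_zero_lt_G_one hG ⟨hu.trans_le hx.1, hx.2.trans_lt hv⟩),
    fun y hy => hmin hy⟩

/-- Purchases whose thresholds fall in a compact part of the range of private beliefs disclose
information. -/
lemma mul_measure_le_integral_disclosure (hG : ∀ ω, Continuous (E.G ω)) {β δ u v : ℝ}
    (hβ : β ∈ Set.Ioo (0 : ℝ) 1) (h : ∀ x ∈ Set.Icc u v, δ ≤ E.G 1 x - E.G 0 x)
    (ψ : Measure Prices) [IsProbabilityMeasure ψ] {D : Set Prices} (hD : MeasurableSet D)
    (hDuv : ∀ z ∈ D, beliefCut β (threshold₀ z) ∈ Set.Icc u v ∨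
      beliefCut β (threshold₁ z) ∈ Set.Icc u v) :
    δ * ψ.real D ≤ ∫ z, E.disclosure β z ∂ψ := by
  obtain ⟨hi, he⟩ := integral_indicators ψ hD hD hD δ 0 0 0
  have h1 := integral_mono hi (integrable_of_mem_Icc (measurable_disclosure hG hβ)
    (abs_disclosure_le β)) fun z => by
      have h0 := G_zero_le_G_one hG (beliefCut β (threshold₀ z))
      have h1 := G_zero_le_G_one hG (beliefCut β (threshold₁ z))
      unfold disclosure
      by_cases hz : z ∈ D
      · simp only [Set.indicator_of_mem hz, Pi.one_apply]
        rcases hDuv z hz with h2 | h2 <;> linarith [h _ h2]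
      · simp only [Set.indicator_of_notMem hz]
        linarith
  rw [he] at h1
  linarith

lemma posteriorCDF_sub_le {β κ x y : ℝ} (hβ : β ∈ Set.Ioo (0 : ℝ) 1)
    (h : ∀ ω, E.G ω (beliefCut β y) - E.G ω (beliefCut β x) ≤ κ) :
    posteriorCDF (E.G 0) (E.G 1) β y - posteriorCDF (E.G 0) (E.G 1) β x ≤ κ := by
  have h0 := mul_le_mul_of_nonneg_left (h 0) hβ.1.le
  have h1 := mul_le_mul_of_nonneg_left (h 1) (sub_nonneg.2 hβ.2.le)
  unfold posteriorCDF
  linarith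

/-- With unbounded signals, every equilibrium discloses information. -/
lemma Unbounded.exists_disclosure_ge (hE : E.Unbounded) (hG : ∀ ω, Continuous (E.G ω)) {a b : ℝ}
    (ha : 0 < a) (hb : b < 1) :
    ∃ δ > 0, ∀ β ∈ Set.Icc a b, ∀ ψ₀ ψ₁ : Measure unitInterval, IsProbabilityMeasure ψ₀ →
      IsProbabilityMeasure ψ₁ → IsPriceEquilibrium (posteriorCDF (E.G 0) (E.G 1) β) ψ₀ ψ₁ →
      δ ≤ ∫ z, E.disclosure β z ∂(ψ₀.prod ψ₁) := by
  rcases lt_or_ge b a with hab | hab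
  · exact ⟨1, one_pos, fun β hβ => absurd (hβ.1.trans hβ.2) (not_le.2 hab)⟩
  have hb0 : 0 < 1 - b := by linarith
  set κ := E.G 0 ((1 - b) / 4) / 2 with hκ
  have hκ0 : 0 < κ := half_pos (G_pos hG 0 (by rw [hE.1]; linarith))
  obtain ⟨η, hη, hη'⟩ : ∃ η > 0, E.G 1 η < κ / 2 := by
    have h1 : Tendsto (E.G 1) (𝓝[>] 0) (𝓝 0) := by
      have := (hG 1).tendsto 0
      rw [E.G_eq_zero_of_nonpos 1 le_rfl] at this
      exact this.mono_left inf_le_left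
    obtain ⟨η, hη⟩ := ((h1.eventually (gt_mem_nhds (half_pos hκ0))).and
      self_mem_nhdsWithin).exists
    exact ⟨η, hη.2, hη.1⟩
  obtain ⟨δ, hδ, hgap⟩ := exists_G_gap_pos hG (u := η) (v := 1 - a * (κ / 2))
    (by rw [hE.1]; exact hη) (by rw [hE.2]; have := mul_pos ha (half_pos hκ0); linarith)
  refine ⟨δ * (κ / 2), by positivity, fun β hβ ψ₀ ψ₁ _ _ h => ?_⟩
  have hβ01 : β ∈ Set.Ioo (0 : ℝ) 1 := ⟨by linarith [hβ.1], by linarith [hβ.2]⟩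
  have hmono := posteriorCDF_mono hβ01 (E.G_mono 0) (E.G_mono 1)
  have hG01 : ∀ ω x, E.G ω x ∈ Set.Icc (0 : ℝ) 1 := fun ω x => ⟨E.G_nonneg ω x, E.G_le_one ω x⟩
  have hκ1 : κ ≤ 1 / 2 := by rw [hκ]; linarith [E.G_le_one 0 ((1 - b) / 4)]
  have hmeas := measure_threshold₁_interior_ge h hmono
    (posteriorCDF_mem hβ01 (hG01 0) (hG01 1)) hκ0.le (by
      have h1 : (1 - b) / 4 ≤ beliefCut β (1 / 4) := by
        rw [beliefCut, clamp_of_mem (by norm_num)]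
        have h2 := cut_denom_le_one hβ01 (y := 1 / 4) (by norm_num)
        have h3 := cut_denom_pos hβ01 (y := 1 / 4) (by norm_num)
        rw [le_div_iff₀ h3]
        have h4 : (1 - b) / 4 * (β * (1 - 1 / 4) + 1 / 4 * (1 - β)) ≤ (1 - b) / 4 * 1 :=
          mul_le_mul_of_nonneg_left h2 (by linarith)
        linarith [hβ.2]
      have h2 : E.G 0 ((1 - b) / 4) ≤ E.G 0 (beliefCut β (1 / 4)) := E.G_mono 0 h1
      have h3 := G_zero_le_G_one hG (beliefCut β (1 / 4))
      have h4 := mul_le_mul_of_nonneg_left h3 (sub_nonneg.2 hβ01.2.le)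
      unfold posteriorCDF
      linarith)
  refine (mul_le_mul_of_nonneg_left hmeas hδ.le).trans ?_
  refine mul_measure_le_integral_disclosure hG hβ01 hgap _
    ((measurableSet_le continuous_threshold₁.measurable measurable_const).inter
      (measurableSet_le measurable_const (hmono.measurable.comp
        continuous_threshold₁.measurable))) fun z hz => Or.inr ⟨?_, ?_⟩
  · by_contra hcon
    rw [not_le] at hcon
    have h1 : E.G 1 (beliefCut β (threshold₁ z)) ≤ E.G 1 η := E.G_mono 1 hcon.le
    have h2 := mul_le_mul_of_nonneg_left (G_zero_le_G_one hG (beliefCut β (threshold₁ z)))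
      hβ01.1.le
    have h3 := hz.2
    unfold posteriorCDF at h3
    linarith
  · have h1 : beliefCut β (threshold₁ z) ≤ beliefCut β (1 - κ / 2) := beliefCut_mono hβ01 hz.1
    have hI : κ / 2 ∈ Set.Icc (0 : ℝ) 1 := ⟨by linarith, by linarith⟩
    have h2 := one_sub_beliefCut hβ01 (1 - κ / 2)
    rw [sub_sub_cancel] at h2
    have hβ' : 1 - β ∈ Set.Ioo (0 : ℝ) 1 := ⟨by linarith [hβ01.2], by linarith [hβ01.1]⟩
    have h3 : a * (κ / 2) ≤ beliefCut (1 - β) (κ / 2) := by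
      rw [beliefCut, clamp_of_mem hI, le_div_iff₀ (cut_denom_pos hβ' hI)]
      have h4 := mul_le_mul_of_nonneg_left (cut_denom_le_one hβ' hI)
        (mul_pos ha (half_pos hκ0)).le
      have h5 := mul_le_mul_of_nonneg_right hβ.1 hI.1
      linarith
    linarith

/-- With bounded signals and vanishing likelihood, every equilibrium discloses information. -/
lemma VanishingLikelihood.exists_disclosure_ge {g : Fin 2 → ℝ → ℝ} (hV : E.VanishingLikelihood g)
    (hE : E.Bounded) (hg : E.HasContinuousDensities g) {a b : ℝ} (ha : 0 < a) (hb : b < 1) :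
    ∃ δ > 0, ∀ β ∈ Set.Icc a b, ∀ ψ₀ ψ₁ : Measure unitInterval, IsProbabilityMeasure ψ₀ →
      IsProbabilityMeasure ψ₁ → IsPriceEquilibrium (posteriorCDF (E.G 0) (E.G 1) β) ψ₀ ψ₁ →
      δ ≤ ∫ z, E.disclosure β z ∂(ψ₀.prod ψ₁) := by
  rcases lt_or_ge b a with hab | hab
  · exact ⟨1, one_pos, fun β hβ => absurd (hβ.1.trans hβ.2) (not_le.2 hab)⟩
  have hG := hg.continuous
  set lo := E.lowerBound with hlo
  set hi := E.upperBound with hhi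
  have hlohi : lo < hi := lowerBound_lt_upperBound hG
  have hlo0 : 0 < lo := hE.1
  have hhi1 : hi < 1 := hE.2
  have hb0 : 0 < 1 - b := by linarith
  set m := min a (1 - b) with hm
  have hm0 : 0 < m := lt_min ha hb0
  have hm1 : m ≤ 1 := (min_le_left _ _).trans (by linarith)
  set C := 1 / m ^ 2 with hC
  have hC1 : 1 ≤ C := by
    rw [hC, le_div_iff₀ (by positivity), one_mul]
    exact pow_le_one₀ hm0.le hm1
  set Λ := min (a * lo) ((1 - b) * (1 - hi)) with hΛ
  have hΛ0 : 0 < Λ := lt_min (mul_pos ha hlo0) (mul_pos hb0 (by linarith))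
  have hκ : 0 < Λ / (100 * C) := by positivity
  obtain ⟨η₁, hη₁, hflat₁⟩ := exists_flat_lower hg hV.1 hκ
  obtain ⟨η₂, hη₂, hflat₂⟩ := exists_flat_upper hg hV.2 hκ
  set η := min (min (η₁ / 2) (η₂ / 2)) (min (1 / 2) ((hi - lo) / 3)) with hη
  have hη0 : 0 < η := by
    rw [hη]
    refine lt_min (lt_min ?_ ?_) (lt_min ?_ ?_) <;> linarith
  have hηη₁ : 2 * η ≤ η₁ := by
    have : η ≤ η₁ / 2 := (min_le_left _ _).trans (min_le_left _ _)
    linarith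
  have hηη₂ : 2 * η ≤ η₂ := by
    have : η ≤ η₂ / 2 := (min_le_left _ _).trans (min_le_right _ _)
    linarith
  have hη_half : η ≤ 1 / 2 := (min_le_right _ _).trans (min_le_left _ _)
  have hη_third : η ≤ (hi - lo) / 3 := (min_le_right _ _).trans (min_le_right _ _)
  have hsmall : Λ / (100 * C) * (2 * η) ≤ Λ / 100 := by
    have h1 : Λ / (100 * C) ≤ Λ / 100 :=
      div_le_div_of_nonneg_left hΛ0.le (by norm_num) (by linarith)
    have h2 := mul_le_mul h1 (show 2 * η ≤ 1 by linarith) (by linarith) (by positivity)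
    linarith
  obtain ⟨δ, hδ, hgap⟩ := exists_G_gap_pos hG (u := lo + η) (v := hi - η)
    (by linarith) (by linarith)
  obtain ⟨K, hK0, hK⟩ := exists_G_lipschitz hg
  set K' := max 1 (K * C) with hK'
  have hK'1 : 1 ≤ K' := le_max_left _ _
  set ε := min η (min lo (1 - hi)) / C with hε
  have hε0 : 0 < ε := div_pos (lt_min hη0 (lt_min hlo0 (by linarith))) (by linarith)
  have hCε : C * ε = min η (min lo (1 - hi)) := mul_div_cancel₀ _ (by linarith)
  have hCη : C * ε ≤ η := hCε ▸ min_le_left _ _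
  have hClo : C * ε ≤ lo := hCε ▸ (min_le_right _ _).trans (min_le_left _ _)
  have hChi : C * ε ≤ 1 - hi := hCε ▸ (min_le_right _ _).trans (min_le_right _ _)
  refine ⟨δ * (Λ / (100 * K')), by positivity, fun β hβ ψ₀ ψ₁ _ _ h => ?_⟩
  have hβ01 : β ∈ Set.Ioo (0 : ℝ) 1 := ⟨by linarith [hβ.1], by linarith [hβ.2]⟩
  have hmβ : m ≤ β := (min_le_left _ _).trans hβ.1
  have hmβ' : m ≤ 1 - β := (min_le_right _ _).trans (by linarith [hβ.2])
  have hcut : ∀ {x y : ℝ}, x ≤ y → beliefCut β y - beliefCut β x ≤ C * (y - x) := fun hxy =>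
    beliefCut_sub_le hm0 hmβ hmβ' hxy
  have hcut' : ∀ x : ℝ, beliefCut β (x + ε) ≤ beliefCut β x + C * ε := fun x => by
    have := hcut (show x ≤ x + ε by linarith)
    rw [add_sub_cancel_left] at this
    linarith
  have hcutmono := beliefCut_mono hβ01
  have hmono := posteriorCDF_mono hβ01 (E.G_mono 0) (E.G_mono 1)
  have hG01 : ∀ ω x, E.G ω x ∈ Set.Icc (0 : ℝ) 1 := fun ω x => ⟨E.G_nonneg ω x, E.G_le_one ω x⟩
  have hlI : lo + η ∈ Set.Icc (0 : ℝ) 1 := ⟨by linarith, by linarith⟩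
  have huI : hi - η ∈ Set.Icc (0 : ℝ) 1 := ⟨by linarith, by linarith⟩
  set l := posterior β (lo + η) with hl
  set u := posterior β (hi - η) with hu
  have hTl : beliefCut β l = lo + η := beliefCut_posterior hβ01 hlI
  have hTu : beliefCut β u = hi - η := beliefCut_posterior hβ01 huI
  have hflat : ∀ x, beliefCut β x ≤ lo + η ∨ hi - 2 * η ≤ beliefCut β x →
      ∀ ω, E.G ω (beliefCut β (x + ε)) - E.G ω (beliefCut β x) ≤ Λ / 100 * ε := fun x hx ω => by
    have h1 : beliefCut β x ≤ beliefCut β (x + ε) := hcutmono (by linarith)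
    have h2 : E.G ω (beliefCut β (x + ε)) - E.G ω (beliefCut β x)
        ≤ Λ / (100 * C) * (beliefCut β (x + ε) - beliefCut β x) := by
      rcases hx with hx | hx
      · exact hflat₁ ω _ _ h1 (by linarith [hcut' x])
      · exact hflat₂ ω _ _ h1 (by linarith)
    have h3 := mul_le_mul_of_nonneg_left (show beliefCut β (x + ε) - beliefCut β x ≤ C * ε by
      linarith [hcut' x]) hκ.le
    have h4 : Λ / (100 * C) * (C * ε) = Λ / 100 * ε := by
      field_simp
    linarith
  have hmain := measure_threshold_interior_ge h hmono (posteriorCDF_mem hβ01 (hG01 0) (hG01 1))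
    (ε := ε) (K := K') (l := l) (u := u) (Λ := Λ) hε0 hK'1 hΛ0
    (by
      have h1 := le_posterior hβ01 hlI
      have h2 := mul_le_mul hβ.1 (show lo ≤ lo + η by linarith) hlo0.le hβ01.1.le
      exact (min_le_left _ _).trans (h2.trans h1))
    (lt_of_beliefCut_lt hβ01 (by rw [hTl, hTu]; linarith))
    (by
      have h1 := le_one_sub_posterior hβ01 huI
      have h2 := mul_le_mul (show 1 - b ≤ 1 - β by linarith [hβ.2])
        (show 1 - hi ≤ 1 - (hi - η) by linarith) (by linarith) (by linarith [hβ01.2])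
      have h3 : Λ ≤ (1 - b) * (1 - hi) := min_le_right _ _
      linarith)
    (fun x hx => posteriorCDF_sub_le hβ01 (hflat x (Or.inl (hTl ▸ hcutmono hx))))
    (fun x hx => posteriorCDF_sub_le hβ01 (hflat x (Or.inr (by
      have h1 := hcutmono hx
      have h2 := hcut' (u - ε)
      rw [sub_add_cancel, hTu] at h2
      linarith))))
    (fun x => posteriorCDF_sub_le hβ01 fun ω => by
      have h1 := hK ω _ _ (hcutmono (show x ≤ x + ε by linarith))
      have h2 := mul_le_mul_of_nonneg_left (show beliefCut β (x + ε) - beliefCut β x ≤ C * ε by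
        linarith [hcut' x]) hK0.le
      have h3 := mul_le_mul_of_nonneg_right (le_max_right 1 (K * C)) hε0.le
      linarith)
    (by
      have h1 : ∀ ω, E.G ω (beliefCut β (l + ε)) - E.G ω (beliefCut β 0) ≤ Λ / 100 := fun ω => by
        rw [beliefCut_of_nonpos le_rfl, E.G_eq_zero_of_nonpos ω le_rfl,
          ← G_eq_zero hG ω (le_refl lo)]
        have h2 : beliefCut β (l + ε) ≤ lo + 2 * η := by linarith [hcut' l]
        have h3 := hflat₁ ω lo (lo + 2 * η) (by linarith) (by linarith)
        have h4 := E.G_mono ω h2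
        rw [add_sub_cancel_left] at h3
        linarith
      have h2 := posteriorCDF_sub_le hβ01 h1
      have h3 : posteriorCDF (E.G 0) (E.G 1) β 0 = 0 := by
        simp [posteriorCDF, beliefCut_of_nonpos, E.G_eq_zero_of_nonpos]
      linarith)
    (by
      have h1 : ∀ ω, E.G ω (beliefCut β 1) - E.G ω (beliefCut β (u - ε)) ≤ Λ / 100 := fun ω => by
        rw [beliefCut_of_one_le hβ01 le_rfl, G_one hG ω, ← G_eq_one hG ω (le_refl hi)]
        have h2 : hi - 2 * η ≤ beliefCut β (u - ε) := by
          have h2 := hcut' (u - ε)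
          rw [sub_add_cancel, hTu] at h2
          linarith
        have h3 := hflat₂ ω (hi - 2 * η) hi (by linarith) (by linarith)
        have h4 := E.G_mono ω h2
        rw [sub_sub_cancel] at h3
        linarith
      have h2 := posteriorCDF_sub_le hβ01 h1
      have h3 : posteriorCDF (E.G 0) (E.G 1) β 1 = 1 := by
        simp [posteriorCDF, beliefCut_of_one_le hβ01, G_one hG]
      linarith)
    (fun x hx => by
      have h1 : hi ≤ beliefCut β x := by
        have h2 := hcut' (1 - ε)
        rw [sub_add_cancel, beliefCut_of_one_le hβ01 le_rfl] at h2
        have h3 := hcutmono hx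
        linarith
      simp [posteriorCDF, G_eq_one hG _ h1])
    (fun x hx => by
      have h1 : beliefCut β x ≤ lo := by
        have h2 := hcut' 0
        rw [zero_add, beliefCut_of_nonpos le_rfl, zero_add] at h2
        exact (hcutmono hx).trans (h2.trans hClo)
      simp [posteriorCDF, G_eq_zero hG _ h1])
  refine (mul_le_mul_of_nonneg_left hmain hδ.le).trans ?_
  refine mul_measure_le_integral_disclosure hG hβ01 hgap _
    ((continuous_threshold₀.measurable measurableSet_Ioo).union
      (continuous_threshold₁.measurable measurableSet_Ioo)) fun z hz => ?_
  rcases hz with hz | hz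
  · exact Or.inl ⟨hTl ▸ hcutmono hz.1.le, hTu ▸ hcutmono hz.2.le⟩
  · exact Or.inr ⟨hTl ▸ hcutmono hz.1.le, hTu ▸ hcutmono hz.2.le⟩

end SignalStructure

/-! ### Optimal consumers -/

section Consumer

variable {S : Type*} [MeasurableSpace S] (E : SignalStructure S) {β : ℝ}

/-- The payoff of the action `a` at the private belief `q`, up to a positive factor that does not
depend on `a`. -/
def actionValue (β q : ℝ) (τ : Prices) (a : Action) : ℝ :=
  β * q * utility a τ 0 + (1 - β) * (1 - q) * utility a τ 1

/-- The best reply of a consumer with private belief `q`. At the two cuts he is indifferent. -/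
def bestReply (β : ℝ) (τ : Prices) (q : ℝ) : Action :=
  if beliefCut β (threshold₀ τ) < q then Action.buy 0
  else if q < beliefCut β (threshold₁ τ) then Action.buy 1
  else Action.exit

lemma measurable_bestReply (β : ℝ) (τ : Prices) : Measurable (bestReply β τ) :=
  Measurable.ite (measurableSet_lt measurable_const measurable_id) measurable_const
    (Measurable.ite (measurableSet_lt measurable_id measurable_const) measurable_const
      measurable_const)

lemma threshold₀_mem (τ : Prices) : threshold₀ τ ∈ Set.Icc (0 : ℝ) 1 := by
  have h0 := τ.1.2
  have h1 := τ.2.2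
  exact ⟨le_max_of_le_left h0.1, max_le h0.2 (by linarith [h0.2, h1.1])⟩

lemma threshold₁_mem (τ : Prices) : threshold₁ τ ∈ Set.Icc (0 : ℝ) 1 := by
  have h0 := τ.1.2
  have h1 := τ.2.2
  exact ⟨le_min (by linarith [h1.2]) (by linarith [h0.1, h1.2]),
    min_le_of_left_le (by linarith [h1.1])⟩

lemma threshold₁_le_threshold₀ (τ : Prices) : threshold₁ τ ≤ threshold₀ τ :=
  (min_le_right _ _).trans (le_max_right _ _)

/-- Away from the two cuts the best reply is strict. -/
lemma actionValue_lt (hβ : β ∈ Set.Ioo (0 : ℝ) 1) {q : ℝ} (hq : q ∈ Set.Icc (0 : ℝ) 1)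
    {τ : Prices} (h0 : q ≠ beliefCut β (threshold₀ τ)) (h1 : q ≠ beliefCut β (threshold₁ τ))
    {a : Action} (ha : a ≠ bestReply β τ q) :
    actionValue β q τ a < actionValue β q τ (bestReply β τ q) := by
  have hA : 0 ≤ β * q := mul_nonneg hβ.1.le hq.1
  have hB : 0 ≤ (1 - β) * (1 - q) := mul_nonneg (sub_nonneg.2 hβ.2.le) (sub_nonneg.2 hq.2)
  have e0 : actionValue β q τ (Action.buy 0)
      = β * q - τ.1 * (β * q + (1 - β) * (1 - q)) := by
    simp [actionValue, utility, price]; ring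
  have e1 : actionValue β q τ (Action.buy 1)
      = (1 - β) * (1 - q) - τ.2 * (β * q + (1 - β) * (1 - q)) := by
    simp [actionValue, utility, price]; ring
  have e2 : actionValue β q τ Action.exit = 0 := by simp [actionValue, utility]
  -- each threshold is attained by one of its two competitors
  have c0 : q < beliefCut β (threshold₀ τ) →
      actionValue β q τ (Action.buy 0) < 0 ∨
        actionValue β q τ (Action.buy 0) < actionValue β q τ (Action.buy 1) := fun h => by
    rw [lt_beliefCut_iff hβ (threshold₀_mem τ)] at h
    rw [e0, e1]
    rcases max_choice (τ.1 : ℝ) ((1 + τ.1 - τ.2) / 2) with hm | hm <;>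
      rw [threshold₀, hm] at h
    · left; linarith
    · right; linarith
  have c1 : beliefCut β (threshold₁ τ) < q →
      actionValue β q τ (Action.buy 1) < 0 ∨
        actionValue β q τ (Action.buy 1) < actionValue β q τ (Action.buy 0) := fun h => by
    rw [beliefCut_lt_iff hβ (threshold₁_mem τ)] at h
    rw [e0, e1]
    rcases min_choice (1 - (τ.2 : ℝ)) ((1 + τ.1 - τ.2) / 2) with hm | hm <;>
      rw [threshold₁, hm] at h
    · left; linarith
    · right; linarith
  have d0 : beliefCut β (threshold₀ τ) < q →
      0 < actionValue β q τ (Action.buy 0) ∧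
        actionValue β q τ (Action.buy 1) < actionValue β q τ (Action.buy 0) := fun h => by
    rw [beliefCut_lt_iff hβ (threshold₀_mem τ)] at h
    rw [e0, e1]
    have m1 := mul_le_mul_of_nonneg_right (le_max_left (τ.1 : ℝ) ((1 + τ.1 - τ.2) / 2))
      (add_nonneg hA hB)
    have m2 := mul_le_mul_of_nonneg_right (le_max_right (τ.1 : ℝ) ((1 + τ.1 - τ.2) / 2))
      (add_nonneg hA hB)
    rw [threshold₀] at h
    constructor <;> linarith
  have d1 : q < beliefCut β (threshold₁ τ) →
      0 < actionValue β q τ (Action.buy 1) ∧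
        actionValue β q τ (Action.buy 0) < actionValue β q τ (Action.buy 1) := fun h => by
    rw [lt_beliefCut_iff hβ (threshold₁_mem τ)] at h
    rw [e0, e1]
    have m1 := mul_le_mul_of_nonneg_right (min_le_left (1 - (τ.2 : ℝ)) ((1 + τ.1 - τ.2) / 2))
      (add_nonneg hA hB)
    have m2 := mul_le_mul_of_nonneg_right (min_le_right (1 - (τ.2 : ℝ)) ((1 + τ.1 - τ.2) / 2))
      (add_nonneg hA hB)
    rw [threshold₁] at h
    constructor <;> linarith
  have hcases : a = Action.buy 0 ∨ a = Action.buy 1 ∨ a = Action.exit := by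
    rcases a with i | _
    · fin_cases i <;> simp
    · simp
  unfold bestReply at ha ⊢
  split_ifs at ha ⊢ with i0 i1
  · have := d0 i0
    rcases hcases with rfl | rfl | rfl
    · exact absurd rfl ha
    · exact this.2
    · rw [e2]; exact this.1
  · have := d1 i1
    rcases hcases with rfl | rfl | rfl
    · exact this.2
    · exact absurd rfl ha
    · rw [e2]; exact this.1
  · have := c0 (lt_of_le_of_ne (not_lt.1 i0) h0)
    have := c1 (lt_of_le_of_ne (not_lt.1 i1) (Ne.symm h1))
    rw [e2]
    rcases hcases with rfl | rfl | rfl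
    · grind
    · grind
    · exact absurd rfl ha

lemma integrable_action {ν : Measure Action} [IsFiniteMeasure ν] (f : Action → ℝ) :
    Integrable f ν := by
  refine Integrable.of_bound (C := max (max |f (Action.buy 0)| |f (Action.buy 1)|)
    |f Action.exit|) (measurable_from_top (f := f)).aestronglyMeasurable (ae_of_all _ fun a => ?_)
  rw [Real.norm_eq_abs]
  rcases a with i | _
  · fin_cases i <;> simp
  · simp

lemma abs_utility_le (a : Action) (τ : Prices) (ω : Fin 2) : |utility a τ ω| ≤ 1 := by
  have h0 := τ.1.2
  have h1 := τ.2.2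
  rcases a with i | _
  · rw [abs_le]
    unfold utility price
    constructor <;> dsimp only <;> split_ifs <;> linarith [h0.1, h0.2, h1.1, h1.2]
  · simp [utility]

lemma abs_actionValue_le (hβ : β ∈ Set.Ioo (0 : ℝ) 1) {q : ℝ} (hq : q ∈ Set.Icc (0 : ℝ) 1)
    (τ : Prices) (a : Action) : |actionValue β q τ a| ≤ 1 := by
  have h0 := abs_le.1 (abs_utility_le a τ 0)
  have h1 := abs_le.1 (abs_utility_le a τ 1)
  have hA : 0 ≤ β * q := mul_nonneg hβ.1.le hq.1
  have hB : 0 ≤ (1 - β) * (1 - q) := mul_nonneg (sub_nonneg.2 hβ.2.le) (sub_nonneg.2 hq.2)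
  have hAB : β * q + (1 - β) * (1 - q) ≤ 1 := posterior_denom_le_one hβ hq
  rw [abs_le]
  unfold actionValue
  constructor <;> nlinarith

lemma measurable_integral_decision {f : S → Action → ℝ}
    (hf : Measurable (Function.uncurry f)) (d : Kernel (Prices × S) Action) [IsMarkovKernel d]
    (τ : Prices) : Measurable fun s => ∫ a, f s a ∂(d (τ, s)) := by
  have h := hf.stronglyMeasurable.integral_kernel_prod_right
    (κ := d.comap (fun s => (τ, s)) measurable_prodMk_left)
  simpa [Function.uncurry] using h.measurable

lemma abs_integral_decision_le {f : Action → ℝ} {M : ℝ} (hf : ∀ a, |f a| ≤ M) (ν : Measure Action)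
    [IsProbabilityMeasure ν] : |∫ a, f a ∂ν| ≤ M := by
  have := norm_integral_le_of_norm_le_const (μ := ν) (f := f) (C := M) (ae_of_all _ hf)
  simpa using this

lemma measurable_actionValue (β : ℝ) (τ : Prices) :
    Measurable (Function.uncurry fun (s : S) a => actionValue β (E.privateBelief s) τ a) := by
  have h : ∀ ω, Measurable fun z : S × Action => utility z.2 τ ω := fun ω =>
    (measurable_from_top (f := fun a => utility a τ ω)).comp measurable_snd
  have hp : Measurable fun z : S × Action => E.privateBelief z.1 :=
    E.measurable_privateBelief.comp measurable_fst
  exact ((measurable_const.mul hp).mul (h 0)).add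
    ((measurable_const.mul (measurable_const.sub hp)).mul (h 1))

lemma integrable_actionValue (hβ : β ∈ Set.Ioo (0 : ℝ) 1) (τ : Prices)
    (d : Kernel (Prices × S) Action) [IsMarkovKernel d] :
    Integrable (fun s => ∫ a, actionValue β (E.privateBelief s) τ a ∂(d (τ, s)))
      (E.F 0 + E.F 1) := by
  refine Integrable.of_bound (C := 1) (measurable_integral_decision
    (measurable_actionValue E β τ) d τ).aestronglyMeasurable (ae_of_all _ fun s => ?_)
  exact abs_integral_decision_le (fun a => abs_actionValue_le hβ (E.privateBelief_mem s) τ a) _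

/-- The payoff of a decision rule, as an integral with respect to the measure `F 0 + F 1` that
dominates both states. -/
lemma consumerPayoff_eq (τ : Prices) (d : Kernel (Prices × S) Action) [IsMarkovKernel d] :
    consumerPayoff E β τ d
      = ∫ s, ∫ a, actionValue β (E.privateBelief s) τ a ∂(d (τ, s)) ∂(E.F 0 + E.F 1) := by
  have hm : ∀ ω, Measurable fun s => ∫ a, utility a τ ω ∂(d (τ, s)) := fun ω =>
    measurable_integral_decision (f := fun _ a => utility a τ ω)
      ((measurable_from_top (f := fun a => utility a τ ω)).comp measurable_snd) d τ
  have hi : ∀ ω, Integrable (fun s => E.beliefWeight ω s * ∫ a, utility a τ ω ∂(d (τ, s)))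
      (E.F 0 + E.F 1) := fun ω => by
    refine Integrable.of_bound (C := 1)
      ((E.measurable_beliefWeight ω).mul (hm ω)).aestronglyMeasurable (ae_of_all _ fun s => ?_)
    rw [Real.norm_eq_abs, abs_mul, abs_of_nonneg (E.beliefWeight_mem ω s).1]
    exact mul_le_one₀ (E.beliefWeight_mem ω s).2 (abs_nonneg _)
      (abs_integral_decision_le (fun a => abs_utility_le a τ ω) _)
  rw [consumerPayoff, Fin.sum_univ_two, E.integral_F 0, E.integral_F 1, ← integral_const_mul,
    ← integral_const_mul, ← integral_add ((hi 0).const_mul _) ((hi 1).const_mul _)]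
  refine integral_congr_ae (ae_of_all _ fun s => ?_)
  simp only [actionValue]
  rw [integral_add (integrable_action _) (integrable_action _), integral_const_mul,
    integral_const_mul]
  simp [weight, SignalStructure.beliefWeight, mul_assoc]

lemma eq_dirac_of_ae_eq {ν : Measure Action} [IsProbabilityMeasure ν] {b : Action}
    (h : ∀ᵐ a ∂ν, a = b) : ν = Measure.dirac b := by
  have h1 : ν.map id = ν.map fun _ => b := Measure.map_congr h
  simpa [Measure.map_const] using h1

lemma measurable_bestReply_privateBelief (β : ℝ) (τ : Prices) :
    Measurable fun z : Prices × S => bestReply β τ (E.privateBelief z.2) :=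
  (measurable_bestReply β τ).comp (E.measurable_privateBelief.comp measurable_snd)

/-- An optimal decision rule is the best reply for almost every signal, since ties have
probability `0`. -/
lemma ae_decision_eq_dirac (hG : ∀ ω, Continuous (E.G ω)) (hβ : β ∈ Set.Ioo (0 : ℝ) 1)
    (d : Kernel (Prices × S) Action) [IsMarkovKernel d] (τ : Prices)
    (hd : ∀ d' : Kernel (Prices × S) Action, IsMarkovKernel d' →
      consumerPayoff E β τ d' ≤ consumerPayoff E β τ d) (ω : Fin 2) :
    ∀ᵐ s ∂(E.F ω), d (τ, s) = Measure.dirac (bestReply β τ (E.privateBelief s)) := by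
  have hbm := measurable_bestReply_privateBelief E β τ
  have hle := hd (Kernel.deterministic _ hbm) inferInstance
  have hne : ∀ x, ∀ᵐ s ∂(E.F 0 + E.F 1), E.privateBelief s ≠ x := fun x => by
    rw [ae_iff]
    simp only [not_not, Measure.add_apply, E.F_belief_eq hG, add_zero]
  have hpt : ∀ᵐ s ∂(E.F 0 + E.F 1), ∀ a, a ≠ bestReply β τ (E.privateBelief s) →
      actionValue β (E.privateBelief s) τ a
        < actionValue β (E.privateBelief s) τ (bestReply β τ (E.privateBelief s)) := by
    filter_upwards [hne (beliefCut β (threshold₀ τ)), hne (beliefCut β (threshold₁ τ))]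
      with s h0 h1 a ha
    exact actionValue_lt hβ (E.privateBelief_mem s) h0 h1 ha
  have hpt' : ∀ᵐ s ∂(E.F 0 + E.F 1), ∀ a, actionValue β (E.privateBelief s) τ a
        ≤ actionValue β (E.privateBelief s) τ (bestReply β τ (E.privateBelief s)) := by
    filter_upwards [hpt] with s hs a
    rcases eq_or_ne a (bestReply β τ (E.privateBelief s)) with h | h
    · rw [← h]
    · exact (hs a h).le
  have hi := integrable_actionValue E hβ τ d
  have hi' := integrable_actionValue E hβ τ (Kernel.deterministic _ hbm)
  rw [consumerPayoff_eq, consumerPayoff_eq] at hle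
  simp only [Kernel.deterministic_apply, integral_dirac] at hle hi'
  have hae : ∀ᵐ s ∂(E.F 0 + E.F 1), ∫ a, actionValue β (E.privateBelief s) τ a ∂(d (τ, s))
      = actionValue β (E.privateBelief s) τ (bestReply β τ (E.privateBelief s)) := by
    have hle' : (fun s => ∫ a, actionValue β (E.privateBelief s) τ a ∂(d (τ, s)))
        ≤ᵐ[E.F 0 + E.F 1]
        fun s => actionValue β (E.privateBelief s) τ (bestReply β τ (E.privateBelief s)) := by
      filter_upwards [hpt'] with s hs
      have := integral_mono (μ := d (τ, s)) (integrable_action _) (integrable_const _) hs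
      simpa using this
    exact (integral_eq_iff_of_ae_le hi hi' hle').1 (le_antisymm (integral_mono_ae hi hi' hle') hle)
  have hfin : ∀ᵐ s ∂(E.F 0 + E.F 1),
      d (τ, s) = Measure.dirac (bestReply β τ (E.privateBelief s)) := by
    filter_upwards [hae, hpt, hpt'] with s hs hlt hle
    refine eq_dirac_of_ae_eq ?_
    have := ae_eq_of_le_of_integral_eq (μ := d (τ, s)) (integrable_action
      fun a => actionValue β (E.privateBelief s) τ a) hle hs
    filter_upwards [this] with a ha
    by_contra hcon
    exact (hlt a hcon).ne ha
  have hac : E.F ω ≪ E.F 0 + E.F 1 :=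
    (E.absolutelyContinuous ω 0).trans (Measure.AbsolutelyContinuous.rfl.add_right _)
  exact hac.ae_le hfin

/-- Expectations over the action of an optimal consumer. -/
lemma integral_bestReply (hG : ∀ ω, Continuous (E.G ω)) (hβ : β ∈ Set.Ioo (0 : ℝ) 1)
    (τ : Prices) (ω : Fin 2) {f : Action → ℝ} (hf : f Action.exit = 0) :
    ∫ s, f (bestReply β τ (E.privateBelief s)) ∂(E.F ω)
      = f (Action.buy 0) * (1 - E.G ω (beliefCut β (threshold₀ τ)))
        + f (Action.buy 1) * E.G ω (beliefCut β (threshold₁ τ)) := by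
  have hlt : MeasurableSet {s | E.privateBelief s < beliefCut β (threshold₁ τ)} :=
    E.measurableSet_belief_lt _
  have hlt0 : MeasurableSet {s | E.privateBelief s < beliefCut β (threshold₀ τ)} :=
    E.measurableSet_belief_lt _
  have hle := beliefCut_mono hβ (threshold₁_le_threshold₀ τ)
  have hne : ∀ᵐ s ∂(E.F ω), E.privateBelief s ≠ beliefCut β (threshold₀ τ) := by
    rw [ae_iff]
    simpa only [not_not] using E.F_belief_eq hG ω _
  have hpt : ∀ᵐ s ∂(E.F ω), f (bestReply β τ (E.privateBelief s))
      = (f (Action.buy 0) - f (Action.buy 0) *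
          {s | E.privateBelief s < beliefCut β (threshold₀ τ)}.indicator 1 s)
        + f (Action.buy 1) *
          {s | E.privateBelief s < beliefCut β (threshold₁ τ)}.indicator 1 s := by
    filter_upwards [hne] with s hs
    simp only [bestReply, Set.indicator_apply, Set.mem_ofPred_eq, Pi.one_apply]
    rcases lt_or_gt_of_ne hs with h | h
    · rw [if_neg (not_lt.2 h.le), if_pos h]
      split_ifs <;> simp [hf]
    · rw [if_pos h, if_neg (not_lt.2 h.le), if_neg (not_lt.2 (hle.trans h.le))]
      simp
  have hi : ∀ {A : Set S}, MeasurableSet A → Integrable (A.indicator (1 : S → ℝ)) (E.F ω) :=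
    fun hA => (integrable_const (1 : ℝ)).indicator hA
  have hi0 : Integrable (fun s => f (Action.buy 0) - f (Action.buy 0) *
      {s | E.privateBelief s < beliefCut β (threshold₀ τ)}.indicator 1 s) (E.F ω) :=
    (integrable_const _).sub ((hi hlt0).const_mul _)
  rw [integral_congr_ae hpt, integral_add hi0 ((hi hlt).const_mul _),
    integral_sub (integrable_const _) ((hi hlt0).const_mul _),
    integral_const_mul, integral_const_mul, integral_indicator_one hlt0,
    integral_indicator_one hlt]
  simp [SignalStructure.G]
  ring

end Consumer

section Equilibrium

variable {S : Type*} [MeasurableSpace S] {E : SignalStructure S} {β : ℝ}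
  {ψ₀ ψ₁ : Measure unitInterval} {d : Kernel (Prices × S) Action} [IsMarkovKernel d]

lemma IsStageEquilibrium.ae_decision_eq_dirac (h : IsStageEquilibrium E β ψ₀ ψ₁ d)
    (hG : ∀ ω, Continuous (E.G ω)) (hβ : β ∈ Set.Ioo (0 : ℝ) 1) (τ : Prices) (ω : Fin 2) :
    ∀ᵐ s ∂(E.F ω), d (τ, s) = Measure.dirac (bestReply β τ (E.privateBelief s)) :=
  PricedHerding.ae_decision_eq_dirac E hG hβ d τ (h.consumer τ) ω

lemma IsStageEquilibrium.integral_decision (h : IsStageEquilibrium E β ψ₀ ψ₁ d)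
    (hG : ∀ ω, Continuous (E.G ω)) (hβ : β ∈ Set.Ioo (0 : ℝ) 1) (τ : Prices) (ω : Fin 2)
    {f : Action → ℝ} (hf : f Action.exit = 0) :
    ∫ s, ∫ a, f a ∂(d (τ, s)) ∂(E.F ω)
      = f (Action.buy 0) * (1 - E.G ω (beliefCut β (threshold₀ τ)))
        + f (Action.buy 1) * E.G ω (beliefCut β (threshold₁ τ)) := by
  rw [← integral_bestReply E hG hβ τ ω hf]
  refine integral_congr_ae ?_
  filter_upwards [h.ae_decision_eq_dirac hG hβ τ ω] with s hs
  rw [hs, integral_dirac]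

lemma measurable_G_comp (hG : ∀ ω, Continuous (E.G ω)) (hβ : β ∈ Set.Ioo (0 : ℝ) 1)
    {c : Prices → ℝ} (hc : Continuous c) (ω : Fin 2) :
    Measurable fun τ => E.G ω (beliefCut β (c τ)) :=
  ((hG ω).comp ((continuous_beliefCut hβ).comp hc)).measurable

lemma abs_mul_le_one {x y : ℝ} (hx : x ∈ Set.Icc (0 : ℝ) 1) (hy : y ∈ Set.Icc (0 : ℝ) 1) :
    |x * y| ≤ 1 := by
  rw [abs_of_nonneg (mul_nonneg hx.1 hy.1)]
  exact mul_le_one₀ hx.2 hy.1 hy.2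

lemma IsStageEquilibrium.firmPayoff_zero (h : IsStageEquilibrium E β ψ₀ ψ₁ d)
    (hG : ∀ ω, Continuous (E.G ω)) (hβ : β ∈ Set.Ioo (0 : ℝ) 1) (ρ₀ ρ₁ : Measure unitInterval)
    [IsProbabilityMeasure ρ₀] [IsProbabilityMeasure ρ₁] :
    firmPayoff E 0 β ρ₀ ρ₁ d = ∫ z : Prices,
      (z.1 : ℝ) * (1 - posteriorCDF (E.G 0) (E.G 1) β (threshold₀ z)) ∂(ρ₀.prod ρ₁) := by
  have hi : ∀ ω, Integrable (fun z : Prices =>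
      (z.1 : ℝ) * (1 - E.G ω (beliefCut β (threshold₀ z)))) (ρ₀.prod ρ₁) := fun ω =>
    integrable_of_mem_Icc ((by fun_prop : Measurable fun z : Prices => (z.1 : ℝ)).mul
      (measurable_const.sub (measurable_G_comp hG hβ continuous_threshold₀ ω)))
      fun z => abs_mul_le_one z.1.2 ⟨by linarith [E.G_le_one ω (beliefCut β (threshold₀ z))],
        by linarith [E.G_nonneg ω (beliefCut β (threshold₀ z))]⟩
  have hp : ∀ ω, ∫ τ, ∫ s, ∫ a, profit 0 a τ ∂(d (τ, s)) ∂(E.F ω) ∂(ρ₀.prod ρ₁)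
      = ∫ z : Prices, (z.1 : ℝ) * (1 - E.G ω (beliefCut β (threshold₀ z))) ∂(ρ₀.prod ρ₁) :=
    fun ω => by
      refine integral_congr_ae (ae_of_all _ fun z => ?_)
      refine (h.integral_decision hG hβ z ω (f := fun a => profit 0 a z) rfl).trans ?_
      simp [profit, price]
  rw [firmPayoff, Fin.sum_univ_two, hp, hp, ← integral_const_mul, ← integral_const_mul,
    ← integral_add ((hi 0).const_mul _) ((hi 1).const_mul _)]
  refine integral_congr_ae (ae_of_all _ fun z => ?_)
  simp only [weight, posteriorCDF, if_true, if_neg (one_ne_zero : (1 : Fin 2) ≠ 0)]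
  ring

lemma IsStageEquilibrium.firmPayoff_one (h : IsStageEquilibrium E β ψ₀ ψ₁ d)
    (hG : ∀ ω, Continuous (E.G ω)) (hβ : β ∈ Set.Ioo (0 : ℝ) 1) (ρ₀ ρ₁ : Measure unitInterval)
    [IsProbabilityMeasure ρ₀] [IsProbabilityMeasure ρ₁] :
    firmPayoff E 1 β ρ₀ ρ₁ d = ∫ z : Prices,
      (z.2 : ℝ) * posteriorCDF (E.G 0) (E.G 1) β (threshold₁ z) ∂(ρ₀.prod ρ₁) := by
  have hi : ∀ ω, Integrable (fun z : Prices =>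
      (z.2 : ℝ) * E.G ω (beliefCut β (threshold₁ z))) (ρ₀.prod ρ₁) := fun ω =>
    integrable_of_mem_Icc ((by fun_prop : Measurable fun z : Prices => (z.2 : ℝ)).mul
      (measurable_G_comp hG hβ continuous_threshold₁ ω))
      fun z => abs_mul_le_one z.2.2 ⟨E.G_nonneg ω _, E.G_le_one ω _⟩
  have hp : ∀ ω, ∫ τ, ∫ s, ∫ a, profit 1 a τ ∂(d (τ, s)) ∂(E.F ω) ∂(ρ₀.prod ρ₁)
      = ∫ z : Prices, (z.2 : ℝ) * E.G ω (beliefCut β (threshold₁ z)) ∂(ρ₀.prod ρ₁) :=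
    fun ω => by
      refine integral_congr_ae (ae_of_all _ fun z => ?_)
      refine (h.integral_decision hG hβ z ω (f := fun a => profit 1 a z) rfl).trans ?_
      simp [profit, price]
  rw [firmPayoff, Fin.sum_univ_two, hp, hp, ← integral_const_mul, ← integral_const_mul,
    ← integral_add ((hi 0).const_mul _) ((hi 1).const_mul _)]
  refine integral_congr_ae (ae_of_all _ fun z => ?_)
  simp only [weight, posteriorCDF, if_true, if_neg (one_ne_zero : (1 : Fin 2) ≠ 0)]
  ring

/-- Against optimal consumers, the firms play the pricing game for the law of the posterior
belief. -/
lemma IsStageEquilibrium.isPriceEquilibrium [IsProbabilityMeasure ψ₀] [IsProbabilityMeasure ψ₁]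
    (h : IsStageEquilibrium E β ψ₀ ψ₁ d)
    (hG : ∀ ω, Continuous (E.G ω)) (hβ : β ∈ Set.Ioo (0 : ℝ) 1) :
    IsPriceEquilibrium (posteriorCDF (E.G 0) (E.G 1) β) ψ₀ ψ₁ := by
  have hc : Continuous (posteriorCDF (E.G 0) (E.G 1) β) := by
    have := continuous_beliefCut hβ
    have h0 := hG 0
    have h1 := hG 1
    unfold posteriorCDF
    fun_prop
  have hc0 := continuous_threshold₀
  have hc1 := continuous_threshold₁
  constructor
  · intro x
    have h1 := h.firm0 x
    rw [h.firmPayoff_zero hG hβ, h.firmPayoff_zero hG hβ, Measure.dirac_prod,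
      integral_map (by fun_prop) (Continuous.aestronglyMeasurable (by fun_prop))] at h1
    exact h1
  · intro y
    have h1 := h.firm1 y
    rw [h.firmPayoff_one hG hβ, h.firmPayoff_one hG hβ, Measure.prod_dirac,
      integral_map (by fun_prop) (Continuous.aestronglyMeasurable (by fun_prop))] at h1
    exact h1

end Equilibrium

section Purchase

variable {S : Type*} [MeasurableSpace S] (E : SignalStructure S) (p : Profile S) {β : ℝ}

lemma publicKernel_apply (ω : Fin 2) (t : ℕ) (h : History t) :
    publicKernel E p ω t h = ((((p.φ₀ t h).prod (p.φ₁ t h)).prod (E.F ω))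
      ⊗ₘ (p.σ t).sectR h).map publicPart := by
  rw [publicKernel, Kernel.map_apply _ measurable_publicPart, roundKernel,
    Kernel.compProd_apply_eq_compProd_sectR]
  simp only [Kernel.prod_apply, Kernel.const_apply]

variable {t : ℕ} {h : History t}

/-- In equilibrium, the information disclosed by the purchase of a period is the expected
disclosure of the prices. -/
lemma purchaseGap_eq (hG : ∀ ω, Continuous (E.G ω)) (hβ : β ∈ Set.Ioo (0 : ℝ) 1)
    (hE : IsStageEquilibrium E β (p.φ₀ t h) (p.φ₁ t h) ((p.σ t).sectR h)) :
    purchaseGap E p t h = ∫ z, E.disclosure β z ∂((p.φ₀ t h).prod (p.φ₁ t h)) := by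
  have hs : Measurable fun z : Prices × Action => purchaseSign z.2 :=
    (measurable_from_top (f := purchaseSign)).comp measurable_snd
  have hs' : Measurable fun r : Round S => purchaseSign r.2 :=
    (measurable_from_top (f := purchaseSign)).comp measurable_snd
  have hmean : ∀ ω, publicMean E p ω t (fun z => purchaseSign z.2.2) h
      = ∫ z, ((1 - E.G ω (beliefCut β (threshold₀ z))) - E.G ω (beliefCut β (threshold₁ z)))
        ∂((p.φ₀ t h).prod (p.φ₁ t h)) := fun ω => by
    have hi : Integrable (fun r : Round S => purchaseSign r.2)
        ((((p.φ₀ t h).prod (p.φ₁ t h)).prod (E.F ω)) ⊗ₘ (p.σ t).sectR h) :=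
      Integrable.of_bound hs'.aestronglyMeasurable (C := 1)
        (ae_of_all _ fun r => abs_purchaseSign_le r.2)
    rw [publicMean, publicKernel_apply, integral_map measurable_publicPart.aemeasurable
      hs.aestronglyMeasurable]
    simp only [publicPart]
    have hi' : Integrable (fun y => ∫ a, purchaseSign a ∂((p.σ t).sectR h y))
        (((p.φ₀ t h).prod (p.φ₁ t h)).prod (E.F ω)) := by
      refine Integrable.of_bound (C := 1) ?_
        (ae_of_all _ fun y => abs_integral_decision_le abs_purchaseSign_le _)
      exact (StronglyMeasurable.integral_kernel_prod_right'
        (κ := (p.σ t).sectR h) hs'.stronglyMeasurable).aestronglyMeasurable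
    rw [Measure.integral_compProd hi, integral_prod _ hi']
    refine integral_congr_ae (ae_of_all _ fun z => ?_)
    simp only
    rw [hE.integral_decision hG hβ z ω (f := purchaseSign) rfl]
    simp [purchaseSign]
    ring
  have hi : ∀ ω, Integrable (fun z =>
      (1 - E.G ω (beliefCut β (threshold₀ z))) - E.G ω (beliefCut β (threshold₁ z)))
      ((p.φ₀ t h).prod (p.φ₁ t h)) := fun ω =>
    integrable_of_mem_Icc (C := 1) (((measurable_const (a := (1 : ℝ))).sub
      (measurable_G_comp hG hβ continuous_threshold₀ ω)).sub
      (measurable_G_comp hG hβ continuous_threshold₁ ω)) fun z => by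
      have h0 := E.G_nonneg ω
      have h1 := E.G_le_one ω
      rw [abs_le]
      constructor <;> linarith [h0 (beliefCut β (threshold₀ z)), h0 (beliefCut β (threshold₁ z)),
        h1 (beliefCut β (threshold₀ z)), h1 (beliefCut β (threshold₁ z))]
  rw [purchaseGap, hmean, hmean, ← integral_sub (hi 0) (hi 1)]
  refine integral_congr_ae (ae_of_all _ fun z => ?_)
  simp only [SignalStructure.disclosure]
  ring

/-- When one action is taken for sure, it does not depend on the state. -/
lemma publicKernel_eq_of_ae_bestReply (hG : ∀ ω, Continuous (E.G ω)) (hβ : β ∈ Set.Ioo (0 : ℝ) 1)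
    (hE : IsStageEquilibrium E β (p.φ₀ t h) (p.φ₁ t h) ((p.σ t).sectR h)) (b : Action)
    (hb : ∀ᵐ z ∂((p.φ₀ t h).prod (p.φ₁ t h)), ∀ ω, ∀ᵐ s ∂(E.F ω),
      bestReply β z (E.privateBelief s) = b) :
    publicKernel E p 0 t h = publicKernel E p 1 t h := by
  have key : ∀ (ω : Fin 2) (f : Prices × Action → ℝ≥0∞), Measurable f →
      ∫⁻ r, f r ∂(publicKernel E p ω t h)
        = ∫⁻ z, f (z, b) ∂((p.φ₀ t h).prod (p.φ₁ t h)) := fun ω f hf => by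
    have hf' : Measurable fun r : Round S => f (publicPart r) := hf.comp measurable_publicPart
    rw [publicKernel_apply, lintegral_map hf measurable_publicPart,
      Measure.lintegral_compProd hf',
      lintegral_prod _ hf'.lintegral_kernel_prod_right'.aemeasurable]
    refine lintegral_congr_ae ?_
    filter_upwards [hb] with z hz
    have : ∀ᵐ s ∂(E.F ω), ∫⁻ a, f (publicPart ((z, s), a)) ∂((p.σ t).sectR h (z, s))
        = f (z, b) := by
      filter_upwards [hE.ae_decision_eq_dirac hG hβ z ω, hz ω] with s h1 h2
      rw [h1, h2, lintegral_dirac]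
      rfl
    rw [lintegral_congr_ae this]
    simp
  exact Measure.ext_of_lintegral _ fun f hf => (key 0 f hf).trans (key 1 f hf).symm

/-- If firm `0` serves the whole market, nothing is learnt. -/
lemma publicKernel_eq_of_market_capture_zero (hG : ∀ ω, Continuous (E.G ω))
    (hβ : β ∈ Set.Ioo (0 : ℝ) 1)
    (hE : IsStageEquilibrium E β (p.φ₀ t h) (p.φ₁ t h) ((p.σ t).sectR h))
    (hb : ∀ᵐ z ∂((p.φ₀ t h).prod (p.φ₁ t h)), beliefCut β (threshold₀ z) ≤ E.lowerBound) :
    publicKernel E p 0 t h = publicKernel E p 1 t h := by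
  refine publicKernel_eq_of_ae_bestReply E p hG hβ hE (Action.buy 0) ?_
  filter_upwards [hb] with z hz ω
  have h0 : E.F ω {s | E.privateBelief s < beliefCut β (threshold₀ z)} = 0 :=
    (measureReal_eq_zero_iff).1 (E.G_eq_zero hG ω hz)
  have h1 : ∀ᵐ s ∂(E.F ω), ¬ E.privateBelief s < beliefCut β (threshold₀ z) := by
    rw [ae_iff]; simpa only [not_not] using h0
  have h2 : ∀ᵐ s ∂(E.F ω), E.privateBelief s ≠ beliefCut β (threshold₀ z) := by
    rw [ae_iff]
    simpa only [not_not] using E.F_belief_eq hG ω _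
  filter_upwards [h1, h2] with s h1 h2
  exact if_pos (lt_of_le_of_ne (not_lt.1 h1) h2.symm)

/-- If firm `1` serves the whole market, nothing is learnt. -/
lemma publicKernel_eq_of_market_capture_one (hG : ∀ ω, Continuous (E.G ω))
    (hβ : β ∈ Set.Ioo (0 : ℝ) 1)
    (hE : IsStageEquilibrium E β (p.φ₀ t h) (p.φ₁ t h) ((p.σ t).sectR h))
    (hb : ∀ᵐ z ∂((p.φ₀ t h).prod (p.φ₁ t h)), E.upperBound ≤ beliefCut β (threshold₁ z)) :
    publicKernel E p 0 t h = publicKernel E p 1 t h := by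
  refine publicKernel_eq_of_ae_bestReply E p hG hβ hE (Action.buy 1) ?_
  filter_upwards [hb] with z hz ω
  have h0 : (E.F ω).real {s | E.privateBelief s < beliefCut β (threshold₁ z)} = 1 :=
    E.G_eq_one hG ω hz
  have h1 : ∀ᵐ s ∂(E.F ω), E.privateBelief s < beliefCut β (threshold₁ z) := by
    rw [ae_iff, ← Set.compl_ofPred, ← measureReal_eq_zero_iff,
      probReal_compl_eq_one_sub (E.measurableSet_belief_lt _), h0, sub_self]
  filter_upwards [h1] with s h1
  have h2 := h1.trans_le (beliefCut_mono hβ (threshold₁_le_threshold₀ z))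
  rw [bestReply, if_neg (not_lt.2 h2.le), if_pos h1]

end Purchase

/-! ### Learning and its failure -/

section Learning

variable {S : Type*} [MeasurableSpace S] {E : SignalStructure S}

/-- Learning holds if purchases disclose information in every pricing equilibrium, uniformly at
interior beliefs. -/
lemma asymptoticLearning_of_disclosure (hG : ∀ ω, Continuous (E.G ω))
    (h : ∀ a b : ℝ, 0 < a → b < 1 → ∃ δ > 0, ∀ β ∈ Set.Icc a b, ∀ ψ₀ ψ₁ : Measure unitInterval,
      IsProbabilityMeasure ψ₀ → IsProbabilityMeasure ψ₁ →
      IsPriceEquilibrium (posteriorCDF (E.G 0) (E.G 1) β) ψ₀ ψ₁ →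
      δ ≤ ∫ z, E.disclosure β z ∂(ψ₀.prod ψ₁)) :
    AsymptoticLearning E := by
  intro μ₀ hμ p hp
  refine learningHolds_of_limitBelief E p hμ (limitBelief_eq_zero_or_one E p hμ ?_)
  intro a b ha _ hb
  obtain ⟨δ, hδ, hd⟩ := h a b ha hb
  refine ⟨δ, hδ, fun t => ?_⟩
  filter_upwards [hp t] with x hx hβ
  have hβ' : publicBelief E p μ₀ t x ∈ Set.Ioo (0 : ℝ) 1 :=
    ⟨ha.trans_le hβ.1, hβ.2.trans_lt hb⟩
  rw [purchaseGap_eq E p hG hβ' hx]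
  exact hd _ hβ _ _ inferInstance inferInstance (hx.isPriceEquilibrium hG hβ')

/-- Learning fails if one of the firms serves the whole market whenever the public belief is close
to one of the point beliefs. -/
lemma asymptoticLearningNeverHolds_of_market_capture (hG : ∀ ω, Continuous (E.G ω))
    (h : (∃ e > 0, ∀ β ∈ Set.Ioo 0 e, ∀ ψ₀ ψ₁ : Measure unitInterval, IsProbabilityMeasure ψ₀ →
        IsProbabilityMeasure ψ₁ → IsPriceEquilibrium (posteriorCDF (E.G 0) (E.G 1) β) ψ₀ ψ₁ →
        ∀ᵐ z ∂(ψ₀.prod ψ₁), E.upperBound ≤ beliefCut β (threshold₁ z)) ∨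
      ∃ e < 1, ∀ β ∈ Set.Ioo e 1, ∀ ψ₀ ψ₁ : Measure unitInterval, IsProbabilityMeasure ψ₀ →
        IsProbabilityMeasure ψ₁ → IsPriceEquilibrium (posteriorCDF (E.G 0) (E.G 1) β) ψ₀ ψ₁ →
        ∀ᵐ z ∂(ψ₀.prod ψ₁), beliefCut β (threshold₀ z) ≤ E.lowerBound) :
    AsymptoticLearningNeverHolds E := by
  intro μ₀ hμ p hp
  refine ⟨?_, limitBelief_interior E p hμ (h.imp ?_ ?_)⟩
  · filter_upwards [tendsto_publicBelief E p hμ] with x hx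
    exact ⟨_, hx⟩
  · rintro ⟨e, he, hcap⟩
    refine limitBelief_ne_of_stuck E p hμ (D := Set.Iio e) isOpen_Iio he (by simp) fun t => ?_
    filter_upwards [hp t, publicBelief_mem_Ioo E p hμ t] with x hx hβ hlt
    exact publicKernel_eq_of_market_capture_one E p hG hβ hx
      (hcap _ ⟨hβ.1, hlt⟩ _ _ inferInstance inferInstance (hx.isPriceEquilibrium hG hβ))
  · rintro ⟨e, he, hcap⟩
    refine limitBelief_ne_of_stuck E p hμ (D := Set.Ioi e) isOpen_Ioi he (by simp) fun t => ?_
    filter_upwards [hp t, publicBelief_mem_Ioo E p hμ t] with x hx hβ hlt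
    exact publicKernel_eq_of_market_capture_zero E p hG hβ hx
      (hcap _ ⟨hlt, hβ.2⟩ _ _ inferInstance inferInstance (hx.isPriceEquilibrium hG hβ))

end Learning

end PricedHerding

end

open PricedHerding
theorem theorem1 {S : Type*} [MeasurableSpace S] (E : SignalStructure S)
    (g : Fin 2 → ℝ → ℝ) (hg : E.HasContinuousDensities g) :
    (E.Unbounded ∨ (E.Bounded ∧ E.VanishingLikelihood g) → AsymptoticLearning E) ∧
    (E.Bounded ∧ ¬ E.VanishingLikelihood g → AsymptoticLearningNeverHolds E) := by
  have hG : ∀ ω, Continuous (E.G ω) := hg.continuous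
  have h01 : ∀ ω x, E.G ω x ∈ Set.Icc (0 : ℝ) 1 := fun ω x => ⟨E.G_nonneg ω x, E.G_le_one ω x⟩
  constructor
  · rintro (hE | ⟨hE, hV⟩)
    · exact asymptoticLearning_of_disclosure hG fun a b ha hb => hE.exists_disclosure_ge hG ha hb
    · exact asymptoticLearning_of_disclosure hG fun a b ha hb =>
        hV.exists_disclosure_ge hE hg ha hb
  · rintro ⟨hE, hV⟩
    have hlu := SignalStructure.lowerBound_lt_upperBound hG
    refine asymptoticLearningNeverHolds_of_market_capture hG ?_
    by_cases h1 : g 1 E.lowerBound = 0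
    · left
      have h0 : g 0 E.upperBound ≠ 0 := fun h0 => hV ⟨h1, h0⟩
      obtain ⟨c, hc, η, hη, hle, hslope⟩ := SignalStructure.exists_slope_upper hg hE.2 h0
      exact exists_forall_market_capture_one (E.G_mono 0) (E.G_mono 1) (hG 0) (hG 1)
        (h01 0) (h01 1) hE.2 (hE.1.le.trans hle) hc hη (fun x => SignalStructure.G_eq_one hG 0)
        (fun x => SignalStructure.G_eq_one hG 1) hslope
    · right
      obtain ⟨c, hc, η, hη, hle, hslope⟩ := SignalStructure.exists_slope_lower hg hE.1 h1
      exact exists_forall_market_capture_zero (E.G_mono 0) (E.G_mono 1) (hG 0) (hG 1)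
        (h01 0) (h01 1) hE.1 (hle.trans hE.2.le) hc hη (fun x => SignalStructure.G_eq_zero hG 0)
        (fun x => SignalStructure.G_eq_zero hG 1) hslope
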